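/- There exists an absolute constant $C>0$ such that the following holds. Let $d,n\in\mathbb{N}$ and $0<\varepsilon\le 1/2$ be such that $n\ge 2^{Cd^3}\log(1/\varepsilon)^{Cd}$, and let $k_1,\dots,k_m$ be nonnegative integers with $k_1+\dots+k_m=n$. Let $\mathcal{U}=\mathcal{U}_{k_1,\dots,k_m}$ be the multi-slice, i.e. the set of all $x\in[m]^n$ that have, for every $j\in[m]$, exactly $k_j$ coordinates equal to $j$, with the uniform probability measure; $L_2$ norms are taken with respect to uniform measures. Let $f\colon\mathcal{U}\to\{0,1\}$ be $(2d,\varepsilon)$-global, meaning that for every $A\subseteq[n]$ with $|A|=2d$ and every $\alpha\in[m]^A$ for which $\mathcal{U}_{A\to\alpha}=\{x\in\mathcal{U}: x_A=\alpha\}$ is nonempty, the restriction $f_{A\to\alpha}$ of $f$ to $\mathcal{U}_{A\to\alpha}$ satisfies $\|f_{A\to\alpha}\|_2\le\varepsilon$. Then $$\|f^{\le d}\|_2^2\le 2^{Cd^4}\,\varepsilon^4\,\log^{Cd}(1/\varepsilon),$$ where $f^{\le d}$ is the orthogonal projection of $f$ in $L^2(\mathcal{U})$ onto the linear span of the $d$-juntas,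 i.e. of the functions $\mathcal{U}\to\mathbb{R}$ that depend only on the coordinates in some set $A\subseteq[n]$ with $|A|\le d$. Here $\log$ is the natural logarithm. -/

import Mathlib

open scoped BigOperators

/-- The multi-slice `𝒰_{k₁,…,k_m}` of dimension `n`: the vectors in `[m]^n` having, for every `j`,
exactly `k j` coordinates equal to `j`. -/
def MultiSlice (n : ℕ) {m : ℕ} (k : Fin m → ℕ) : Type :=
  {x : Fin n → Fin m // ∀ j, (Finset.univ.filter (fun i => x i = j)).card = k j}

namespace MultiSlice

instance instFintype (n : ℕ) {m : ℕ} (k : Fin m → ℕ) : Fintype (MultiSlice n k) :=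
  inferInstanceAs
    (Fintype {x : Fin n → Fin m // ∀ j, (Finset.univ.filter (fun i => x i = j)).card = k j})

/-- The `L²` norm with respect to the uniform probability measure on a finite space. -/
noncomputable def l2Norm {Ω : Type*} [Fintype Ω] (f : Ω → ℝ) : ℝ :=
  Real.sqrt (𝔼 x, f x ^ 2)

/-- The points `x` of the multi-slice with `x_A = α`. Forgetting the coordinates in `A` identifies
this set with the smaller multi-slice on the coordinates outside `A` (it is empty when `α` uses some
symbol `j` more than `k j` times). -/
abbrev Sub {n m : ℕ} (k : Fin m → ℕ) (A : Finset (Fin n)) (α : A → Fin m) : Type :=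
  {x : MultiSlice n k // ∀ i : A, x.1 i = α i}

/-- The restriction `f_{A → α}`. -/
def restrict {n m : ℕ} {k : Fin m → ℕ} (f : MultiSlice n k → ℝ)
    (A : Finset (Fin n)) (α : A → Fin m) : Sub k A α → ℝ :=
  fun z => f z.1

/-- `f` is `(d, ε)`-global: `‖f_{A → α}‖₂ ≤ ε` for every `d`-restriction `(A, α)`.
An `α` with empty restricted domain imposes nothing, as the norm is then `0`. -/
def IsGlobal {n m : ℕ} {k : Fin m → ℕ} (d : ℕ) (ε : ℝ) (f : MultiSlice n k → ℝ) : Prop :=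
  ∀ (A : Finset (Fin n)) (α : A → Fin m), A.card = d → l2Norm (restrict f A α) ≤ ε

/-- `f` is a `d`-junta: it depends only on `x_A` for some set `A` of at most `d` coordinates. -/
def IsJunta {n m : ℕ} {k : Fin m → ℕ} (d : ℕ) (f : MultiSlice n k → ℝ) : Prop :=
  ∃ A : Finset (Fin n), A.card ≤ d ∧
    ∃ g : (A → Fin m) → ℝ, ∀ x : MultiSlice n k, f x = g (fun i => x.1 i)

/-- The space `V_d` of functions of degree at most `d`: the span of the `d`-juntas. -/
def degreeSpace (n : ℕ) {m : ℕ} (k : Fin m → ℕ) (d : ℕ) : Submodule ℝ (MultiSlice n k → ℝ) :=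
  Submodule.span ℝ {f | IsJunta d f}

/-- `V_d` inside the Euclidean space of functions on the multi-slice. -/
noncomputable def degreeSpaceL2 (n : ℕ) {m : ℕ} (k : Fin m → ℕ) (d : ℕ) :
    Submodule ℝ (EuclideanSpace ℝ (MultiSlice n k)) :=
  (degreeSpace n k d).map (WithLp.linearEquiv 2 ℝ (MultiSlice n k → ℝ)).symm.toLinearMap

/-- `f^{≤ d}`, the orthogonal projection of `f` onto `V_d`. The Euclidean inner product is a positive
multiple of the inner product `𝔼 x, f x * g x`, so both give the same projection
(see `lowDegreePart_mem` and `expect_sub_lowDegreePart_mul`). -/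
noncomputable def lowDegreePart {n m : ℕ} {k : Fin m → ℕ} (d : ℕ) (f : MultiSlice n k → ℝ) :
    MultiSlice n k → ℝ :=
  WithLp.ofLp ((degreeSpaceL2 n k d).starProjection (WithLp.toLp 2 f))

theorem lowDegreePart_mem {n m : ℕ} {k : Fin m → ℕ} (d : ℕ) (f : MultiSlice n k → ℝ) :
    lowDegreePart d f ∈ degreeSpace n k d := by
  have h := (degreeSpaceL2 n k d).starProjection_apply_mem (WithLp.toLp 2 f)
  obtain ⟨g, hg, hgf⟩ := h
  have : lowDegreePart d f = g := by
    unfold lowDegreePart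
    rw [← hgf]
    rfl
  rw [this]
  exact hg

theorem expect_sub_lowDegreePart_mul {n m : ℕ} {k : Fin m → ℕ} (d : ℕ) (f g : MultiSlice n k → ℝ)
    (hg : g ∈ degreeSpace n k d) : 𝔼 x, (f x - lowDegreePart d f x) * g x = 0 := by
  have h := (degreeSpaceL2 n k d).starProjection_inner_eq_zero (WithLp.toLp 2 f) (WithLp.toLp 2 g)
    ⟨g, hg, rfl⟩
  have h2 : ∑ x, (f x - lowDegreePart d f x) * g x = 0 := by
    rw [← h, PiLp.inner_apply]
    refine Finset.sum_congr rfl fun x _ => ?_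
    simp [lowDegreePart, mul_comm]
  rw [Finset.expect, h2, smul_zero]

end MultiSlice

/-!
The multi-slice is a quotient of the symmetric group: for a point `x₀` of it, `π ↦ x₀ ∘ π` carries
uniform measure to uniform measure, juntas to juntas and averages over restrictions to averages over
restrictions (`MultiSlice.card_mul_sum_act`). So it suffices to bound, for a Boolean function `f` on
`Equiv.Perm Ω` with `#Ω = n`, all of whose averages given the values at `d` or fewer points are at
most `μ = ε ^ 2`, the part of `f` of degree at most `d`. In degree `0` this is immediate. Otherwise
the part of degree at most `d` is split into its parts `u` of pure degree, each of which is bounded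
by `μ ^ 2` up to powers of `d` and `log (1 / μ)` (`PermLevel.expect_pure_sq_le`).

For `d` disjoint pairs of points of `Ω`, take the conditional averages of `f` given the values at one
point of each pair, and antisymmetrize within each pair (`PermLevel.diffBoth`). Let `h` be the sum of
these differences over all choices of `d` pairs among `N = n / 4` random disjoint pairs. The
correlation of `f` with `h` (`PermLevel.corr`) is compared with `u` from below and with `μ` from
above.

*From above* (`PermLevel.weightSum_le`). By Hölder's inequality with exponent `2p`, where `p` is of
order `log (1 / μ)`, the square of the correlation is at most `3 μ ^ 2` times the square of the
`2p`-norm of `h`. Random exchanges within the pairs do not change the distribution of the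
permutation, and they turn `h` into a homogeneous polynomial of degree `d` in random signs. Bonami's
lemma, which for even moments follows from a two-point inequality, replaces `h ^ 2` by the sum `W` of
the squares of the differences. Up to factors `16 ^ d` the points and values involved may be taken
independent; then the `p`-th moment of the nonnegative statistic `W` is controlled by its conditional
expectations given a few of the pairs (`ProductSpace.expect_sum_pow_le`). These conditional
expectations belong to restrictions of `f` at lower levels, to which induction on `d` applies, except
for the mean of `W` itself. But that mean is in turn at most `2 ^ d` times the correlation, so that
the inequality is self-improving. No hypercontractivity on the symmetric group is needed.

*From below* (`PermLevel.choose_mul_expect_sq_le_corr`). The correlation is a sum of squares of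
one-sided differences. These annihilate the part of `f` of degree less than `d`, and do not see the
part orthogonal to degree `d`, so `f` may be replaced by `u`. The conditional averages of `u` sum to
zero over each position, whence the cross terms in the squares vanish, and the correlation is at
least half the sum of `⟪u, A u⟫`, with `A` an average of conditional expectations given the values at
`d` points (`PermLevel.avgOp`). The operator `A` is symmetric, preserves the juntas on any given set
of points, and on the juntas on a set of at most `d` points it is at least `n ^ (-d)`; by the
spectral theorem it is at least `n ^ (-d)` on their sum (`PermLevel.le_inner_of_mem_iSup`). There are
`N.choose d` terms, so the powers of `n` cancel.
-/

/-! ### Averages over product spaces -/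

namespace ProductSpace

set_option linter.unusedSectionVars false

variable {κ Z : Type} [Fintype κ] [DecidableEq κ] [Fintype Z]

theorem expect_mono {ι : Type*} [Fintype ι] {f g : ι → ℝ} (h : ∀ x, f x ≤ g x) :
    𝔼 x, f x ≤ 𝔼 x, g x :=
  Finset.expect_le_expect fun x _ => h x

theorem expect_nonneg {ι : Type*} [Fintype ι] {f : ι → ℝ} (h : ∀ x, 0 ≤ f x) : 0 ≤ 𝔼 x, f x :=
  Finset.expect_nonneg fun x _ => h x

theorem sq_expect_le {ι : Type*} [Fintype ι] [Nonempty ι] (f : ι → ℝ) :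
    (𝔼 x, f x) ^ 2 ≤ 𝔼 x, f x ^ 2 := by
  have h := Finset.expect_mul_sq_le_sq_mul_sq (Finset.univ : Finset ι) (fun _ => (1 : ℝ)) f
  simpa [Fintype.expect_const] using h

/-- Replacing the coordinates outside `R` by those of an independent copy does not change the
average. -/
theorem expect_piecewise (R : Finset κ) (φ : (κ → Z) → ℝ) :
    𝔼 z, 𝔼 z', φ (R.piecewise z z') = 𝔼 z, φ z := by
  classical
  rcases isEmpty_or_nonempty (κ → Z) with h | h
  · simp [Finset.univ_eq_empty]
  have h1 : 𝔼 z, 𝔼 z', φ (R.piecewise z z')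
      = 𝔼 q : (κ → Z) × (κ → Z), φ (R.piecewise q.1 q.2) := by
    rw [← Finset.univ_product_univ, Finset.expect_product]
  have h2 : 𝔼 q : (κ → Z) × (κ → Z), φ (R.piecewise q.1 q.2)
      = 𝔼 q : (κ → Z) × (κ → Z), φ q.1 := by
    refine Fintype.expect_bijective
      (fun q : (κ → Z) × (κ → Z) => (R.piecewise q.1 q.2, R.piecewise q.2 q.1))
      (Function.Involutive.bijective ?_) _ _ fun q => rfl
    rintro ⟨a, b⟩
    ext i <;> by_cases hi : i ∈ R <;> simp [Finset.piecewise, hi]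
  rw [h1, h2, ← Finset.univ_product_univ, Finset.expect_product]
  simp

theorem expect_agree [DecidableEq Z] [Nonempty Z] (S : Finset κ) (z : κ → Z) :
    𝔼 z' : κ → Z, (if ∀ s ∈ S, z' s = z s then (1 : ℝ) else 0)
      = ((Fintype.card Z : ℝ) ^ S.card)⁻¹ := by
  classical
  have hZ : (Fintype.card Z : ℝ) ≠ 0 := by exact_mod_cast Fintype.card_ne_zero
  rw [Fintype.expect_eq_sum_div_card, Finset.sum_boole]
  have h1 : (Finset.univ.filter fun z' : κ → Z => ∀ s ∈ S, z' s = z s)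
      = Fintype.piFinset fun s => if s ∈ S then {z s} else Finset.univ := by
    ext z'
    simp only [Finset.mem_filter, Finset.mem_univ, true_and, Fintype.mem_piFinset]
    refine forall_congr' fun s => ?_
    by_cases hs : s ∈ S <;> simp [hs]
  have h2 : (Finset.univ.filter fun z' : κ → Z => ∀ s ∈ S, z' s = z s).card
      * Fintype.card Z ^ S.card = Fintype.card (κ → Z) := by
    rw [h1, Fintype.card_piFinset, Fintype.card_fun,
      ← Finset.card_compl_add_card S, pow_add]
    congr 1
    rw [← Finset.prod_mul_prod_compl S, Finset.prod_congr rfl (g := fun _ => 1),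
      Finset.prod_congr (s₁ := Sᶜ) rfl (g := fun _ => Fintype.card Z)]
    · simp
    · intro s hs; rw [Finset.mem_compl] at hs; simp [hs]
    · intro s hs; simp [hs]
  rw [div_eq_iff (by exact_mod_cast Fintype.card_ne_zero), ← h2]
  push_cast
  field_simp

/-! ### Moments of nonnegative statistics of independent variables -/

theorem card_filter_powerset_le (U : Finset κ) (d : ℕ) :
    (U.powerset.filter fun R => R.card ≤ d).card ≤ (U.card + 1) ^ d := by
  have h1 : U.powerset.filter (fun R => R.card ≤ d)
      = (Finset.range (d + 1)).biUnion fun r => U.powersetCard r := by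
    ext R
    simp only [Finset.mem_filter, Finset.mem_powerset, Finset.mem_biUnion, Finset.mem_range,
      Finset.mem_powersetCard]
    constructor
    · rintro ⟨h, h'⟩; exact ⟨R.card, by omega, h, rfl⟩
    · rintro ⟨r, h, h', rfl⟩; exact ⟨h', by omega⟩
  rw [h1]
  refine Finset.card_biUnion_le.trans ?_
  rw [add_pow]
  refine Finset.sum_le_sum fun r hr => ?_
  rw [Finset.card_powersetCard, one_pow, mul_one, Nat.cast_id]
  have : 0 < d.choose r := Nat.choose_pos (by simpa [Nat.lt_succ_iff] using hr)
  exact (Nat.choose_le_pow _ _).trans (Nat.le_mul_of_pos_right _ this)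

/-- Multiplying by one more factor of the statistic: if `P` depends only on the coordinates in `U`,
a set `S` of the family interacts with `P` only through `R = S ∩ U`, and there are at most
`(#U + 1) ^ d` choices of `R`. -/
theorem sum_expect_mul_le {𝒮 : Finset (Finset κ)} {d : ℕ} (h𝒮 : ∀ S ∈ 𝒮, S.card ≤ d)
    {w : Finset κ → (κ → Z) → ℝ} (hw0 : ∀ S z, 0 ≤ w S z) (hw : ∀ S, DependsOn (w S) S)
    {Λ : ℝ} (hΛ : ∀ R z, ∑ S ∈ 𝒮.filter (R ⊆ ·), 𝔼 z', w S (R.piecewise z z') ≤ Λ)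
    (U : Finset κ) {P : (κ → Z) → ℝ} (hP0 : ∀ z, 0 ≤ P z) (hP : DependsOn P U) :
    ∑ S ∈ 𝒮, 𝔼 z, P z * w S z ≤ (U.card + 1 : ℝ) ^ d * Λ * 𝔼 z, P z := by
  classical
  rcases isEmpty_or_nonempty (κ → Z) with hE | hE
  · simp [Finset.univ_eq_empty]
  have hΛ0 : 0 ≤ Λ := le_trans
    (Finset.sum_nonneg fun S _ => expect_nonneg fun z' => hw0 _ _) (hΛ ∅ (Classical.arbitrary _))
  have hexp : ∀ S, 𝔼 z, P z * w S z = 𝔼 z, P z * 𝔼 z', w S ((S ∩ U).piecewise z z') := by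
    intro S
    rw [← expect_piecewise U]
    refine Finset.expect_congr rfl fun z _ => ?_
    rw [Finset.mul_expect]
    refine Finset.expect_congr rfl fun z' _ => ?_
    rw [hP (y := z) (by intro i hi; simp [Finset.piecewise, Finset.mem_coe.1 hi])]
    congr 1
    refine hw S fun i hi => ?_
    have hi' : i ∈ S := hi
    simp [Finset.piecewise, hi']
  calc ∑ S ∈ 𝒮, 𝔼 z, P z * w S z
      = ∑ S ∈ 𝒮, 𝔼 z, P z * 𝔼 z', w S ((S ∩ U).piecewise z z') :=
        Finset.sum_congr rfl fun S _ => hexp S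
    _ = ∑ R ∈ U.powerset.filter (fun R => R.card ≤ d), ∑ S ∈ 𝒮.filter (fun S => S ∩ U = R),
          𝔼 z, P z * 𝔼 z', w S ((S ∩ U).piecewise z z') := by
        refine (Finset.sum_fiberwise_of_maps_to (fun S hS => ?_) _).symm
        simp only [Finset.mem_filter, Finset.mem_powerset]
        exact ⟨Finset.inter_subset_right,
          (Finset.card_le_card Finset.inter_subset_left).trans (h𝒮 S hS)⟩
    _ ≤ ∑ R ∈ U.powerset.filter (fun R => R.card ≤ d), Λ * 𝔼 z, P z := by
        refine Finset.sum_le_sum fun R _ => ?_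
        have : ∑ S ∈ 𝒮.filter (fun S => S ∩ U = R),
            𝔼 z, P z * 𝔼 z', w S ((S ∩ U).piecewise z z')
            ≤ ∑ S ∈ 𝒮.filter (R ⊆ ·), 𝔼 z, P z * 𝔼 z', w S (R.piecewise z z') := by
          rw [Finset.sum_congr rfl (g := fun S => 𝔼 z, P z * 𝔼 z', w S (R.piecewise z z'))]
          · refine Finset.sum_le_sum_of_subset_of_nonneg ?_ fun S _ _ =>
              expect_nonneg fun z => mul_nonneg (hP0 z) (expect_nonneg fun z' => hw0 _ _)
            intro S hS
            simp only [Finset.mem_filter] at hS ⊢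
            exact ⟨hS.1, hS.2 ▸ Finset.inter_subset_left⟩
          · intro S hS
            rw [(Finset.mem_filter.1 hS).2]
        refine this.trans ?_
        rw [← Finset.expect_sum_comm, Finset.mul_expect]
        refine expect_mono fun z => ?_
        rw [← Finset.mul_sum, mul_comm]
        exact mul_le_mul_of_nonneg_right (hΛ R z) (hP0 z)
    _ ≤ (U.card + 1 : ℝ) ^ d * Λ * 𝔼 z, P z := by
        rw [Finset.sum_const, nsmul_eq_mul, mul_assoc]
        refine mul_le_mul_of_nonneg_right ?_ (mul_nonneg hΛ0 (expect_nonneg hP0))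
        exact_mod_cast card_filter_powerset_le U d

/-- The induction for the moment bound: the factor `P` collects the terms already chosen, and depends
on the coordinates in their union `U`. -/
theorem expect_mul_sum_pow_le {𝒮 : Finset (Finset κ)} {d : ℕ} (h𝒮 : ∀ S ∈ 𝒮, S.card ≤ d)
    {w : Finset κ → (κ → Z) → ℝ} (hw0 : ∀ S z, 0 ≤ w S z) (hw : ∀ S, DependsOn (w S) S)
    {Λ : ℝ} (hΛ0 : 0 ≤ Λ)
    (hΛ : ∀ R z, ∑ S ∈ 𝒮.filter (R ⊆ ·), 𝔼 z', w S (R.piecewise z z') ≤ Λ) (m : ℕ) (q : ℕ) :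
    ∀ (U : Finset κ) (P : (κ → Z) → ℝ), (∀ z, 0 ≤ P z) → DependsOn P U → U.card + d * q ≤ m →
      𝔼 z, P z * (∑ S ∈ 𝒮, w S z) ^ q ≤ ((m + 1 : ℝ) ^ d * Λ) ^ q * 𝔼 z, P z := by
  induction q with
  | zero => intro U P _ _ _; simp
  | succ q ih =>
    intro U P hP0 hP hU
    have hstep : 𝔼 z, P z * (∑ S ∈ 𝒮, w S z) ^ (q + 1)
        = ∑ S ∈ 𝒮, 𝔼 z, (P z * w S z) * (∑ S ∈ 𝒮, w S z) ^ q := by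
      rw [← Finset.expect_sum_comm]
      refine Finset.expect_congr rfl fun z _ => ?_
      rw [← Finset.sum_mul, ← Finset.mul_sum]; ring
    rw [hstep]
    calc ∑ S ∈ 𝒮, 𝔼 z, (P z * w S z) * (∑ S ∈ 𝒮, w S z) ^ q
        ≤ ∑ S ∈ 𝒮, ((m + 1 : ℝ) ^ d * Λ) ^ q * 𝔼 z, P z * w S z := by
          refine Finset.sum_le_sum fun S hS => ?_
          refine ih (U ∪ S) (fun z => P z * w S z) (fun z => mul_nonneg (hP0 z) (hw0 S z)) ?_ ?_
          · intro x y hxy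
            have h1 : P x = P y := hP fun i hi => hxy i (by simp_all)
            have h2 : w S x = w S y := hw S fun i hi => hxy i (by simp_all)
            simp only [h1, h2]
          · have := Finset.card_union_le U S
            have := h𝒮 S hS
            rw [Nat.mul_succ] at hU
            omega
      _ = ((m + 1 : ℝ) ^ d * Λ) ^ q * ∑ S ∈ 𝒮, 𝔼 z, P z * w S z := by rw [Finset.mul_sum]
      _ ≤ ((m + 1 : ℝ) ^ d * Λ) ^ q * ((U.card + 1 : ℝ) ^ d * Λ * 𝔼 z, P z) :=
          mul_le_mul_of_nonneg_left (sum_expect_mul_le h𝒮 hw0 hw hΛ U hP0 hP) (by positivity)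
      _ ≤ ((m + 1 : ℝ) ^ d * Λ) ^ q * ((m + 1 : ℝ) ^ d * Λ * 𝔼 z, P z) := by
          have hU' : (U.card : ℝ) ≤ m := by exact_mod_cast (by omega : U.card ≤ m)
          have := expect_nonneg hP0
          gcongr
      _ = _ := by ring

/-- Moments of a nonnegative statistic `∑ S, w S` of independent variables, where `w S` depends only
on the variables in `S`, are controlled by its conditional expectations given few variables. -/
theorem expect_sum_pow_le {𝒮 : Finset (Finset κ)} {d : ℕ} (h𝒮 : ∀ S ∈ 𝒮, S.card ≤ d)
    {w : Finset κ → (κ → Z) → ℝ} (hw0 : ∀ S z, 0 ≤ w S z) (hw : ∀ S, DependsOn (w S) S)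
    {Λ : ℝ} (hΛ0 : 0 ≤ Λ)
    (hΛ : ∀ R z, ∑ S ∈ 𝒮.filter (R ⊆ ·), 𝔼 z', w S (R.piecewise z z') ≤ Λ) (p : ℕ) :
    𝔼 z, (∑ S ∈ 𝒮, w S z) ^ p ≤ (((d * p : ℕ) + 1 : ℝ) ^ d * Λ) ^ p := by
  rcases isEmpty_or_nonempty (κ → Z) with hE | hE
  · simp only [Finset.univ_eq_empty, Finset.expect_empty]; positivity
  have := expect_mul_sum_pow_le h𝒮 hw0 hw hΛ0 hΛ (d * p) p ∅ (fun _ => 1) (fun _ => zero_le_one)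
    (fun _ _ _ => rfl) (by simp)
  simpa [Fintype.expect_const] using this

/-! ### Even moments of multilinear polynomials in random signs -/

/-- The character `∏ s ∈ S, (-1) ^ c s` of the group of Boolean vectors. -/
def sgn (S : Finset κ) (c : κ → Bool) : ℝ := ∏ s ∈ S, if c s then -1 else 1

theorem sgn_mul_self (S : Finset κ) (c : κ → Bool) : sgn S c * sgn S c = 1 := by
  rw [sgn, ← Finset.prod_mul_distrib]
  exact Finset.prod_eq_one fun s _ => by split_ifs <;> norm_num

theorem sgn_sq (S : Finset κ) (c : κ → Bool) : sgn S c ^ 2 = 1 := by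
  rw [sq, sgn_mul_self]

theorem sgn_xor (S : Finset κ) (c b : κ → Bool) :
    sgn S (fun s => xor (c s) (b s)) = sgn S c * sgn S b := by
  rw [sgn, sgn, sgn, ← Finset.prod_mul_distrib]
  exact Finset.prod_congr rfl fun s _ => by cases c s <;> cases b s <;> simp

theorem sgn_congr {S : Finset κ} {c b : κ → Bool} (h : ∀ s ∈ S, c s = b s) : sgn S c = sgn S b :=
  Finset.prod_congr rfl fun s hs => by rw [h s hs]

/-- Flipping the coordinate `s`. -/
def flipAt (s : κ) (c : κ → Bool) : κ → Bool := Function.update c s (!c s)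

theorem flipAt_involutive (s : κ) : Function.Involutive (flipAt s) := by
  intro c; ext i; by_cases h : i = s <;> simp [flipAt, h]

theorem sgn_flipAt_of_mem {S : Finset κ} {s : κ} (hs : s ∈ S) (c : κ → Bool) :
    sgn S (flipAt s c) = -sgn S c := by
  rw [sgn, sgn, ← Finset.mul_prod_erase S _ hs, ← Finset.mul_prod_erase S _ hs]
  have : ∏ x ∈ S.erase s, (if flipAt s c x then (-1 : ℝ) else 1)
      = ∏ x ∈ S.erase s, if c x then -1 else 1 :=
    Finset.prod_congr rfl fun x hx => by simp [flipAt, Finset.ne_of_mem_erase hx]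
  rw [this]
  cases h : c s <;> simp [flipAt, h]

theorem sgn_flipAt_of_notMem {S : Finset κ} {s : κ} (hs : s ∉ S) (c : κ → Bool) :
    sgn S (flipAt s c) = sgn S c :=
  sgn_congr fun x hx => by simp [flipAt, ne_of_mem_of_not_mem hx hs]

theorem expect_flipAt (s : κ) (φ : (κ → Bool) → ℝ) : 𝔼 c, φ (flipAt s c) = 𝔼 c, φ c :=
  Fintype.expect_bijective _ (flipAt_involutive s).bijective _ _ fun _ => rfl

theorem expect_eq_zero_of_flipAt (s : κ) (φ : (κ → Bool) → ℝ) (h : ∀ c, φ (flipAt s c) = -φ c) :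
    𝔼 c, φ c = 0 := by
  have h1 := expect_flipAt s φ
  simp_rw [h, Finset.expect_neg_distrib] at h1
  linarith

/-- The two-point inequality at exponents `q + 1 ≤ p`, together with the bound for the difference of
the two powers that makes the induction on `q` work. -/
theorem two_point_aux {x y K : ℝ} {p : ℕ} (hK : 4 * (p : ℝ) ≤ K) (q : ℕ) (hq : q < p) :
    (x + y) ^ (2 * (q + 1)) + (x - y) ^ (2 * (q + 1)) ≤ 2 * (x ^ 2 + K * y ^ 2) ^ (q + 1) ∧
    |(x + y) ^ (2 * (q + 1)) - (x - y) ^ (2 * (q + 1))|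
      ≤ 4 * (q + 1) * |x * y| * (x ^ 2 + K * y ^ 2) ^ q := by
  have hp1 : (1 : ℝ) ≤ p := by exact_mod_cast (by omega : 1 ≤ p)
  induction q with
  | zero =>
    constructor
    · norm_num; nlinarith [sq_nonneg y]
    · have : (x + y) ^ (2 * (0 + 1)) - (x - y) ^ (2 * (0 + 1)) = 4 * (x * y) := by ring
      rw [this, abs_mul]; norm_num
  | succ q ih =>
    obtain ⟨ha, hb⟩ := ih (by omega)
    set D := x ^ 2 + K * y ^ 2 with hD
    have hqp : (q : ℝ) + 2 ≤ p := by exact_mod_cast (by omega : q + 2 ≤ p)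
    have hK0 : 0 ≤ K := by linarith
    have hD0 : 0 ≤ D := by positivity
    have hAD : x ^ 2 + y ^ 2 ≤ D := by rw [hD]; nlinarith [sq_nonneg y]
    set a := (x + y) ^ (2 * (q + 1)) + (x - y) ^ (2 * (q + 1)) with haD
    set b := (x + y) ^ (2 * (q + 1)) - (x - y) ^ (2 * (q + 1)) with hbD
    have ha0 : 0 ≤ a := add_nonneg (Even.pow_nonneg (by simp) _) (Even.pow_nonneg (by simp) _)
    have e1 : (x + y) ^ (2 * (q + 1 + 1)) + (x - y) ^ (2 * (q + 1 + 1))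
        = (x ^ 2 + y ^ 2) * a + 2 * (x * y) * b := by rw [haD, hbD]; ring
    have e2 : (x + y) ^ (2 * (q + 1 + 1)) - (x - y) ^ (2 * (q + 1 + 1))
        = (x ^ 2 + y ^ 2) * b + 2 * (x * y) * a := by rw [haD, hbD]; ring
    have hDq : 0 ≤ D ^ q := pow_nonneg hD0 q
    constructor
    · rw [e1]
      have h1 : 2 * (x * y) * b ≤ 2 * |x * y| * (4 * (q + 1) * |x * y| * D ^ q) := by
        calc 2 * (x * y) * b ≤ |2 * (x * y) * b| := le_abs_self _
          _ = 2 * |x * y| * |b| := by rw [abs_mul, abs_mul]; norm_num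
          _ ≤ _ := by gcongr
      have h2 : 2 * |x * y| * (4 * (q + 1) * |x * y| * D ^ q)
          = 8 * (q + 1) * (x ^ 2 * y ^ 2) * D ^ q := by
        have : |x * y| * |x * y| = x ^ 2 * y ^ 2 := by rw [abs_mul_abs_self]; ring
        calc _ = 8 * (q + 1) * (|x * y| * |x * y|) * D ^ q := by ring
          _ = _ := by rw [this]
      have h3 : (x ^ 2 + y ^ 2) * a ≤ (x ^ 2 + y ^ 2) * (2 * D ^ (q + 1)) := by gcongr
      have h4 : (x ^ 2 + y ^ 2) * D + 4 * (q + 1) * (x ^ 2 * y ^ 2) ≤ D * D := by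
        have hx : x ^ 2 ≤ D := by nlinarith [sq_nonneg y]
        have : 4 * ((q : ℝ) + 1) * (x ^ 2 * y ^ 2) ≤ 4 * (q + 1) * y ^ 2 * D := by
          nlinarith [mul_le_mul_of_nonneg_left hx
            (by positivity : (0 : ℝ) ≤ 4 * (q + 1) * y ^ 2)]
        have h5 : x ^ 2 + y ^ 2 + 4 * (q + 1) * y ^ 2 ≤ D := by
          rw [hD]; nlinarith [sq_nonneg y]
        nlinarith [mul_le_mul_of_nonneg_right h5 hD0]
      have h6 := mul_le_mul_of_nonneg_left h4 hDq
      have e3 : D ^ (q + 1) = D ^ q * D := pow_succ _ _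
      have e4 : D ^ (q + 1 + 1) = D ^ q * (D * D) := by ring
      rw [e4]; rw [e3] at h3
      nlinarith
    · rw [e2]
      push_cast
      calc |(x ^ 2 + y ^ 2) * b + 2 * (x * y) * a|
          ≤ |(x ^ 2 + y ^ 2) * b| + |2 * (x * y) * a| := abs_add_le _ _
        _ = (x ^ 2 + y ^ 2) * |b| + 2 * |x * y| * a := by
            rw [abs_mul, abs_mul, abs_mul, abs_of_nonneg ha0,
              abs_of_nonneg (by positivity : 0 ≤ x ^ 2 + y ^ 2)]; norm_num
        _ ≤ D * (4 * (q + 1) * |x * y| * D ^ q) + 2 * |x * y| * (2 * D ^ (q + 1)) := by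
            gcongr
        _ = _ := by ring

/-- The two-point inequality behind the moment bound for random signs. -/
theorem two_point (x y : ℝ) (p : ℕ) :
    (x + y) ^ (2 * p) + (x - y) ^ (2 * p) ≤ 2 * (x ^ 2 + 4 * p * y ^ 2) ^ p := by
  cases p with
  | zero => norm_num
  | succ q => exact (two_point_aux (K := 4 * ((q + 1 : ℕ) : ℝ)) le_rfl q (by omega)).1

/-- Minkowski's inequality for natural exponents. -/
theorem expect_add_pow_le {ι : Type*} [Fintype ι] {u v : ι → ℝ} (hu : ∀ x, 0 ≤ u x)
    (hv : ∀ x, 0 ≤ v x) {α β : ℝ} (hα : 0 ≤ α) (hβ : 0 ≤ β) {p : ℕ} (hp : p ≠ 0)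
    (h1 : 𝔼 x, u x ^ p ≤ α ^ p) (h2 : 𝔼 x, v x ^ p ≤ β ^ p) :
    𝔼 x, (u x + v x) ^ p ≤ (α + β) ^ p := by
  have key : ∀ {w : ι → ℝ}, (∀ x, 0 ≤ w x) → 𝔼 x, w x ^ p ≤ (0 : ℝ) ^ p → ∀ x, w x = 0 := by
    intro w hw h x
    rw [zero_pow hp] at h
    have h0 : (fun x => w x ^ p) = 0 :=
      (Fintype.expect_eq_zero_iff_of_nonneg (fun x => pow_nonneg (hw x) p)).1
        (le_antisymm h (expect_nonneg fun x => pow_nonneg (hw x) p))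
    exact pow_eq_zero_iff hp |>.1 (congrFun h0 x)
  rcases hα.eq_or_lt with rfl | hα
  · simpa [key hu h1] using h2
  rcases hβ.eq_or_lt with rfl | hβ
  · simpa [key hv h2] using h1
  have hs : 0 < α + β := by positivity
  have hconv : ∀ x, (u x + v x) ^ p
      ≤ (α + β) ^ p * (α / (α + β) * (u x ^ p / α ^ p) + β / (α + β) * (v x ^ p / β ^ p)) := by
    intro x
    have := (convexOn_pow p (𝕜 := ℝ)).2 (Set.mem_Ici.2 (div_nonneg (hu x) hα.le))
      (Set.mem_Ici.2 (div_nonneg (hv x) hβ.le)) (by positivity : 0 ≤ α / (α + β))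
      (by positivity : 0 ≤ β / (α + β)) (by field_simp)
    simp only [smul_eq_mul, div_pow] at this
    have e : (u x + v x) ^ p
        = (α + β) ^ p * (α / (α + β) * (u x / α) + β / (α + β) * (v x / β)) ^ p := by
      rw [← mul_pow]; congr 1; field_simp
    rw [e]
    gcongr
  calc 𝔼 x, (u x + v x) ^ p
      ≤ 𝔼 x, (α + β) ^ p
          * (α / (α + β) * (u x ^ p / α ^ p) + β / (α + β) * (v x ^ p / β ^ p)) :=
        expect_mono hconv
    _ = (α + β) ^ p * (α / (α + β) * ((𝔼 x, u x ^ p) / α ^ p)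
          + β / (α + β) * ((𝔼 x, v x ^ p) / β ^ p)) := by
        rw [← Finset.mul_expect, Finset.expect_add_distrib, ← Finset.mul_expect,
          ← Finset.mul_expect, Finset.expect_div, Finset.expect_div]
    _ ≤ (α + β) ^ p * (α / (α + β) * 1 + β / (α + β) * 1) := by
        gcongr
        · exact div_le_one_of_le₀ h1 (by positivity)
        · exact div_le_one_of_le₀ h2 (by positivity)
    _ = (α + β) ^ p := by field_simp

/-- Bonami's lemma for even moments, with the constant `4p` in place of the optimal `2p - 1`. -/
theorem expect_sum_sgn_pow_le (p : ℕ) (hp : p ≠ 0) (V : Finset κ) :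
    ∀ a : Finset κ → ℝ, 𝔼 c : κ → Bool, (∑ S ∈ V.powerset, a S * sgn S c) ^ (2 * p)
      ≤ (∑ S ∈ V.powerset, (4 * p : ℝ) ^ S.card * a S ^ 2) ^ p := by
  induction V using Finset.induction_on with
  | empty =>
    intro a
    simp [sgn, pow_mul]
  | insert s V hs ih =>
    intro a
    have hmem : ∀ S ∈ V.powerset, s ∉ S := fun S hS h => hs (Finset.mem_powerset.1 hS h)
    set Q0 : (κ → Bool) → ℝ := fun c => ∑ S ∈ V.powerset, a S * sgn S c
    set Q1 : (κ → Bool) → ℝ := fun c => ∑ S ∈ V.powerset, a (insert s S) * sgn S c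
    set N0 := ∑ S ∈ V.powerset, (4 * p : ℝ) ^ S.card * a S ^ 2
    set N1 := ∑ S ∈ V.powerset, (4 * p : ℝ) ^ S.card * a (insert s S) ^ 2
    have hN0 : 0 ≤ N0 := Finset.sum_nonneg fun _ _ => by positivity
    have hN1 : 0 ≤ N1 := Finset.sum_nonneg fun _ _ => by positivity
    have hQ : ∀ c, ∑ S ∈ (insert s V).powerset, a S * sgn S c
        = Q0 c + (if c s then -1 else 1) * Q1 c := by
      intro c
      rw [Finset.sum_powerset_insert hs, Finset.mul_sum]
      congr 1
      refine Finset.sum_congr rfl fun S hS => ?_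
      rw [sgn, Finset.prod_insert (hmem S hS), sgn]; ring
    have hN : ∑ S ∈ (insert s V).powerset, (4 * p : ℝ) ^ S.card * a S ^ 2 = N0 + 4 * p * N1 := by
      rw [Finset.sum_powerset_insert hs, Finset.mul_sum]
      congr 1
      refine Finset.sum_congr rfl fun S hS => ?_
      rw [Finset.card_insert_of_notMem (hmem S hS)]; ring
    have hf0 : ∀ c, Q0 (flipAt s c) = Q0 c := fun c =>
      Finset.sum_congr rfl fun S hS => by rw [sgn_flipAt_of_notMem (hmem S hS)]
    have hf1 : ∀ c, Q1 (flipAt s c) = Q1 c := fun c =>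
      Finset.sum_congr rfl fun S hS => by rw [sgn_flipAt_of_notMem (hmem S hS)]
    rw [hN]
    simp_rw [hQ]
    set φ : (κ → Bool) → ℝ := fun c => (Q0 c + (if c s then -1 else 1) * Q1 c) ^ (2 * p)
    have hφ : ∀ c, φ c + φ (flipAt s c) ≤ 2 * (Q0 c ^ 2 + 4 * p * Q1 c ^ 2) ^ p := by
      intro c
      refine le_trans (le_of_eq ?_) (two_point (Q0 c) (Q1 c) p)
      simp only [φ, hf0, hf1]
      cases h : c s <;> simp [flipAt, h] <;> ring
    have h1 : 𝔼 c, φ c ≤ 𝔼 c, (Q0 c ^ 2 + 4 * p * Q1 c ^ 2) ^ p := by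
      have h2 := expect_mono hφ
      rw [Finset.expect_add_distrib, expect_flipAt s φ, ← Finset.mul_expect] at h2
      linarith
    refine h1.trans (expect_add_pow_le (fun c => sq_nonneg _) (fun c => by positivity) hN0
      (by positivity) hp ?_ ?_)
    · simp_rw [← pow_mul]; exact ih a
    · simp_rw [mul_pow (4 * (p : ℝ)), ← pow_mul, ← Finset.mul_expect]
      gcongr
      exact ih fun S => a (insert s S)

/-- Hölder's inequality against the indicator function of a set. -/
theorem expect_indicator_mul_pow_le {ι : Type*} [Fintype ι] {f : ι → ℝ}
    (hf : ∀ x, f x = 0 ∨ f x = 1) (h : ι → ℝ) {q : ℕ} (hq : Even q) (hq0 : q ≠ 0) :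
    (𝔼 x, f x * h x) ^ q ≤ (𝔼 x, f x) ^ (q - 1) * 𝔼 x, h x ^ q := by
  have hf0 : ∀ x, 0 ≤ f x := fun x => by rcases hf x with h | h <;> simp [h]
  have hf1 : ∀ x, f x ≤ 1 := fun x => by rcases hf x with h | h <;> simp [h]
  set s := ∑ x, f x with hs
  have hs0 : 0 ≤ s := Finset.sum_nonneg fun x _ => hf0 x
  have hR : 0 ≤ (𝔼 x, f x) ^ (q - 1) * 𝔼 x, h x ^ q :=
    mul_nonneg (pow_nonneg (expect_nonneg hf0) _) (expect_nonneg fun x => hq.pow_nonneg _)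
  rcases hs0.eq_or_lt with hs1 | hs1
  · have : ∀ x, f x = 0 := fun x =>
      (Finset.sum_eq_zero_iff_of_nonneg fun x _ => hf0 x).1 hs1.symm x (Finset.mem_univ x)
    simpa [this, hq0] using hR
  have hJ := Real.pow_arith_mean_le_arith_mean_pow_of_even Finset.univ (fun x => f x / s) h
    (fun x _ => div_nonneg (hf0 x) hs0) (by rw [← Finset.sum_div, div_self hs1.ne']) hq
  have e1 : ∑ x, f x / s * h x = (∑ x, f x * h x) / s := by
    rw [Finset.sum_div]; exact Finset.sum_congr rfl fun x _ => by ring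
  have e2 : ∑ x, f x / s * h x ^ q = (∑ x, f x * h x ^ q) / s := by
    rw [Finset.sum_div]; exact Finset.sum_congr rfl fun x _ => by ring
  rw [e1, e2, div_pow] at hJ
  have h3 : (∑ x, f x * h x) ^ q ≤ s ^ (q - 1) * ∑ x, h x ^ q := by
    have h4 : ∑ x, f x * h x ^ q ≤ ∑ x, h x ^ q :=
      Finset.sum_le_sum fun x _ => mul_le_of_le_one_left (hq.pow_nonneg _) (hf1 x)
    have h5 : (∑ x, f x * h x) ^ q ≤ (∑ x, f x * h x ^ q) / s * s ^ q :=
      (div_le_iff₀ (pow_pos hs1 q)).1 hJ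
    refine h5.trans ?_
    obtain ⟨r, rfl⟩ := Nat.exists_eq_succ_of_ne_zero hq0
    rw [Nat.succ_sub_one, Nat.succ_eq_add_one, pow_succ, div_mul_eq_mul_div, div_le_iff₀ hs1]
    have := mul_le_mul_of_nonneg_left h4 (pow_nonneg hs0 r)
    nlinarith
  simp_rw [Fintype.expect_eq_sum_div_card]
  rw [← hs, div_pow, div_pow, div_mul_div_comm, ← pow_succ, Nat.sub_add_cancel
    (Nat.pos_of_ne_zero hq0)]
  gcongr

end ProductSpace

/-! ### Conditional averages over permutations -/

namespace PermLevel

open ProductSpace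

set_option linter.unusedSectionVars false

variable {Ω : Type} [Fintype Ω] [DecidableEq Ω] {κ : Type} [Fintype κ] [DecidableEq κ]

theorem exists_perm_apply_eq {K : Type} {Q : Finset K} {i j : K → Ω} (hi : Set.InjOn i Q)
    (hj : Set.InjOn j Q) : ∃ x : Equiv.Perm Ω, ∀ k ∈ Q, x (i k) = j k := by
  classical
  rcases Q.eq_empty_or_nonempty with rfl | ⟨k0, hk0⟩
  · exact ⟨1, by simp⟩
  set g : Ω → Ω := fun y => j (if h : ∃ k ∈ Q, i k = y then h.choose else k0) with hg
  have hgi : ∀ k ∈ Q, g (i k) = j k := by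
    intro k hk
    have h : ∃ k' ∈ Q, i k' = i k := ⟨k, hk, rfl⟩
    simp only [hg, dif_pos h]
    rw [hi h.choose_spec.1 hk h.choose_spec.2]
  obtain ⟨x, hx⟩ := Set.MapsTo.exists_equiv_extend_of_card_eq (t := (Finset.univ : Finset Ω))
    (s := i '' Q) (f := g) (by simp) (fun _ _ => by simp) (by
      rintro _ ⟨k, hk, rfl⟩ _ ⟨l, hl, rfl⟩ h
      rw [hgi k hk, hgi l hl] at h
      rw [hj hk hl h])
  refine ⟨x.trans (Equiv.subtypeUnivEquiv (by simp)), fun k hk => ?_⟩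
  have := hx (i k) ⟨k, hk, rfl⟩
  simp [this, hgi k hk]

/-- The permutations that agree with `x₀` on `Q`, parametrized by the permutations of the
complement of `Q`. -/
theorem sum_ofSubtype (Q : Finset Ω) (x₀ : Equiv.Perm Ω) (φ : Equiv.Perm Ω → ℝ) :
    ∑ σ : Equiv.Perm {y // y ∉ Q}, φ (x₀ * Equiv.Perm.ofSubtype σ)
      = ∑ x : Equiv.Perm Ω, if ∀ y ∈ Q, x y = x₀ y then φ x else 0 := by
  classical
  have h1 : ∑ x : Equiv.Perm Ω, (if ∀ y ∈ Q, x y = x₀ y then φ x else 0)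
      = ∑ x : Equiv.Perm Ω, if ∀ y, ¬ (y ∉ Q) → x y = y then φ (x₀ * x) else 0 := by
    refine (Fintype.sum_equiv (Equiv.mulLeft x₀) _ _ fun x => ?_).symm
    simp
  rw [h1, ← Finset.sum_filter, Finset.sum_subtype (p := fun x : Equiv.Perm Ω =>
    ∀ y, ¬ (y ∉ Q) → x y = y) _ (by simp)]
  exact Fintype.sum_equiv (Equiv.Perm.subtypeEquivSubtypePerm (· ∉ Q)) _ _ fun σ => rfl

theorem card_compl_subtype (Q : Finset Ω) :
    Fintype.card {y // y ∉ Q} = Fintype.card Ω - Q.card := by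
  rw [Fintype.card_subtype_compl, Fintype.card_coe]

theorem sum_agree_one (Q : Finset Ω) (x₀ : Equiv.Perm Ω) :
    ∑ x : Equiv.Perm Ω, (if ∀ y ∈ Q, x y = x₀ y then (1 : ℝ) else 0)
      = ((Fintype.card Ω - Q.card).factorial : ℝ) := by
  rw [← sum_ofSubtype Q x₀ fun _ => 1]
  simp [Fintype.card_perm]

/-- For injective `i` and `j`, the conditional average of `f x` given that `x (i s) = j s` for all
`s ∈ S`. The number of such `x` is hard-coded as `(n - #S)!`, so that the value is `0` when exactly
one of `i` and `j` fails to be injective on `S`. -/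
noncomputable def condMean (f : Equiv.Perm Ω → ℝ) (S : Finset κ) (i j : κ → Ω) : ℝ :=
  (∑ x : Equiv.Perm Ω, if ∀ s ∈ S, x (i s) = j s then f x else 0)
    / ((Fintype.card Ω - S.card).factorial : ℝ)

/-- The ratio `n ^ d / (n (n - 1) ⋯ (n - d + 1))` of the numbers of all and of injective maps from
`d` points to `Ω`. -/
noncomputable def injRatio (Ω : Type) [Fintype Ω] (d : ℕ) : ℝ :=
  (Fintype.card Ω : ℝ) ^ d * ((Fintype.card Ω - d).factorial : ℝ)
    / ((Fintype.card Ω).factorial : ℝ)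

theorem injRatio_eq {d : ℕ} (hd : d ≤ Fintype.card Ω) :
    injRatio Ω d = (Fintype.card Ω : ℝ) ^ d / ((Fintype.card Ω).descFactorial d : ℝ) := by
  have h := Nat.factorial_mul_descFactorial hd
  have h1 : ((Fintype.card Ω - d).factorial : ℝ) ≠ 0 := by positivity
  have h2 : ((Fintype.card Ω).descFactorial d : ℝ) ≠ 0 := by
    exact_mod_cast (Nat.descFactorial_pos.2 hd).ne'
  rw [injRatio, ← h]
  push_cast
  field_simp

theorem one_le_injRatio {d : ℕ} (hd : d ≤ Fintype.card Ω) : 1 ≤ injRatio Ω d := by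
  rw [injRatio_eq hd, le_div_iff₀ (by exact_mod_cast Nat.descFactorial_pos.2 hd), one_mul]
  exact_mod_cast Nat.descFactorial_le_pow _ _

theorem injRatio_le {d : ℕ} (hd : 2 * d ≤ Fintype.card Ω) : injRatio Ω d ≤ 2 ^ d := by
  rw [injRatio_eq (by omega),
    div_le_iff₀ (by exact_mod_cast Nat.descFactorial_pos.2 (by omega))]
  have h1 : ((Fintype.card Ω + 1 - d : ℕ) : ℝ) ^ d ≤ ((Fintype.card Ω).descFactorial d : ℝ) := by
    exact_mod_cast Nat.pow_sub_le_descFactorial _ _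
  have h2 : (Fintype.card Ω : ℝ) ≤ 2 * ((Fintype.card Ω + 1 - d : ℕ) : ℝ) := by
    exact_mod_cast (by omega : Fintype.card Ω ≤ 2 * (Fintype.card Ω + 1 - d))
  calc (Fintype.card Ω : ℝ) ^ d ≤ (2 * ((Fintype.card Ω + 1 - d : ℕ) : ℝ)) ^ d := by gcongr
    _ = 2 ^ d * ((Fintype.card Ω + 1 - d : ℕ) : ℝ) ^ d := mul_pow _ _ _
    _ ≤ _ := by gcongr

theorem condMean_congr (f : Equiv.Perm Ω → ℝ) {S : Finset κ} {i i' j j' : κ → Ω}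
    (hi : ∀ s ∈ S, i s = i' s) (hj : ∀ s ∈ S, j s = j' s) :
    condMean f S i j = condMean f S i' j' := by
  unfold condMean
  congr 1
  refine Finset.sum_congr rfl fun x _ => ?_
  refine if_congr (forall₂_congr fun s hs => ?_) rfl rfl
  rw [hi s hs, hj s hs]

theorem condMean_add (f g : Equiv.Perm Ω → ℝ) (S : Finset κ) (i j : κ → Ω) :
    condMean (f + g) S i j = condMean f S i j + condMean g S i j := by
  unfold condMean
  rw [← add_div, ← Finset.sum_add_distrib]
  congr 1
  exact Finset.sum_congr rfl fun x _ => by split_ifs <;> simp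

theorem condMean_eq_zero_of_not_injOn (f : Equiv.Perm Ω → ℝ) {S : Finset κ} {i j : κ → Ω}
    (h : ¬ (Set.InjOn i S ↔ Set.InjOn j S)) : condMean f S i j = 0 := by
  unfold condMean
  rw [Finset.sum_eq_zero, zero_div]
  intro x _
  rw [if_neg]
  intro hx
  refine h ⟨fun hi s hs t ht hst => ?_, fun hj s hs t ht hst => ?_⟩
  · rw [← hx s hs, ← hx t ht] at hst
    exact hi hs ht (x.injective hst)
  · refine hj hs ht ?_
    rw [← hx s hs, ← hx t ht, hst]

theorem condMean_one {S : Finset κ} {i j : κ → Ω} (hi : Set.InjOn i S) (hj : Set.InjOn j S) :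
    condMean (fun _ => 1) S i j = 1 := by
  classical
  obtain ⟨x₀, hx₀⟩ := exists_perm_apply_eq hi hj
  have h := sum_agree_one (S.image i) x₀
  rw [Finset.card_image_of_injOn hi] at h
  unfold condMean
  rw [div_eq_one_iff_eq (by positivity), ← h]
  refine Finset.sum_congr rfl fun x _ => if_congr ?_ rfl rfl
  simp only [Finset.forall_mem_image]
  exact forall₂_congr fun s hs => by rw [hx₀ s hs]

/-- Averaging over `x` in two steps: first given the values of `x` at the points `i s`, then over
these values. -/
theorem expect_mul_comp (f : Equiv.Perm Ω → ℝ) (S : Finset κ) (i : κ → Ω)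
    {ψ : (κ → Ω) → ℝ} (hψ : DependsOn ψ S) :
    𝔼 x : Equiv.Perm Ω, f x * ψ (x ∘ i)
      = injRatio Ω S.card * 𝔼 j : κ → Ω, condMean f S i j * ψ j := by
  classical
  rcases isEmpty_or_nonempty Ω with hΩ | hΩ
  · have hS : ∀ s : κ, False := fun s => hΩ.false (i s)
    have : IsEmpty κ := ⟨hS⟩
    have hS0 : S = ∅ := Finset.eq_empty_of_isEmpty S
    subst hS0
    simp only [Fintype.expect_eq_sum_div_card, injRatio, condMean]
    simp [Subsingleton.elim _ i]
  have hn : (Fintype.card Ω : ℝ) ≠ 0 := by exact_mod_cast Fintype.card_ne_zero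
  have h1 : ∀ x : Equiv.Perm Ω, ψ (x ∘ i) = (Fintype.card Ω : ℝ) ^ S.card *
      𝔼 j : κ → Ω, (if ∀ s ∈ S, x (i s) = j s then 1 else 0) * ψ j := by
    intro x
    have h2 : ∀ j : κ → Ω, (if ∀ s ∈ S, x (i s) = j s then 1 else 0) * ψ j
        = (if ∀ s ∈ S, j s = (x ∘ i) s then 1 else 0) * ψ (x ∘ i) := by
      intro j
      by_cases h : ∀ s ∈ S, x (i s) = j s
      · have h' : ∀ s ∈ S, j s = (x ∘ i) s := fun s hs => (h s hs).symm
        rw [if_pos h, if_pos h', hψ (x := j) (y := x ∘ i) h']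
      · have h' : ¬ ∀ s ∈ S, j s = (x ∘ i) s := fun h' => h fun s hs => (h' s hs).symm
        rw [if_neg h, if_neg h']; simp
    simp_rw [h2, ← Finset.expect_mul, expect_agree]
    field_simp
  simp_rw [h1, Finset.mul_expect]
  rw [Finset.expect_comm]
  refine Finset.expect_congr rfl fun j _ => ?_
  rw [Fintype.expect_eq_sum_div_card, Fintype.card_perm, injRatio, condMean]
  have h3 : ((Fintype.card Ω - S.card).factorial : ℝ) ≠ 0 := by positivity
  have h4 : ∑ x : Equiv.Perm Ω, f x * ((Fintype.card Ω : ℝ) ^ S.card *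
      ((if ∀ s ∈ S, x (i s) = j s then 1 else 0) * ψ j))
      = (Fintype.card Ω : ℝ) ^ S.card * ψ j *
        ∑ x : Equiv.Perm Ω, if ∀ s ∈ S, x (i s) = j s then f x else 0 := by
    rw [Finset.mul_sum]
    exact Finset.sum_congr rfl fun x _ => by split_ifs <;> ring
  rw [h4]
  field_simp

open Classical in
/-- The values of a uniform permutation at distinct points are a uniform injective tuple. -/
theorem expect_comp {S : Finset κ} {i : κ → Ω} (hi : Set.InjOn i S)
    {ψ : (κ → Ω) → ℝ} (hψ : DependsOn ψ S) :
    𝔼 x : Equiv.Perm Ω, ψ (x ∘ i)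
      = injRatio Ω S.card * 𝔼 j : κ → Ω, if Set.InjOn j S then ψ j else 0 := by
  have h := expect_mul_comp (fun _ => 1) S i hψ
  simp only [one_mul] at h
  rw [h]
  congr 1
  refine Finset.expect_congr rfl fun j _ => ?_
  by_cases hj : Set.InjOn j S
  · rw [condMean_one hi hj, if_pos hj, one_mul]
  · rw [condMean_eq_zero_of_not_injOn _ (by tauto), if_neg hj, zero_mul]

/-- `f` has conditional averages at most `μ` given the values at any `d` or fewer points. -/
def PermGlobal (d : ℕ) (μ : ℝ) (f : Equiv.Perm Ω → ℝ) : Prop :=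
  ∀ (Q : Finset Ω), Q.card ≤ d → ∀ x₀ : Equiv.Perm Ω,
    ∑ x : Equiv.Perm Ω, (if ∀ y ∈ Q, x y = x₀ y then f x else 0)
      ≤ μ * ((Fintype.card Ω - Q.card).factorial : ℝ)

/-- The restriction of `f` to the permutations agreeing with `x₀` on `Q`, as a function of a
permutation of the complement of `Q`. -/
def restrictPerm (f : Equiv.Perm Ω → ℝ) (Q : Finset Ω) (x₀ : Equiv.Perm Ω) :
    Equiv.Perm {y // y ∉ Q} → ℝ :=
  fun σ => f (x₀ * Equiv.Perm.ofSubtype σ)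

theorem PermGlobal.restrictPerm {d r : ℕ} {μ : ℝ} {f : Equiv.Perm Ω → ℝ}
    (hf : PermGlobal (d + r) μ f) (Q : Finset Ω) (hQ : Q.card = r) (x₀ : Equiv.Perm Ω) :
    PermGlobal d μ (restrictPerm f Q x₀) := by
  classical
  intro Q' hQ' σ₀
  have hdisj : Disjoint Q (Q'.map (Function.Embedding.subtype _)) := by
    rw [Finset.disjoint_left]
    intro y hy hy'
    obtain ⟨z, _, rfl⟩ := Finset.mem_map.1 hy'
    exact z.2 hy
  have h := hf (Q ∪ Q'.map (Function.Embedding.subtype _))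
    (by rw [Finset.card_union_of_disjoint hdisj, Finset.card_map]; omega)
    (x₀ * Equiv.Perm.ofSubtype σ₀)
  rw [Finset.card_union_of_disjoint hdisj, Finset.card_map, Nat.sub_add_eq] at h
  rw [card_compl_subtype]
  refine le_trans (le_of_eq ?_) h
  set φ : Equiv.Perm Ω → ℝ := fun x =>
    if ∀ y ∈ Q', x y.1 = (x₀ * Equiv.Perm.ofSubtype σ₀) y.1 then f x else 0 with hφ
  have h1 : ∀ σ : Equiv.Perm {y // y ∉ Q},
      (if ∀ y ∈ Q', σ y = σ₀ y then PermLevel.restrictPerm f Q x₀ σ else 0)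
        = φ (x₀ * Equiv.Perm.ofSubtype σ) := by
    intro σ
    simp only [hφ, PermLevel.restrictPerm]
    refine if_congr (forall₂_congr fun y _ => ?_) rfl rfl
    simp [Subtype.ext_iff]
  simp_rw [h1]
  rw [sum_ofSubtype Q x₀ φ]
  refine Finset.sum_congr rfl fun x _ => ?_
  simp only [hφ, ← ite_and]
  refine if_congr ?_ rfl rfl
  have h2 : ∀ y ∈ Q, (x₀ * Equiv.Perm.ofSubtype σ₀) y = x₀ y := fun y hy => by
    simp [Equiv.Perm.ofSubtype_apply_of_not_mem σ₀ (not_not.2 hy)]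
  constructor
  · rintro ⟨hx, hx'⟩ y hy
    rcases Finset.mem_union.1 hy with hy | hy
    · rw [hx y hy, h2 y hy]
    · obtain ⟨z, hz, rfl⟩ := Finset.mem_map.1 hy
      exact hx' z hz
  · intro hx
    refine ⟨fun y hy => ?_, fun y hy => ?_⟩
    · rw [hx y (Finset.mem_union_left _ hy), h2 y hy]
    · exact hx y (Finset.mem_union_right _ (Finset.mem_map.2 ⟨y, hy, rfl⟩))

/-- Conditional averages of restrictions of `f` are conditional averages of `f`. -/
theorem condMean_restrictPerm (f : Equiv.Perm Ω → ℝ) {R S : Finset κ} (hRS : Disjoint R S)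
    {i j : κ → Ω} (hi : Set.InjOn i R) {x₀ : Equiv.Perm Ω}
    (hx₀ : ∀ s ∈ R, x₀ (i s) = j s) {i' j' : κ → {y // y ∉ R.image i}}
    (hi' : ∀ s ∈ S, i s = i' s) (hj' : ∀ s ∈ S, j s = x₀ (j' s)) :
    condMean f (R ∪ S) i j = condMean (restrictPerm f (R.image i) x₀) S i' j' := by
  unfold condMean
  rw [card_compl_subtype, Finset.card_image_of_injOn hi, Finset.card_union_of_disjoint hRS,
    Nat.sub_add_eq]
  congr 1
  set φ : Equiv.Perm Ω → ℝ := fun x => if ∀ s ∈ S, x (i s) = j s then f x else 0 with hφ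
  have h1 : ∀ σ : Equiv.Perm {y // y ∉ R.image i},
      (if ∀ s ∈ S, σ (i' s) = j' s then restrictPerm f (R.image i) x₀ σ else 0)
        = φ (x₀ * Equiv.Perm.ofSubtype σ) := by
    intro σ
    simp only [hφ, restrictPerm]
    refine if_congr (forall₂_congr fun s hs => ?_) rfl rfl
    rw [hi' s hs, hj' s hs]
    simp [Subtype.ext_iff]
  simp_rw [h1]
  rw [sum_ofSubtype _ x₀ φ]
  refine Finset.sum_congr rfl fun x _ => ?_
  simp only [hφ, ← ite_and]
  refine if_congr ?_ rfl rfl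
  simp only [Finset.forall_mem_image]
  constructor
  · intro hx
    refine ⟨fun s hs => ?_, fun s hs => hx s (Finset.mem_union_right _ hs)⟩
    rw [hx s (Finset.mem_union_left _ hs), hx₀ s hs]
  · rintro ⟨hx, hx'⟩ s hs
    rcases Finset.mem_union.1 hs with hs | hs
    · rw [hx hs, hx₀ s hs]
    · exact hx' s hs

/-! ### Discrete differences of conditional averages -/

/-- From a family of pairs of points, select one point of each pair. -/
def sel (a : κ → Bool → Ω) (c : κ → Bool) : κ → Ω := fun s => a s (c s)

/-- The `2 #S` points of the pairs with index in `S` are distinct. -/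
def PairInj (S : Finset κ) (a : κ → Bool → Ω) : Prop :=
  ∀ s ∈ S, ∀ t ∈ S, ∀ b c, a s b = a t c → s = t ∧ b = c

/-- The difference of the conditional averages of `f` in the positions: the alternating average over
all selections of one position from each of the pairs `a s`, `s ∈ S`. -/
noncomputable def diffLeft (f : Equiv.Perm Ω → ℝ) (S : Finset κ) (a : κ → Bool → Ω) (j : κ → Ω) :
    ℝ :=
  𝔼 c : κ → Bool, sgn S c * condMean f S (sel a c) j

/-- The difference of the conditional averages of `f` both in the positions and in the values. For
`b = x ∘ a` this is the value at `x` of the product over `s ∈ S` of the antisymmetrizations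
`(1 - τ_s) / 2`, with `τ_s` the transposition of the two points `a s`, applied to the sum of the
conditional averages of `f` given the values at one point of each pair. -/
noncomputable def diffBoth (f : Equiv.Perm Ω → ℝ) (S : Finset κ) (a b : κ → Bool → Ω) : ℝ :=
  2 ^ S.card * 𝔼 c : κ → Bool, sgn S c * diffLeft f S a (sel b c)

open Classical in
/-- The square of `diffBoth`, set to `0` unless the points involved are distinct. -/
noncomputable def weight (f : Equiv.Perm Ω → ℝ) (S : Finset κ) (a b : κ → Bool → Ω) : ℝ :=
  if PairInj S a ∧ PairInj S b then diffBoth f S a b ^ 2 else 0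

theorem weight_nonneg (f : Equiv.Perm Ω → ℝ) (S : Finset κ) (a b : κ → Bool → Ω) :
    0 ≤ weight f S a b := by
  unfold weight; split_ifs <;> positivity

theorem PairInj.mono {S T : Finset κ} (hST : S ⊆ T) {a : κ → Bool → Ω} (h : PairInj T a) :
    PairInj S a :=
  fun s hs t ht b c hbc => h s (hST hs) t (hST ht) b c hbc

theorem PairInj.comp_perm {S : Finset κ} {a : κ → Bool → Ω} (h : PairInj S a)
    (x : Equiv.Perm Ω) : PairInj S fun s b => x (a s b) :=
  fun s hs t ht b c hbc => h s hs t ht b c (x.injective hbc)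

theorem PairInj.injOn_sel {S : Finset κ} {a : κ → Bool → Ω} (h : PairInj S a) (c : κ → Bool) :
    Set.InjOn (sel a c) S :=
  fun s hs t ht hst => (h s hs t ht _ _ hst).1

theorem pairInj_congr {S : Finset κ} {a a' : κ → Bool → Ω} (h : ∀ s ∈ S, a s = a' s) :
    PairInj S a ↔ PairInj S a' :=
  forall₂_congr fun s hs => forall₂_congr fun t ht => by rw [h s hs, h t ht]

theorem pairInj_iff_injOn {S : Finset κ} {a : κ → Bool → Ω} :
    PairInj S a ↔
      Set.InjOn (Function.uncurry a) (S ×ˢ (Finset.univ : Finset Bool) : Finset (κ × Bool)) := by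
  constructor
  · rintro h ⟨s, b⟩ hs ⟨t, c⟩ ht hst
    obtain ⟨rfl, rfl⟩ := h s (by simpa using hs) t (by simpa using ht) b c hst
    rfl
  · intro h s hs t ht b c hst
    simpa using @h (s, b) (by simpa using hs) (t, c) (by simpa using ht) hst

theorem diffLeft_congr (f : Equiv.Perm Ω → ℝ) {S : Finset κ} {a a' : κ → Bool → Ω} {j j' : κ → Ω}
    (ha : ∀ s ∈ S, a s = a' s) (hj : ∀ s ∈ S, j s = j' s) :
    diffLeft f S a j = diffLeft f S a' j' :=
  Finset.expect_congr rfl fun c _ => by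
    rw [condMean_congr f (i' := sel a' c) (fun s hs => by simp only [sel, ha s hs]) hj]

theorem diffBoth_congr (f : Equiv.Perm Ω → ℝ) {S : Finset κ} {a a' b b' : κ → Bool → Ω}
    (ha : ∀ s ∈ S, a s = a' s) (hb : ∀ s ∈ S, b s = b' s) :
    diffBoth f S a b = diffBoth f S a' b' := by
  unfold diffBoth
  congr 1
  exact Finset.expect_congr rfl fun c _ => by
    rw [diffLeft_congr f ha (j' := sel b' c) fun s hs => by simp only [sel, hb s hs]]

theorem weight_congr (f : Equiv.Perm Ω → ℝ) {S : Finset κ} {a a' b b' : κ → Bool → Ω}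
    (ha : ∀ s ∈ S, a s = a' s) (hb : ∀ s ∈ S, b s = b' s) :
    weight f S a b = weight f S a' b' := by
  classical
  unfold weight
  rw [diffBoth_congr f ha hb]
  exact if_congr (and_congr (pairInj_congr ha) (pairInj_congr hb)) rfl rfl

open Classical in
/-- The values of a uniform permutation at disjoint pairs of points are uniform among the families
of disjoint pairs. -/
theorem expect_comp_pairs {S : Finset κ} {e : κ → Bool → Ω} (he : PairInj S e)
    {ψ : (κ → Bool → Ω) → ℝ} (hψ : DependsOn ψ S) :
    𝔼 x : Equiv.Perm Ω, ψ (fun s b => x (e s b))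
      = injRatio Ω (2 * S.card) * 𝔼 a : κ → Bool → Ω, if PairInj S a then ψ a else 0 := by
  have h := expect_comp (S := S ×ˢ (Finset.univ : Finset Bool)) (pairInj_iff_injOn.1 he)
    (ψ := fun j => ψ fun s b => j (s, b)) (by
      intro j j' h
      exact hψ fun s hs => funext fun b => h (s, b) (by simpa using hs))
  rw [Finset.card_product, Finset.card_univ, Fintype.card_bool, mul_comm S.card] at h
  refine h.trans ?_
  congr 1
  refine Fintype.expect_equiv (Equiv.curry κ Bool Ω) _ _ fun j => ?_
  exact if_congr (pairInj_iff_injOn (a := Function.curry j)).symm rfl rfl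

/-- For independent uniform pairs, any selection of one point of each pair is uniform. -/
theorem expect_sel (c : κ → Bool) (ψ : (κ → Ω) → ℝ) :
    𝔼 a : κ → Bool → Ω, ψ (sel a c) = 𝔼 i : κ → Ω, ψ i := by
  rcases isEmpty_or_nonempty (κ → Ω) with hE | hE
  · have : IsEmpty (κ → Bool → Ω) := ⟨fun a => hE.false (sel a c)⟩
    simp [Finset.univ_eq_empty]
  have h1 : 𝔼 a : κ → Bool → Ω, ψ (sel a c) = 𝔼 q : (κ → Ω) × (κ → Ω), ψ q.1 := by
    refine Fintype.expect_bijective (fun a => (sel a c, sel a fun s => !c s)) ⟨?_, ?_⟩ _ _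
      fun a => rfl
    · intro a a' h
      ext s b
      have h1 := congrFun (Prod.ext_iff.1 h).1 s
      have h2 := congrFun (Prod.ext_iff.1 h).2 s
      simp only [sel] at h1 h2
      rcases Bool.eq_or_eq_not b (c s) with rfl | rfl
      · exact h1
      · exact h2
    · rintro ⟨i, i'⟩
      refine ⟨fun s b => if b = c s then i s else i' s, ?_⟩
      ext s <;> simp [sel]
  rw [h1, ← Finset.univ_product_univ, Finset.expect_product]
  simp

/-- The correlation of `f` with its two-sided difference is a sum of squares. -/
theorem expect_mul_diffBoth (f : Equiv.Perm Ω → ℝ) (S : Finset κ) (a : κ → Bool → Ω) :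
    𝔼 x : Equiv.Perm Ω, f x * diffBoth f S a (fun s b => x (a s b))
      = injRatio Ω S.card * 2 ^ S.card * 𝔼 j : κ → Ω, diffLeft f S a j ^ 2 := by
  have h1 : ∀ x : Equiv.Perm Ω, f x * diffBoth f S a (fun s b => x (a s b))
      = 2 ^ S.card * 𝔼 c : κ → Bool, sgn S c * (f x * diffLeft f S a (x ∘ sel a c)) := by
    intro x
    rw [diffBoth, mul_left_comm, Finset.mul_expect]
    congr 1
    exact Finset.expect_congr rfl fun c _ => by rw [mul_left_comm]; rfl
  have h2 : ∀ c : κ → Bool, 𝔼 x : Equiv.Perm Ω, f x * diffLeft f S a (x ∘ sel a c)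
      = injRatio Ω S.card * 𝔼 j : κ → Ω, condMean f S (sel a c) j * diffLeft f S a j :=
    fun c => expect_mul_comp f S (sel a c) fun j j' h =>
      diffLeft_congr f (fun _ _ => rfl) fun s hs => h s hs
  simp_rw [h1]
  rw [← Finset.mul_expect, Finset.expect_comm]
  simp_rw [← Finset.mul_expect, h2]
  have h3 : ∀ j : κ → Ω, diffLeft f S a j ^ 2
      = 𝔼 c : κ → Bool, sgn S c * (condMean f S (sel a c) j * diffLeft f S a j) := by
    intro j
    rw [sq]
    nth_rewrite 1 [diffLeft]
    rw [Finset.expect_mul]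
    exact Finset.expect_congr rfl fun c _ => by ring
  simp_rw [h3]
  rw [Finset.expect_comm]
  simp_rw [Finset.mul_expect]
  refine Finset.expect_congr rfl fun c _ => Finset.expect_congr rfl fun j _ => ?_
  ring

/-- The mean of `weight` is controlled by the correlation of `f` with its two-sided difference. -/
theorem expect_weight_le (f : Equiv.Perm Ω → ℝ) {S : Finset κ} {e : κ → Bool → Ω}
    (he : PairInj S e) (hS : 2 * S.card ≤ Fintype.card Ω) :
    𝔼 a : κ → Bool → Ω, 𝔼 b : κ → Bool → Ω, weight f S a b
      ≤ 2 ^ S.card * 𝔼 ρ : Equiv.Perm Ω, 𝔼 x : Equiv.Perm Ω,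
          f x * diffBoth f S (fun s b => ρ (e s b)) (fun s b => x (ρ (e s b))) := by
  classical
  have hψ : DependsOn (fun a : κ → Bool → Ω => 𝔼 j : κ → Ω, diffLeft f S a j ^ 2) S :=
    fun a a' h => Finset.expect_congr rfl fun j _ => by
      rw [diffLeft_congr f h fun _ _ => rfl]
  have h0 : ∀ a : κ → Bool → Ω, 0 ≤ 𝔼 j : κ → Ω, diffLeft f S a j ^ 2 :=
    fun a => expect_nonneg fun j => sq_nonneg _
  have h1 : ∀ a : κ → Bool → Ω, 𝔼 b : κ → Bool → Ω, weight f S a b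
      ≤ 4 ^ S.card * if PairInj S a then 𝔼 j : κ → Ω, diffLeft f S a j ^ 2 else 0 := by
    intro a
    by_cases ha : PairInj S a
    · rw [if_pos ha]
      have h2 : ∀ b, weight f S a b
          ≤ 4 ^ S.card * 𝔼 c : κ → Bool, diffLeft f S a (sel b c) ^ 2 := by
        intro b
        have h3 : diffBoth f S a b ^ 2
            ≤ 4 ^ S.card * 𝔼 c : κ → Bool, diffLeft f S a (sel b c) ^ 2 := by
          rw [diffBoth, mul_pow, ← pow_mul, mul_comm S.card 2, pow_mul]
          norm_num only
          refine mul_le_mul_of_nonneg_left ((sq_expect_le _).trans (le_of_eq ?_)) (by positivity)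
          exact Finset.expect_congr rfl fun c _ => by rw [mul_pow, sgn_sq, one_mul]
        unfold weight
        split_ifs
        · exact h3
        · exact (sq_nonneg _).trans h3
      refine (expect_mono h2).trans (le_of_eq ?_)
      rw [← Finset.mul_expect, Finset.expect_comm]
      congr 1
      simp_rw [expect_sel _ fun i => diffLeft f S a i ^ 2]
      simp
    · rw [if_neg ha]
      simp [weight, ha]
  refine (expect_mono h1).trans ?_
  rw [← Finset.mul_expect]
  simp_rw [expect_mul_diffBoth]
  rw [← Finset.mul_expect, expect_comp_pairs he hψ]
  set A := 𝔼 a : κ → Bool → Ω, if PairInj S a then 𝔼 j : κ → Ω, diffLeft f S a j ^ 2 else 0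
  have hA : 0 ≤ A := expect_nonneg fun a => by split_ifs; exacts [h0 a, le_rfl]
  have e1 := one_le_injRatio (Ω := Ω) (d := S.card) (by omega)
  have e2 := one_le_injRatio (Ω := Ω) (d := 2 * S.card) hS
  have e3 : (4 : ℝ) ^ S.card = 2 ^ S.card * 2 ^ S.card := by rw [← mul_pow]; norm_num
  have e4 : 1 ≤ injRatio Ω S.card * injRatio Ω (2 * S.card) := one_le_mul_of_one_le_of_one_le e1 e2
  calc (4 : ℝ) ^ S.card * A = 2 ^ S.card * 2 ^ S.card * A * 1 := by rw [e3, mul_one]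
    _ ≤ 2 ^ S.card * 2 ^ S.card * A * (injRatio Ω S.card * injRatio Ω (2 * S.card)) := by gcongr
    _ = _ := by ring

/-- Exchanging the values within some of the pairs multiplies `diffBoth` by a sign. -/
theorem diffBoth_flip (f : Equiv.Perm Ω → ℝ) (S : Finset κ) (a b : κ → Bool → Ω) (t : κ → Bool) :
    diffBoth f S a (fun s c => b s (xor c (t s))) = sgn S t * diffBoth f S a b := by
  have hbij : Function.Bijective fun (c : κ → Bool) (s : κ) => xor (c s) (t s) :=
    Function.Involutive.bijective fun c => by ext s; simp
  have h : 𝔼 c : κ → Bool, sgn S c * diffLeft f S a (sel (fun s c => b s (xor c (t s))) c)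
      = 𝔼 c : κ → Bool, sgn S t * (sgn S c * diffLeft f S a (sel b c)) := by
    refine Fintype.expect_bijective _ hbij _ _ fun c => ?_
    have hD : diffLeft f S a (sel (fun s c => b s (xor c (t s))) c)
        = diffLeft f S a (sel b fun s => xor (c s) (t s)) := rfl
    rw [sgn_xor, hD]
    linear_combination
      -(sgn S c * diffLeft f S a (sel b fun s => xor (c s) (t s))) * sgn_mul_self S t
  rw [diffBoth, h, ← Finset.mul_expect, mul_left_comm, diffBoth]

/-! ### Restrictions -/

/-- If `φ` vanishes unless the coordinates in `S` lie in the range of `e`, restricting the variables to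
this range can only increase the average. -/
theorem expect_le_expect_comp {Z Z' : Type} [Fintype Z] [Fintype Z'] [DecidableEq Z]
    [DecidableEq Z'] [Nonempty Z'] {e : Z' → Z} (he : Function.Injective e) {S : Finset κ}
    {φ : (κ → Z) → ℝ} (hφ0 : ∀ z, 0 ≤ φ z) (hφ : DependsOn φ S)
    (hφe : ∀ z, φ z ≠ 0 → ∀ s ∈ S, ∃ y, e y = z s) :
    𝔼 z, φ z ≤ 𝔼 z', φ (e ∘ z') := by
  have : Nonempty Z := ⟨e (Classical.arbitrary Z')⟩
  have hZ : (0 : ℝ) < Fintype.card Z := by exact_mod_cast Fintype.card_pos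
  have hZ' : (0 : ℝ) < Fintype.card Z' := by exact_mod_cast Fintype.card_pos
  have h1 : ∀ z, φ z = (Fintype.card Z' : ℝ) ^ S.card *
      𝔼 z' : κ → Z', (if ∀ s ∈ S, z s = (e ∘ z') s then 1 else 0) * φ (e ∘ z') := by
    intro z
    have h2 : ∀ z' : κ → Z', (if ∀ s ∈ S, z s = (e ∘ z') s then 1 else 0) * φ (e ∘ z')
        = (if ∀ s ∈ S, z s = (e ∘ z') s then 1 else 0) * φ z := by
      intro z'
      by_cases h : ∀ s ∈ S, z s = (e ∘ z') s
      · rw [hφ h]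
      · rw [if_neg h]; simp
    simp_rw [h2, ← Finset.expect_mul]
    by_cases hz : φ z = 0
    · simp [hz]
    have h3 := hφe z hz
    obtain ⟨z₀, hz₀⟩ : ∃ z₀ : κ → Z', ∀ s ∈ S, e (z₀ s) = z s :=
      ⟨fun s => if h : s ∈ S then (h3 s h).choose else Classical.arbitrary Z', fun s hs => by
        simp only [dif_pos hs]; exact (h3 s hs).choose_spec⟩
    have h4 : ∀ z' : κ → Z', (if ∀ s ∈ S, z s = (e ∘ z') s then (1 : ℝ) else 0)
        = if ∀ s ∈ S, z' s = z₀ s then 1 else 0 := by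
      intro z'
      refine if_congr (forall₂_congr fun s hs => ?_) rfl rfl
      rw [← hz₀ s hs]
      exact ⟨fun h => (he h).symm, fun h => by simp [h]⟩
    simp_rw [h4]
    rw [expect_agree]
    field_simp
  have h5 : 𝔼 z, φ z = (Fintype.card Z' : ℝ) ^ S.card * ((Fintype.card Z : ℝ) ^ S.card)⁻¹
      * 𝔼 z', φ (e ∘ z') := by
    rw [Finset.expect_congr rfl fun z _ => h1 z, ← Finset.mul_expect, Finset.expect_comm]
    simp_rw [← Finset.expect_mul, expect_agree]
    rw [← Finset.mul_expect, mul_assoc]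
  rw [h5]
  refine mul_le_of_le_one_left (expect_nonneg fun z' => hφ0 _) ?_
  rw [← div_eq_mul_inv]
  refine div_le_one_of_le₀ ?_ (by positivity)
  gcongr
  exact Fintype.card_le_of_injective e he

/-- The two-sided difference of `f` over `S`, with the choices within the pairs in `R ⊆ S`
prescribed. -/
noncomputable def partialDiff (f : Equiv.Perm Ω → ℝ) (R S : Finset κ) (a b : κ → Bool → Ω)
    (u u' : κ → Bool) (a' b' : κ → Bool → Ω) : ℝ :=
  2 ^ (S \ R).card * 𝔼 c' : κ → Bool, sgn (S \ R) c' * 𝔼 c : κ → Bool, sgn (S \ R) c *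
    condMean f S (R.piecewise (sel a u) (sel a' c)) (R.piecewise (sel b u') (sel b' c'))

theorem sgn_piecewise {R S : Finset κ} (hRS : R ⊆ S) (u c : κ → Bool) :
    sgn S (R.piecewise u c) = sgn R u * sgn (S \ R) c := by
  rw [sgn, ← Finset.prod_sdiff hRS, mul_comm]
  congr 1
  · exact sgn_congr fun s hs => by simp [hs]
  · exact sgn_congr fun s hs => by simp [(Finset.mem_sdiff.1 hs).2]

theorem sel_piecewise (R : Finset κ) (a a' : κ → Bool → Ω) (u c : κ → Bool) :
    sel (R.piecewise a a') (R.piecewise u c) = R.piecewise (sel a u) (sel a' c) := by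
  ext s; by_cases hs : s ∈ R <;> simp [sel, hs]

theorem diffBoth_piecewise_sq_le (f : Equiv.Perm Ω → ℝ) {R S : Finset κ} (hRS : R ⊆ S)
    (a b a' b' : κ → Bool → Ω) :
    diffBoth f S (R.piecewise a a') (R.piecewise b b') ^ 2
      ≤ 4 ^ R.card * 𝔼 u' : κ → Bool, 𝔼 u : κ → Bool, partialDiff f R S a b u u' a' b' ^ 2 := by
  have h1 : diffBoth f S (R.piecewise a a') (R.piecewise b b')
      = 2 ^ R.card * 𝔼 u' : κ → Bool, 𝔼 u : κ → Bool,
          sgn R u' * (sgn R u * partialDiff f R S a b u u' a' b') := by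
    have hc : (2 : ℝ) ^ S.card = 2 ^ R.card * 2 ^ (S \ R).card := by
      rw [← pow_add, Finset.card_sdiff_of_subset hRS,
        Nat.add_sub_cancel' (Finset.card_le_card hRS)]
    unfold diffBoth diffLeft
    rw [← expect_piecewise R, hc, mul_assoc, Finset.mul_expect]
    congr 1
    refine Finset.expect_congr rfl fun u' _ => ?_
    have h2 : ∀ c' : κ → Bool, 𝔼 c : κ → Bool, sgn S c *
        condMean f S (sel (R.piecewise a a') c) (sel (R.piecewise b b') (R.piecewise u' c'))
        = 𝔼 u : κ → Bool, 𝔼 c : κ → Bool, sgn R u * sgn (S \ R) c *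
          condMean f S (R.piecewise (sel a u) (sel a' c)) (R.piecewise (sel b u') (sel b' c')) := by
      intro c'
      rw [← expect_piecewise R]
      simp_rw [sgn_piecewise hRS, sel_piecewise]
    simp_rw [h2, sgn_piecewise hRS]
    unfold partialDiff
    simp_rw [Finset.mul_expect]
    rw [Finset.expect_comm]
    refine Finset.expect_congr rfl fun u _ => Finset.expect_congr rfl fun c' _ =>
      Finset.expect_congr rfl fun c _ => ?_
    ring
  rw [h1, mul_pow, ← pow_mul, mul_comm R.card 2, pow_mul]
  norm_num only
  refine mul_le_mul_of_nonneg_left ?_ (by positivity)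
  refine (sq_expect_le _).trans (expect_mono fun u' => ?_)
  refine (sq_expect_le _).trans (le_of_eq ?_)
  exact Finset.expect_congr rfl fun u _ => by
    rw [mul_pow, mul_pow, sgn_sq, sgn_sq, one_mul, one_mul]

theorem partialDiff_congr (f : Equiv.Perm Ω → ℝ) {R S : Finset κ} (a b : κ → Bool → Ω)
    (u u' : κ → Bool) {a' a'' b' b'' : κ → Bool → Ω} (ha : ∀ s ∈ S \ R, a' s = a'' s)
    (hb : ∀ s ∈ S \ R, b' s = b'' s) :
    partialDiff f R S a b u u' a' b' = partialDiff f R S a b u u' a'' b'' := by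
  have key : ∀ {g : κ → Ω} {a' a'' : κ → Bool → Ω} (c : κ → Bool),
      (∀ s ∈ S \ R, a' s = a'' s) →
      ∀ s ∈ S, R.piecewise g (sel a' c) s = R.piecewise g (sel a'' c) s := by
    intro g a' a'' c h s hs
    by_cases hsR : s ∈ R
    · simp [hsR]
    · simp [hsR, sel, h s (Finset.mem_sdiff.2 ⟨hs, hsR⟩)]
  unfold partialDiff
  congr 1
  refine Finset.expect_congr rfl fun c' _ => ?_
  congr 1
  refine Finset.expect_congr rfl fun c _ => ?_
  rw [condMean_congr f (key c ha) (key c' hb)]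

/-- Fixing one position and one value for each pair in `R` amounts to restricting `f`. -/
theorem partialDiff_eq_restrictPerm (f : Equiv.Perm Ω → ℝ) {R S : Finset κ} (hRS : R ⊆ S)
    (a b : κ → Bool → Ω) (u u' : κ → Bool) (ha : Set.InjOn (sel a u) R) {x₀ : Equiv.Perm Ω}
    (hx₀ : ∀ s ∈ R, x₀ (sel a u s) = sel b u' s)
    (a' b' : κ → Bool → {y // y ∉ R.image (sel a u)}) :
    partialDiff f R S a b u u' (fun s c => (a' s c : Ω)) (fun s c => x₀ (b' s c : Ω))
      = diffBoth (restrictPerm f (R.image (sel a u)) x₀) (S \ R) a' b' := by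
  unfold partialDiff diffBoth diffLeft
  congr 1
  refine Finset.expect_congr rfl fun c' _ => ?_
  congr 1
  refine Finset.expect_congr rfl fun c _ => ?_
  congr 1
  have hS : condMean f S = condMean f (R ∪ S \ R) := by rw [Finset.union_sdiff_of_subset hRS]
  rw [hS]
  set i := R.piecewise (sel a u) (sel (fun s c => (a' s c : Ω)) c)
  have him : R.image (sel a u) = R.image i :=
    Finset.image_congr fun s hs => by simp [i, Finset.mem_coe.1 hs]
  have hiR : ∀ s ∈ R, i s = sel a u s := fun s hs => by simp [i, hs]
  have hiS : ∀ s ∈ S \ R, i s = a' s (c s) := fun s hs => by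
    simp [i, (Finset.mem_sdiff.1 hs).2, sel]
  clear_value i
  have hinj : Set.InjOn i R := fun s hs t ht hst => ha hs ht (by
    rw [← hiR s hs, ← hiR t ht, hst])
  generalize hQ : R.image (sel a u) = Q at a' b' him hiS ⊢
  subst him
  refine condMean_restrictPerm f Finset.disjoint_sdiff hinj (fun s hs => ?_)
    (fun s hs => ?_) fun s hs => ?_
  · rw [hiR s hs, hx₀ s hs]; simp [hs]
  · rw [hiS s hs]; rfl
  · simp [(Finset.mem_sdiff.1 hs).2, sel]

/-- Conditioning on the pairs in `R` reduces the mean of the weight of `f` to means of weights of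
restrictions of `f`. -/
theorem exists_expect_weight_piecewise_le (f : Equiv.Perm Ω → ℝ) {R : Finset κ}
    (hR : R.card < Fintype.card Ω) {a b : κ → Bool → Ω} (ha : PairInj R a) (hb : PairInj R b) :
    ∃ (Q : (κ → Bool) → Finset Ω) (x₀ : (κ → Bool) → (κ → Bool) → Equiv.Perm Ω),
      (∀ u, (Q u).card = R.card) ∧ ∀ S, R ⊆ S →
        𝔼 a' : κ → Bool → Ω, 𝔼 b' : κ → Bool → Ω,
            weight f S (R.piecewise a a') (R.piecewise b b')
          ≤ 4 ^ R.card * 𝔼 u' : κ → Bool, 𝔼 u : κ → Bool,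
            𝔼 a' : κ → Bool → {y // y ∉ Q u}, 𝔼 b' : κ → Bool → {y // y ∉ Q u},
              weight (restrictPerm f (Q u) (x₀ u u')) (S \ R) a' b' := by
  classical
  choose x₀ hx₀ using fun u u' => exists_perm_apply_eq (ha.injOn_sel u) (hb.injOn_sel u')
  refine ⟨fun u => R.image (sel a u), x₀, fun u => Finset.card_image_of_injOn (ha.injOn_sel u),
    fun S hRS => ?_⟩
  set Φ : (κ → Bool) → (κ → Bool) → (κ → Bool → Ω) → (κ → Bool → Ω) → ℝ := fun u u' a' b' =>
    if PairInj S (R.piecewise a a') ∧ PairInj S (R.piecewise b b') then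
      partialDiff f R S a b u u' a' b' ^ 2 else 0 with hΦ
  have hΦ0 : ∀ u u' a' b', 0 ≤ Φ u u' a' b' := fun u u' a' b' => by
    simp only [hΦ]; split_ifs <;> positivity
  have h1 : ∀ a' b', weight f S (R.piecewise a a') (R.piecewise b b')
      ≤ 4 ^ R.card * 𝔼 u' : κ → Bool, 𝔼 u : κ → Bool, Φ u u' a' b' := by
    intro a' b'
    by_cases h : PairInj S (R.piecewise a a') ∧ PairInj S (R.piecewise b b')
    · simp only [hΦ, weight, if_pos h]
      exact diffBoth_piecewise_sq_le f hRS a b a' b'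
    · simp only [hΦ, weight, if_neg h]
      simp
  have hpw : ∀ {g g' g'' : κ → Bool → Ω}, (∀ s ∈ S \ R, g' s = g'' s) →
      (PairInj S (R.piecewise g g') ↔ PairInj S (R.piecewise g g'')) := by
    intro g g' g'' h
    refine pairInj_congr fun s hs => ?_
    by_cases hsR : s ∈ R
    · simp [hsR]
    · simp [hsR, h s (Finset.mem_sdiff.2 ⟨hs, hsR⟩)]
  have h2 : ∀ u u', 𝔼 a' : κ → Bool → Ω, 𝔼 b' : κ → Bool → Ω, Φ u u' a' b'
      ≤ 𝔼 a' : κ → Bool → {y // y ∉ R.image (sel a u)},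
        𝔼 b' : κ → Bool → {y // y ∉ R.image (sel a u)},
          weight (restrictPerm f (R.image (sel a u)) (x₀ u u')) (S \ R) a' b' := by
    intro u u'
    have hne : Nonempty {y // y ∉ R.image (sel a u)} := by
      rw [← Fintype.card_pos_iff, card_compl_subtype,
        Finset.card_image_of_injOn (ha.injOn_sel u)]
      omega
    have hnotin : ∀ {g g' : κ → Bool → Ω} {v : κ → Bool}, PairInj S (R.piecewise g g') →
        ∀ s ∈ S \ R, ∀ c, g' s c ∉ R.image (sel g v) := by
      intro g g' v hg s hs c hmem
      obtain ⟨t, ht, hts⟩ := Finset.mem_image.1 hmem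
      have hsR := (Finset.mem_sdiff.1 hs).2
      have := (hg t (hRS ht) s (Finset.mem_sdiff.1 hs).1 (v t) c (by
        simp only [Finset.piecewise_eq_of_mem _ _ _ ht, Finset.piecewise_eq_of_notMem _ _ _ hsR]
        exact hts)).1
      exact hsR (this ▸ ht)
    set ea : (Bool → {y // y ∉ R.image (sel a u)}) → (Bool → Ω) := fun g c => (g c : Ω)
    set eb : (Bool → {y // y ∉ R.image (sel a u)}) → (Bool → Ω) := fun g c => x₀ u u' (g c : Ω)
    have hea : Function.Injective ea := fun g g' h =>
      funext fun c => Subtype.ext (congrFun h c)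
    have heb : Function.Injective eb := fun g g' h =>
      funext fun c => Subtype.ext ((x₀ u u').injective (congrFun h c))
    have s1 : 𝔼 a' : κ → Bool → Ω, 𝔼 b' : κ → Bool → Ω, Φ u u' a' b'
        ≤ 𝔼 a' : κ → Bool → {y // y ∉ R.image (sel a u)}, 𝔼 b', Φ u u' (ea ∘ a') b' := by
      refine expect_le_expect_comp hea (S := S \ R)
        (φ := fun a' => 𝔼 b', Φ u u' a' b') (fun a' => expect_nonneg fun b' => hΦ0 _ _ _ _) ?_ ?_
      · intro a' a'' h
        refine Finset.expect_congr rfl fun b' _ => ?_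
        simp only [hΦ]
        rw [partialDiff_congr f a b u u' h fun _ _ => rfl]
        exact if_congr (and_congr (hpw h) Iff.rfl) rfl rfl
      · intro a' hne s hs
        obtain ⟨b', -, hb'⟩ := Finset.exists_ne_zero_of_expect_ne_zero hne
        have hP : PairInj S (R.piecewise a a') := by
          by_contra hP
          exact hb' (by simp only [hΦ]; rw [if_neg fun h => hP h.1])
        exact ⟨fun c => ⟨a' s c, hnotin hP s hs c⟩, rfl⟩
    refine s1.trans (expect_mono fun a' => ?_)
    have s2 : 𝔼 b', Φ u u' (ea ∘ a') b'
        ≤ 𝔼 b' : κ → Bool → {y // y ∉ R.image (sel a u)}, Φ u u' (ea ∘ a') (eb ∘ b') := by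
      refine expect_le_expect_comp heb (S := S \ R)
        (φ := fun b' => Φ u u' (ea ∘ a') b') (fun b' => hΦ0 _ _ _ _) ?_ ?_
      · intro b' b'' h
        simp only [hΦ]
        rw [partialDiff_congr f a b u u' (fun _ _ => rfl) h]
        exact if_congr (and_congr Iff.rfl (hpw h)) rfl rfl
      · intro b' hne s hs
        have hP : PairInj S (R.piecewise b b') := by
          by_contra hP
          exact hne (by simp only [hΦ]; rw [if_neg fun h => hP h.2])
        have key : ∀ c, (x₀ u u').symm (b' s c) ∉ R.image (sel a u) := by
          intro c hmem
          obtain ⟨t, ht, hts⟩ := Finset.mem_image.1 hmem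
          refine hnotin (v := u') hP s hs c (Finset.mem_image.2 ⟨t, ht, ?_⟩)
          rw [← hx₀ u u' t ht, hts, Equiv.apply_symm_apply]
        exact ⟨fun c => ⟨(x₀ u u').symm (b' s c), key c⟩, by ext c; simp [eb]⟩
    refine s2.trans (expect_mono fun b' => ?_)
    by_cases h : PairInj S (R.piecewise a (ea ∘ a')) ∧ PairInj S (R.piecewise b (eb ∘ b'))
    · have hP : PairInj (S \ R) a' ∧ PairInj (S \ R) b' := by
        constructor
        · intro s hs t ht c d hcd
          refine h.1 s (Finset.mem_sdiff.1 hs).1 t (Finset.mem_sdiff.1 ht).1 c d ?_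
          simp only [Finset.piecewise_eq_of_notMem _ _ _ (Finset.mem_sdiff.1 hs).2,
            Finset.piecewise_eq_of_notMem _ _ _ (Finset.mem_sdiff.1 ht).2, Function.comp, ea, hcd]
        · intro s hs t ht c d hcd
          refine h.2 s (Finset.mem_sdiff.1 hs).1 t (Finset.mem_sdiff.1 ht).1 c d ?_
          simp only [Finset.piecewise_eq_of_notMem _ _ _ (Finset.mem_sdiff.1 hs).2,
            Finset.piecewise_eq_of_notMem _ _ _ (Finset.mem_sdiff.1 ht).2, Function.comp, eb, hcd]
      simp only [hΦ]
      rw [if_pos h, weight, if_pos hP,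
        ← partialDiff_eq_restrictPerm f hRS a b u u' (ha.injOn_sel u) (hx₀ u u') a' b']
      rfl
    · simp only [hΦ]
      rw [if_neg h]
      exact weight_nonneg _ _ _ _
  calc 𝔼 a' : κ → Bool → Ω, 𝔼 b' : κ → Bool → Ω,
        weight f S (R.piecewise a a') (R.piecewise b b')
      ≤ 𝔼 a' : κ → Bool → Ω, 𝔼 b' : κ → Bool → Ω,
        4 ^ R.card * 𝔼 u' : κ → Bool, 𝔼 u : κ → Bool, Φ u u' a' b' :=
        expect_mono fun a' => expect_mono fun b' => h1 a' b'
    _ = 4 ^ R.card * 𝔼 u' : κ → Bool, 𝔼 u : κ → Bool,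
          𝔼 a' : κ → Bool → Ω, 𝔼 b' : κ → Bool → Ω, Φ u u' a' b' := by
        simp_rw [← Finset.mul_expect]
        congr 1
        rw [Finset.expect_congr rfl fun a' _ => Finset.expect_comm _ _ _, Finset.expect_comm]
        refine Finset.expect_congr rfl fun u' _ => ?_
        rw [Finset.expect_congr rfl fun a' _ => Finset.expect_comm _ _ _, Finset.expect_comm]
    _ ≤ _ := by
        refine mul_le_mul_of_nonneg_left ?_ (by positivity)
        exact expect_mono fun u' => expect_mono fun u => h2 u u'

/-! ### The level inequality for two-sided differences -/

/-- A comparison of averages of nonnegative functions of few coordinates gives a comparison of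
moments. -/
theorem expect_sum_pow_comp_le {ι Z : Type} [Fintype ι] [Fintype Z] (ζ : ι → κ → Z)
    {𝒮 : Finset (Finset κ)} {d : ℕ} (h𝒮 : ∀ S ∈ 𝒮, S.card ≤ d)
    {w : Finset κ → (κ → Z) → ℝ} (hw0 : ∀ S z, 0 ≤ w S z) (hw : ∀ S, DependsOn (w S) S)
    {c : ℝ} {m : ℕ} (hζ : ∀ (U : Finset κ) (P : (κ → Z) → ℝ), U.card ≤ m → (∀ z, 0 ≤ P z) →
      DependsOn P U → 𝔼 q, P (ζ q) ≤ c * 𝔼 z, P z) (p : ℕ) (hp : d * p ≤ m) :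
    𝔼 q, (∑ S ∈ 𝒮, w S (ζ q)) ^ p ≤ c * 𝔼 z, (∑ S ∈ 𝒮, w S z) ^ p := by
  have key : ∀ (r : ℕ) (U : Finset κ) (P : (κ → Z) → ℝ), U.card + d * r ≤ m → (∀ z, 0 ≤ P z) →
      DependsOn P U → 𝔼 q, P (ζ q) * (∑ S ∈ 𝒮, w S (ζ q)) ^ r
        ≤ c * 𝔼 z, P z * (∑ S ∈ 𝒮, w S z) ^ r := by
    intro r
    induction r with
    | zero => intro U P hU hP0 hP; simpa using hζ U P (by omega) hP0 hP
    | succ r ih =>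
      intro U P hU hP0 hP
      have e : ∀ z, P z * (∑ S ∈ 𝒮, w S z) ^ (r + 1)
          = ∑ S ∈ 𝒮, P z * w S z * (∑ S ∈ 𝒮, w S z) ^ r := by
        intro z; rw [← Finset.sum_mul, ← Finset.mul_sum]; ring
      simp_rw [e]
      rw [Finset.expect_sum_comm, Finset.expect_sum_comm, Finset.mul_sum]
      refine Finset.sum_le_sum fun S hS => ?_
      refine ih (U ∪ S) (fun z => P z * w S z) ?_ (fun z => mul_nonneg (hP0 z) (hw0 S z)) ?_
      · have := Finset.card_union_le U S
        have := h𝒮 S hS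
        rw [Nat.mul_succ] at hU
        omega
      · intro x y hxy
        have h1 : P x = P y := hP fun i hi => hxy i (by simp_all)
        have h2 : w S x = w S y := hw S fun i hi => hxy i (by simp_all)
        simp only [h1, h2]
  simpa using key p ∅ (fun _ => 1) (by simpa using hp) (fun _ => zero_le_one) fun _ _ _ => rfl

theorem expect_prodArrow {A B : Type} [Fintype A] [Fintype B] (φ : (κ → A) → (κ → B) → ℝ) :
    𝔼 z : κ → A × B, φ (fun s => (z s).1) (fun s => (z s).2)
      = 𝔼 a : κ → A, 𝔼 b : κ → B, φ a b := by
  rw [← Finset.expect_product (f := fun q : (κ → A) × (κ → B) => φ q.1 q.2),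
    Finset.univ_product_univ]
  exact Fintype.expect_equiv (Equiv.arrowProdEquivProdArrow κ (fun _ => A) (fun _ => B)) _ _
    fun z => rfl

/-- The positions `ρ ∘ e` and the values `x ∘ ρ ∘ e` at them, for the fixed pairs `e` and
permutations `ρ` and `x`. -/
def pairData (e : κ → Bool → Ω) (q : Equiv.Perm Ω × Equiv.Perm Ω) : κ → (Bool → Ω) × (Bool → Ω) :=
  fun s => (fun b => q.1 (e s b), fun b => q.2 (q.1 (e s b)))

/-- Distinct points and their values under a random permutation, seen through few of the pairs, have
bounded density with respect to independent uniform points. -/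
theorem expect_pairData_le {e : κ → Bool → Ω} (he : PairInj Finset.univ e) {U : Finset κ}
    (hU : 4 * U.card ≤ Fintype.card Ω) {P : (κ → (Bool → Ω) × (Bool → Ω)) → ℝ}
    (hP0 : ∀ z, 0 ≤ P z) (hP : DependsOn P U) :
    𝔼 q : Equiv.Perm Ω × Equiv.Perm Ω, P (pairData e q) ≤ 16 ^ U.card * 𝔼 z, P z := by
  classical
  set ψ : (κ → Bool → Ω) → (κ → Bool → Ω) → ℝ := fun a b => P fun s => (a s, b s) with hψ
  set r := injRatio Ω (2 * U.card) with hr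
  have hr1 : 1 ≤ r := one_le_injRatio (by omega)
  have hr2 : r * r ≤ 16 ^ U.card := by
    have := injRatio_le (Ω := Ω) (d := 2 * U.card) (by omega)
    calc r * r ≤ 2 ^ (2 * U.card) * 2 ^ (2 * U.card) := by gcongr
      _ = 16 ^ U.card := by rw [pow_mul, ← mul_pow]; norm_num
  have heU : PairInj U e := he.mono (Finset.subset_univ U)
  have h1 : 𝔼 q : Equiv.Perm Ω × Equiv.Perm Ω, P (pairData e q)
      = 𝔼 ρ : Equiv.Perm Ω, 𝔼 x : Equiv.Perm Ω,
        ψ (fun s b => ρ (e s b)) (fun s b => x (ρ (e s b))) := by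
    rw [← Finset.univ_product_univ, Finset.expect_product]; rfl
  have h2 : ∀ ρ : Equiv.Perm Ω, 𝔼 x : Equiv.Perm Ω,
      ψ (fun s b => ρ (e s b)) (fun s b => x (ρ (e s b)))
      = r * 𝔼 b : κ → Bool → Ω, if PairInj U b then ψ (fun s b => ρ (e s b)) b else 0 := fun ρ =>
    expect_comp_pairs (heU.comp_perm ρ) (ψ := ψ fun s b => ρ (e s b)) fun b b' h =>
      hP fun s hs => by simp [h s hs]
  have h3 : ∀ b : κ → Bool → Ω, 𝔼 ρ : Equiv.Perm Ω, ψ (fun s b => ρ (e s b)) b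
      = r * 𝔼 a : κ → Bool → Ω, if PairInj U a then ψ a b else 0 := fun b =>
    expect_comp_pairs heU (ψ := fun a => ψ a b) fun a a' h => hP fun s hs => by simp [h s hs]
  have h4 : ∀ b : κ → Bool → Ω, 𝔼 ρ : Equiv.Perm Ω,
      (if PairInj U b then ψ (fun s b => ρ (e s b)) b else 0) ≤ r * 𝔼 a, ψ a b := by
    intro b
    have h5 : 𝔼 ρ : Equiv.Perm Ω, (if PairInj U b then ψ (fun s b => ρ (e s b)) b else 0)
        ≤ 𝔼 ρ : Equiv.Perm Ω, ψ (fun s b => ρ (e s b)) b :=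
      expect_mono fun ρ => by split_ifs; exacts [le_rfl, hP0 _]
    refine h5.trans ?_
    rw [h3]
    refine mul_le_mul_of_nonneg_left (expect_mono fun a => ?_) (by linarith)
    split_ifs; exacts [le_rfl, hP0 _]
  have h6 : 𝔼 z, P z = 𝔼 b : κ → Bool → Ω, 𝔼 a : κ → Bool → Ω, ψ a b := by
    rw [Finset.expect_comm, ← expect_prodArrow ψ]
  rw [h1, h6]
  simp_rw [h2]
  rw [← Finset.mul_expect, Finset.expect_comm]
  have hnn : 0 ≤ 𝔼 b : κ → Bool → Ω, 𝔼 a : κ → Bool → Ω, ψ a b :=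
    expect_nonneg fun b => expect_nonneg fun a => hP0 _
  calc r * 𝔼 b : κ → Bool → Ω, 𝔼 ρ : Equiv.Perm Ω,
        (if PairInj U b then ψ (fun s b => ρ (e s b)) b else 0)
      ≤ r * 𝔼 b : κ → Bool → Ω, r * 𝔼 a, ψ a b := by
        refine mul_le_mul_of_nonneg_left (expect_mono h4) (by linarith)
    _ = r * r * 𝔼 b : κ → Bool → Ω, 𝔼 a, ψ a b := by rw [← Finset.mul_expect, mul_assoc]
    _ ≤ _ := mul_le_mul_of_nonneg_right hr2 hnn

variable (κ) in
/-- The sum over the `d`-subsets of `κ` of the means of the weights of `f` for independent uniform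
pairs of positions and of values. -/
noncomputable def weightSum (f : Equiv.Perm Ω → ℝ) (d : ℕ) : ℝ :=
  ∑ S ∈ Finset.powersetCard d (Finset.univ : Finset κ),
    𝔼 a : κ → Bool → Ω, 𝔼 b : κ → Bool → Ω, weight f S a b

/-- The correlation of `f` with the sum of its two-sided differences along the random disjoint pairs
`ρ ∘ e`. -/
noncomputable def corr (f : Equiv.Perm Ω → ℝ) (e : κ → Bool → Ω) (d : ℕ) : ℝ :=
  ∑ S ∈ Finset.powersetCard d (Finset.univ : Finset κ),
    𝔼 ρ : Equiv.Perm Ω, 𝔼 x : Equiv.Perm Ω,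
      f x * diffBoth f S (fun s b => ρ (e s b)) (fun s b => x (ρ (e s b)))

theorem weightSum_nonneg (f : Equiv.Perm Ω → ℝ) (d : ℕ) : 0 ≤ weightSum κ f d :=
  Finset.sum_nonneg fun _ _ => expect_nonneg fun _ => expect_nonneg fun _ => weight_nonneg _ _ _ _

theorem weightSum_le_corr (f : Equiv.Perm Ω → ℝ) {e : κ → Bool → Ω}
    (he : PairInj Finset.univ e) {d : ℕ} (hd : 2 * d ≤ Fintype.card Ω) :
    weightSum κ f d ≤ 2 ^ d * corr f e d := by
  rw [weightSum, corr, Finset.mul_sum]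
  refine Finset.sum_le_sum fun S hS => ?_
  have hS' := (Finset.mem_powersetCard.1 hS).2
  have := expect_weight_le f (he.mono (Finset.subset_univ S)) (by omega)
  rwa [hS'] at this

/-- Random exchanges within the pairs turn the sum of the two-sided differences into a homogeneous
polynomial in random signs, so that its even moments are controlled by those of its square
function. -/
theorem expect_sum_diffBoth_pow_le (f : Equiv.Perm Ω → ℝ) {a : κ → Bool → Ω}
    (ha : PairInj Finset.univ a) (d : ℕ) {p : ℕ} (hp : p ≠ 0) :
    𝔼 x : Equiv.Perm Ω, (∑ S ∈ Finset.powersetCard d (Finset.univ : Finset κ),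
        diffBoth f S a (fun s b => x (a s b))) ^ (2 * p)
      ≤ (4 * p : ℝ) ^ (d * p) * 𝔼 x : Equiv.Perm Ω,
        (∑ S ∈ Finset.powersetCard d (Finset.univ : Finset κ),
          weight f S a (fun s b => x (a s b))) ^ p := by
  classical
  have hflip : ∀ t : κ → Bool, ∃ y : Equiv.Perm Ω, ∀ s c, y (a s c) = a s (xor c (t s)) := by
    intro t
    obtain ⟨y, hy⟩ := exists_perm_apply_eq
      (Q := ((Finset.univ : Finset κ) ×ˢ (Finset.univ : Finset Bool)))
      (i := Function.uncurry a) (j := fun q => a q.1 (xor q.2 (t q.1)))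
      (pairInj_iff_injOn.1 ha) (by
        rintro ⟨s, b⟩ _ ⟨s', b'⟩ _ h
        obtain ⟨rfl, h2⟩ := ha s (Finset.mem_univ _) s' (Finset.mem_univ _) _ _ h
        simpa using h2)
    exact ⟨y, fun s c => hy (s, c) (by simp)⟩
  choose y hy using hflip
  set D : Finset κ → Equiv.Perm Ω → ℝ := fun S x => diffBoth f S a (fun s b => x (a s b)) with hD
  have h1 : ∀ (t : κ → Bool), 𝔼 x : Equiv.Perm Ω,
      (∑ S ∈ Finset.powersetCard d (Finset.univ : Finset κ), D S x) ^ (2 * p)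
      = 𝔼 x : Equiv.Perm Ω,
        (∑ S ∈ Finset.powersetCard d (Finset.univ : Finset κ), D S x * sgn S t) ^ (2 * p) := by
    intro t
    refine (Fintype.expect_equiv (Equiv.mulRight (y t)) _ _ fun x => ?_).symm
    congr 1
    refine Finset.sum_congr rfl fun S _ => ?_
    simp only [hD, Equiv.coe_mulRight, Equiv.Perm.mul_apply, hy]
    rw [diffBoth_flip f S a (fun s b => x (a s b)) t, mul_comm]
  have h2 : 𝔼 x : Equiv.Perm Ω,
      (∑ S ∈ Finset.powersetCard d (Finset.univ : Finset κ), D S x) ^ (2 * p)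
      = 𝔼 x : Equiv.Perm Ω, 𝔼 t : κ → Bool,
        (∑ S ∈ Finset.powersetCard d (Finset.univ : Finset κ), D S x * sgn S t) ^ (2 * p) := by
    rw [Finset.expect_comm, ← Finset.expect_congr rfl fun t _ => h1 t, Fintype.expect_const]
  rw [h2, Finset.mul_expect]
  refine expect_mono fun x => ?_
  have hB := expect_sum_sgn_pow_le p hp (Finset.univ : Finset κ)
    fun S => if S.card = d then D S x else 0
  simp only [ite_mul, zero_mul, ← Finset.sum_filter, ← Finset.powersetCard_eq_filter] at hB
  refine hB.trans (le_of_eq ?_)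
  rw [pow_mul, ← mul_pow, Finset.mul_sum]
  congr 1
  rw [Finset.powersetCard_eq_filter, Finset.sum_filter]
  refine Finset.sum_congr rfl fun S _ => ?_
  by_cases hS : S.card = d
  · have hP : PairInj S a ∧ PairInj S (fun s b => x (a s b)) :=
      ⟨ha.mono (Finset.subset_univ S), (ha.mono (Finset.subset_univ S)).comp_perm x⟩
    simp only [weight, if_pos hP, hS, hD, if_true]
  · simp [if_neg hS]

/-- Hölder's inequality with exponent `2p`, where `μ⁻¹ ≤ 3 ^ p`, loses only a constant against the factor
`μ ^ 2`; the moment of order `2p` is bounded in terms of conditional sums of weights. -/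
theorem corr_sq_le {f : Equiv.Perm Ω → ℝ} (hf : ∀ x, f x = 0 ∨ f x = 1) {μ : ℝ} (hμ : 0 < μ)
    (hfμ : 𝔼 x, f x ≤ μ) {p : ℕ} (hp : p ≠ 0) (hμp : μ⁻¹ ≤ 3 ^ p) {e : κ → Bool → Ω}
    (he : PairInj Finset.univ e) {d : ℕ} (hd : 4 * (d * p) ≤ Fintype.card Ω) {Λ : ℝ} (hΛ0 : 0 ≤ Λ)
    (hΛ : ∀ (R : Finset κ) (a b : κ → Bool → Ω),
      ∑ S ∈ (Finset.powersetCard d (Finset.univ : Finset κ)).filter (R ⊆ ·),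
        𝔼 a' : κ → Bool → Ω, 𝔼 b' : κ → Bool → Ω,
          weight f S (R.piecewise a a') (R.piecewise b b') ≤ Λ) :
    corr f e d ^ 2 ≤ 3 * μ ^ 2 * (64 * p * (d * p + 1)) ^ d * Λ := by
  classical
  set 𝒮 := Finset.powersetCard d (Finset.univ : Finset κ) with h𝒮
  set h : Equiv.Perm Ω × Equiv.Perm Ω → ℝ := fun q =>
    ∑ S ∈ 𝒮, diffBoth f S (fun s b => q.1 (e s b)) (fun s b => q.2 (q.1 (e s b))) with hh
  set w : Finset κ → (κ → (Bool → Ω) × (Bool → Ω)) → ℝ := fun S z =>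
    weight f S (fun s => (z s).1) (fun s => (z s).2) with hw
  have hf0 : ∀ x, 0 ≤ f x := fun x => by rcases hf x with h | h <;> simp [h]
  have hw0 : ∀ S z, 0 ≤ w S z := fun S z => weight_nonneg _ _ _ _
  have hwd : ∀ S, DependsOn (w S) S := fun S z z' h =>
    weight_congr f (fun s hs => by rw [h s hs]) fun s hs => by rw [h s hs]
  have h𝒮d : ∀ S ∈ 𝒮, S.card ≤ d := fun S hS => (Finset.mem_powersetCard.1 hS).2.le
  have hcorr : corr f e d = 𝔼 q : Equiv.Perm Ω × Equiv.Perm Ω, f q.2 * h q := by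
    rw [corr, ← Finset.univ_product_univ, Finset.expect_product]
    simp only [hh, Finset.mul_sum]
    rw [← Finset.expect_sum_comm]
    refine Finset.expect_congr rfl fun ρ _ => ?_
    rw [← Finset.expect_sum_comm]
  have hmean : 𝔼 q : Equiv.Perm Ω × Equiv.Perm Ω, f q.2 ≤ μ := by
    rw [← Finset.univ_product_univ, Finset.expect_product]
    simpa using hfμ
  -- the moment of order `2p` of `h`
  have hmom : 𝔼 q, h q ^ (2 * p) ≤ (4 * p : ℝ) ^ (d * p) * (16 ^ (d * p) *
      (((d * p : ℕ) + 1 : ℝ) ^ d * Λ) ^ p) := by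
    have s1 : 𝔼 q, h q ^ (2 * p)
        ≤ (4 * p : ℝ) ^ (d * p) * 𝔼 q, (∑ S ∈ 𝒮, w S (pairData e q)) ^ p := by
      rw [← Finset.univ_product_univ, Finset.expect_product, Finset.expect_product,
        Finset.mul_expect]
      refine expect_mono fun ρ => ?_
      exact expect_sum_diffBoth_pow_le f (he.comp_perm ρ) d hp
    have s2 : 𝔼 q, (∑ S ∈ 𝒮, w S (pairData e q)) ^ p
        ≤ 16 ^ (d * p) * 𝔼 z, (∑ S ∈ 𝒮, w S z) ^ p := by
      refine expect_sum_pow_comp_le (pairData e) h𝒮d hw0 hwd (m := d * p) ?_ p le_rfl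
      intro U P hU hP0 hP
      refine (expect_pairData_le he (by omega) hP0 hP).trans ?_
      refine mul_le_mul_of_nonneg_right ?_ (expect_nonneg hP0)
      exact pow_le_pow_right₀ (by norm_num) hU
    have s3 : 𝔼 z, (∑ S ∈ 𝒮, w S z) ^ p ≤ (((d * p : ℕ) + 1 : ℝ) ^ d * Λ) ^ p := by
      refine expect_sum_pow_le h𝒮d hw0 hwd hΛ0 (fun R z => ?_) p
      refine le_trans (le_of_eq ?_) (hΛ R (fun s => (z s).1) fun s => (z s).2)
      refine Finset.sum_congr rfl fun S _ => ?_
      rw [← expect_prodArrow fun a' b' => weight f S (R.piecewise (fun s => (z s).1) a')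
        (R.piecewise (fun s => (z s).2) b')]
      refine Finset.expect_congr rfl fun z' _ => ?_
      simp only [hw]
      congr 1 <;> · ext s; by_cases hs : s ∈ R <;> simp [hs]
    refine s1.trans (mul_le_mul_of_nonneg_left (s2.trans ?_) (by positivity))
    exact mul_le_mul_of_nonneg_left s3 (by positivity)
  have hH := expect_indicator_mul_pow_le (f := fun q : Equiv.Perm Ω × Equiv.Perm Ω => f q.2)
    (fun q => hf q.2) h (q := 2 * p) (by simp) (by omega)
  rw [← hcorr] at hH
  have hX : corr f e d ^ (2 * p) ≤ μ ^ (2 * p - 1) * ((4 * p : ℝ) ^ (d * p) * (16 ^ (d * p) *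
      (((d * p : ℕ) + 1 : ℝ) ^ d * Λ) ^ p)) := by
    refine hH.trans (mul_le_mul ?_ hmom (expect_nonneg fun q => by
      rw [pow_mul]; positivity) (by positivity))
    exact pow_le_pow_left₀ (expect_nonneg fun q : Equiv.Perm Ω × Equiv.Perm Ω => hf0 q.2) hmean _
  have hμ2 : μ ^ (2 * p - 1) ≤ (3 * μ ^ 2) ^ p := by
    have e1 : μ ^ (2 * p) = μ ^ (2 * p - 1) * μ := by
      rw [← pow_succ, Nat.sub_add_cancel (by omega)]
    have e2 : μ ^ (2 * p - 1) = μ ^ (2 * p) * μ⁻¹ := by rw [e1]; field_simp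
    rw [e2, mul_pow, ← pow_mul, mul_comm]
    exact mul_le_mul_of_nonneg_right hμp (by positivity)
  have hfin : (corr f e d ^ 2) ^ p ≤ (3 * μ ^ 2 * (64 * p * (d * p + 1)) ^ d * Λ) ^ p := by
    rw [← pow_mul]
    refine hX.trans ((mul_le_mul_of_nonneg_right hμ2 (by positivity)).trans (le_of_eq ?_))
    rw [pow_mul (4 * (p : ℝ)), pow_mul (16 : ℝ), ← mul_pow, ← mul_pow, ← mul_pow]
    congr 1
    have : (64 * p * (d * p + 1) : ℝ) ^ d = (4 * p) ^ d * 16 ^ d * (d * p + 1) ^ d := by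
      rw [← mul_pow, ← mul_pow]; congr 1; ring
    rw [this]
    push_cast
    ring
  exact (pow_le_pow_iff_left₀ (sq_nonneg _) (by positivity) hp).1 hfin

theorem PermGlobal.expect_le {d : ℕ} {μ : ℝ} {f : Equiv.Perm Ω → ℝ} (hf : PermGlobal d μ f) :
    𝔼 x, f x ≤ μ := by
  have h := hf ∅ (by simp) 1
  simp only [Finset.notMem_empty, false_imp_iff, implies_true, if_true, Finset.card_empty,
    Nat.sub_zero] at h
  rw [Fintype.expect_eq_sum_div_card, Fintype.card_perm, div_le_iff₀ (by positivity)]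
  exact h

theorem PermGlobal.mono {d d' : ℕ} {μ : ℝ} {f : Equiv.Perm Ω → ℝ} (hf : PermGlobal d μ f)
    (h : d' ≤ d) : PermGlobal d' μ f :=
  fun Q hQ => hf Q (hQ.trans h)

theorem exists_pairInj (h : 2 * Fintype.card κ ≤ Fintype.card Ω) :
    ∃ e : κ → Bool → Ω, PairInj Finset.univ e := by
  obtain ⟨e⟩ := Function.Embedding.nonempty_of_card_le (α := κ × Bool) (β := Ω)
    (by rw [Fintype.card_prod, Fintype.card_bool]; omega)
  refine ⟨fun s b => e (s, b), fun s _ t _ b c h => ?_⟩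
  simpa using e.injective h

/-- The conditional sums entering the moment bound are controlled by the same quantities at lower
levels, for restrictions of `f`. -/
theorem sum_weight_piecewise_le {f : Equiv.Perm Ω → ℝ} {d : ℕ} {R : Finset κ}
    (hR : R.card < Fintype.card Ω) (a b : κ → Bool → Ω) {B : ℝ} (hB0 : 0 ≤ B)
    (hB : ∀ (Q : Finset Ω) (x₀ : Equiv.Perm Ω), Q.card = R.card →
      weightSum κ (restrictPerm f Q x₀) (d - R.card) ≤ B) :
    ∑ S ∈ (Finset.powersetCard d (Finset.univ : Finset κ)).filter (R ⊆ ·),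
        𝔼 a' : κ → Bool → Ω, 𝔼 b' : κ → Bool → Ω,
          weight f S (R.piecewise a a') (R.piecewise b b') ≤ 4 ^ R.card * B := by
  classical
  by_cases hab : PairInj R a ∧ PairInj R b
  swap
  · refine le_trans (le_of_eq (Finset.sum_eq_zero fun S hS => ?_)) (by positivity)
    have hRS : R ⊆ S := (Finset.mem_filter.1 hS).2
    refine Finset.expect_eq_zero fun a' _ => Finset.expect_eq_zero fun b' _ => if_neg fun h => hab ?_
    exact ⟨(pairInj_congr fun s hs => by simp [hs]).1 (h.1.mono hRS),
      (pairInj_congr fun s hs => by simp [hs]).1 (h.2.mono hRS)⟩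
  obtain ⟨Q, x₀, hQ, hle⟩ := exists_expect_weight_piecewise_le f hR hab.1 hab.2
  refine (Finset.sum_le_sum fun S hS => hle S (Finset.mem_filter.1 hS).2).trans ?_
  rw [← Finset.mul_sum]
  refine mul_le_mul_of_nonneg_left ?_ (by positivity)
  rw [← Finset.expect_sum_comm]
  refine Finset.expect_le Finset.univ_nonempty fun u' _ => ?_
  rw [← Finset.expect_sum_comm]
  refine Finset.expect_le Finset.univ_nonempty fun u _ => ?_
  refine le_trans ?_ (hB (Q u) (x₀ u u') (hQ u))
  have hinj : Set.InjOn (fun S : Finset κ => S \ R)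
      ((Finset.powersetCard d (Finset.univ : Finset κ)).filter (R ⊆ ·)) := by
    intro S hS T hT hST
    have h1 := (Finset.mem_filter.1 (Finset.mem_coe.1 hS)).2
    have h2 := (Finset.mem_filter.1 (Finset.mem_coe.1 hT)).2
    rw [← Finset.sdiff_union_of_subset h1, ← Finset.sdiff_union_of_subset h2]
    simp only at hST
    rw [hST]
  rw [weightSum, ← Finset.sum_image (f := fun T => 𝔼 a' : κ → Bool → {y // y ∉ Q u},
    𝔼 b' : κ → Bool → {y // y ∉ Q u}, weight (restrictPerm f (Q u) (x₀ u u')) T a' b') hinj]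
  refine Finset.sum_le_sum_of_subset_of_nonneg ?_ fun _ _ _ =>
    expect_nonneg fun _ => expect_nonneg fun _ => weight_nonneg _ _ _ _
  intro T hT
  obtain ⟨S, hS, rfl⟩ := Finset.mem_image.1 hT
  obtain ⟨hS1, hS2⟩ := Finset.mem_filter.1 hS
  rw [Finset.mem_powersetCard] at hS1 ⊢
  exact ⟨Finset.subset_univ _, by rw [Finset.card_sdiff_of_subset hS2, hS1.2]⟩

/-- The level inequality: for a global Boolean function, the two-sided differences of order `d` are
of size `μ²`, up to a power of a polynomial in `D` and `p`. The moment
bound refers to the weights of `f` itself, for `R = ∅`, and to those of its restrictions at lower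
levels; the former are absorbed, as they enter to the first power on the right and to the second on
the left. -/
theorem weightSum_le {D p : ℕ} (hp : p ≠ 0) {μ : ℝ} (hμ : 0 < μ) (hμp : μ⁻¹ ≤ 3 ^ p) (d : ℕ) :
    d ≤ D → ∀ {Ω : Type} [Fintype Ω] [DecidableEq Ω] {f : Equiv.Perm Ω → ℝ},
      (∀ x, f x = 0 ∨ f x = 1) → PermGlobal d μ f → 2 * Fintype.card κ + d ≤ Fintype.card Ω →
      4 * (D * p) + 2 * d ≤ Fintype.card Ω →
      weightSum κ f d ≤ 3 * μ ^ 2 * (4 * (64 * p * (D * p + 1))) ^ d ∧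
      ∀ e : κ → Bool → Ω, PairInj Finset.univ e →
        corr f e d ≤ 3 * μ ^ 2 * (2 * (64 * p * (D * p + 1))) ^ d := by
  induction d using Nat.strong_induction_on with
  | _ d ih =>
    intro hdD Ω _ _ f hf hglob hκ hn
    set M : ℝ := 64 * p * (D * p + 1) with hM
    have hp1 : (1 : ℝ) ≤ p := by exact_mod_cast Nat.one_le_iff_ne_zero.2 hp
    have hM1 : 1 ≤ M := by
      have : (0 : ℝ) ≤ D * p := by positivity
      rw [hM]; nlinarith
    have hdM : 64 * p * (d * p + 1) ≤ M := by
      have : (d : ℝ) ≤ D := by exact_mod_cast hdD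
      rw [hM]; gcongr
    clear_value M
    set B : ℝ := 3 * μ ^ 2 * (4 * M) ^ d with hB
    have hB0 : 0 < B := by positivity
    have hdp : d * p ≤ D * p := Nat.mul_le_mul_right p hdD
    have hΛ : ∀ (R : Finset κ) (a b : κ → Bool → Ω),
        ∑ S ∈ (Finset.powersetCard d (Finset.univ : Finset κ)).filter (R ⊆ ·),
          𝔼 a' : κ → Bool → Ω, 𝔼 b' : κ → Bool → Ω,
            weight f S (R.piecewise a a') (R.piecewise b b') ≤ max (weightSum κ f d) B := by
      intro R a b
      rcases R.eq_empty_or_nonempty with rfl | hR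
      · refine le_trans (le_of_eq ?_) (le_max_left _ _)
        simp [weightSum]
      have hR0 : 0 < R.card := hR.card_pos
      by_cases hRd : R.card ≤ d
      swap
      · refine le_trans (le_of_eq (Finset.sum_eq_zero fun S hS => ?_)) (hB0.le.trans (le_max_right _ _))
        obtain ⟨h1, h2⟩ := Finset.mem_filter.1 hS
        exact absurd ((Finset.card_le_card h2).trans (Finset.mem_powersetCard.1 h1).2.le) hRd
      refine le_trans ?_ (le_max_right _ _)
      refine (sum_weight_piecewise_le (by omega) a b
        (B := 3 * μ ^ 2 * (4 * M) ^ (d - R.card)) (by positivity) ?_).trans ?_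
      · intro Q x₀ hQ
        refine (ih (d - R.card) (by omega) (by omega) (f := restrictPerm f Q x₀)
          (fun σ => hf _) ?_ ?_ ?_).1
        · exact PermGlobal.restrictPerm (by rwa [Nat.sub_add_cancel hRd]) Q hQ x₀
        · rw [card_compl_subtype]; omega
        · rw [card_compl_subtype]; omega
      · have e1 : (4 * M) ^ d = (4 * M) ^ R.card * (4 * M) ^ (d - R.card) := by
          rw [← pow_add, Nat.add_sub_cancel' hRd]
        rw [hB, e1]
        have e2 : (4 : ℝ) ^ R.card ≤ (4 * M) ^ R.card := by gcongr; linarith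
        calc (4 : ℝ) ^ R.card * (3 * μ ^ 2 * (4 * M) ^ (d - R.card))
            ≤ (4 * M) ^ R.card * (3 * μ ^ 2 * (4 * M) ^ (d - R.card)) := by gcongr
          _ = _ := by ring
    have hkey : ∀ e : κ → Bool → Ω, PairInj Finset.univ e →
        corr f e d ^ 2 ≤ 3 * μ ^ 2 * M ^ d * max (weightSum κ f d) B := by
      intro e he
      refine (corr_sq_le hf hμ hglob.expect_le hp hμp he (by omega)
        (hB0.le.trans (le_max_right _ _)) hΛ).trans ?_
      have : 0 ≤ max (weightSum κ f d) B := hB0.le.trans (le_max_right _ _)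
      gcongr
    have hY0 := weightSum_nonneg (κ := κ) f d
    have hYB : weightSum κ f d ≤ B := by
      by_contra hlt
      push Not at hlt
      obtain ⟨e, he⟩ := exists_pairInj (κ := κ) (Ω := Ω) (by omega)
      have h1 := hkey e he
      rw [max_eq_left hlt.le] at h1
      have h2 := weightSum_le_corr f he (d := d) (by omega)
      have h3 : weightSum κ f d ^ 2 ≤ B * weightSum κ f d := by
        calc weightSum κ f d ^ 2 ≤ (2 ^ d * corr f e d) ^ 2 := by gcongr
          _ = 4 ^ d * corr f e d ^ 2 := by
              rw [mul_pow, ← pow_mul, mul_comm d 2, pow_mul]; norm_num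
          _ ≤ 4 ^ d * (3 * μ ^ 2 * M ^ d * weightSum κ f d) := by gcongr
          _ = _ := by rw [hB, mul_pow]; ring
      have h4 : 0 < weightSum κ f d := hB0.trans hlt
      nlinarith
    refine ⟨hYB, fun e he => ?_⟩
    have h1 := hkey e he
    rw [max_eq_right hYB] at h1
    refine le_of_sq_le_sq ?_ (by positivity)
    refine h1.trans (le_of_eq ?_)
    have : (4 : ℝ) ^ d = 2 ^ d * 2 ^ d := by rw [← mul_pow]; norm_num
    rw [hB, mul_pow 4 M, mul_pow 2 M, this]
    ring

/-! ### Functions of low degree on permutations -/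

/-- The orthogonal projection, for the inner product `∑ x, f x * g x`. -/
theorem exists_orthogonal_projection {ι : Type} [Fintype ι] (V : Submodule ℝ (ι → ℝ))
    (f : ι → ℝ) : ∃ v ∈ V, ∀ g ∈ V, ∑ x, (f x - v x) * g x = 0 := by
  set W := V.map (WithLp.linearEquiv 2 ℝ (ι → ℝ)).symm.toLinearMap
  obtain ⟨v, hv, hvf⟩ := W.starProjection_apply_mem (WithLp.toLp 2 f)
  refine ⟨v, hv, fun g hg => ?_⟩
  have h := W.starProjection_inner_eq_zero (WithLp.toLp 2 f) (WithLp.toLp 2 g) ⟨g, hg, rfl⟩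
  rw [← hvf, PiLp.inner_apply] at h
  rw [← h]
  refine Finset.sum_congr rfl fun x _ => ?_
  simp [mul_comm]

/-- A symmetric operator that leaves invariant each of a family of subspaces and is bounded below by
`c` on each of them is bounded below by `c` on their sum: an eigenvector with a smaller eigenvalue is
orthogonal to all the subspaces, as its projections to them are eigenvectors as well. -/
theorem le_inner_of_mem_iSup {E : Type} [NormedAddCommGroup E] [InnerProductSpace ℝ E]
    [FiniteDimensional ℝ E] {A : E →ₗ[ℝ] E} (hA : A.IsSymmetric) {α : Type}
    (J : α → Submodule ℝ E) (hJ : ∀ k, ∀ v ∈ J k, A v ∈ J k) {c : ℝ}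
    (hc : ∀ k, ∀ v ∈ J k, c * inner ℝ v v ≤ inner ℝ v (A v)) {u : E} (hu : u ∈ ⨆ k, J k) :
    c * inner ℝ u u ≤ inner ℝ u (A u) := by
  set b := hA.eigenvectorBasis rfl
  set l := hA.eigenvalues rfl
  have hb : ∀ m, A (b m) = l m • b m := fun m => hA.apply_eigenvectorBasis rfl m
  have hz : ∀ m, l m < c → inner ℝ (b m) u = 0 := by
    intro m hm
    have hle : ⨆ k, J k ≤ LinearMap.ker (innerₛₗ ℝ (b m)) := by
      refine iSup_le fun k v hv => ?_
      set w := (J k).starProjection (b m) with hw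
      have hwJ : w ∈ J k := (J k).starProjection_apply_mem (b m)
      have hort : ∀ g ∈ J k, inner ℝ (b m) g = inner ℝ w g := fun g hg => by
        have := (J k).starProjection_inner_eq_zero (b m) g hg
        rwa [inner_sub_left, sub_eq_zero] at this
      have h1 : inner ℝ w (A w) = l m * inner ℝ w w := by
        rw [← hort _ (hJ k w hwJ), ← hA, hb, real_inner_smul_left, hort w hwJ]
      have h2 := hc k w hwJ
      rw [h1] at h2
      have h3 : 0 ≤ inner ℝ w w := real_inner_self_nonneg
      have h4 : inner ℝ w w = 0 := by nlinarith
      have h5 : w = 0 := inner_self_eq_zero.1 h4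
      change inner ℝ (b m) v = 0
      rw [hort v hv, h5, inner_zero_left]
    exact hle hu
  have e1 : inner ℝ u u = ∑ m, inner ℝ u (b m) * inner ℝ (b m) u := (b.sum_inner_mul_inner u u).symm
  have e2 : inner ℝ u (A u) = ∑ m, l m * (inner ℝ u (b m) * inner ℝ (b m) u) := by
    rw [← b.sum_inner_mul_inner u (A u)]
    refine Finset.sum_congr rfl fun m _ => ?_
    rw [← hA, hb, real_inner_smul_left]; ring
  rw [e1, e2, Finset.mul_sum]
  refine Finset.sum_le_sum fun m _ => ?_
  rcases lt_or_ge (l m) c with h | h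
  · simp [hz m h]
  · refine mul_le_mul_of_nonneg_right h ?_
    rw [real_inner_comm]
    exact mul_self_nonneg _

theorem le_sum_mul_of_mem_iSup {ι : Type} [Fintype ι] {A : (ι → ℝ) →ₗ[ℝ] (ι → ℝ)}
    (hA : ∀ u v, ∑ x, A u x * v x = ∑ x, u x * A v x) {α : Type}
    (J : α → Submodule ℝ (ι → ℝ)) (hJ : ∀ k, ∀ v ∈ J k, A v ∈ J k) {c : ℝ}
    (hc : ∀ k, ∀ v ∈ J k, c * ∑ x, v x ^ 2 ≤ ∑ x, v x * A v x) {u : ι → ℝ} (hu : u ∈ ⨆ k, J k) :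
    c * ∑ x, u x ^ 2 ≤ ∑ x, u x * A u x := by
  set e : (ι → ℝ) ≃ₗ[ℝ] EuclideanSpace ℝ ι := (WithLp.linearEquiv 2 ℝ (ι → ℝ)).symm with he
  have hin : ∀ u v : ι → ℝ, inner ℝ (e u) (e v) = ∑ x, u x * v x := by
    intro u v
    rw [PiLp.inner_apply]
    exact Finset.sum_congr rfl fun x _ => by simp [he, mul_comm]
  have h := le_inner_of_mem_iSup (A := e.toLinearMap ∘ₗ A ∘ₗ e.symm.toLinearMap) (c := c)
    (fun a b => by
      obtain ⟨u, rfl⟩ := e.surjective a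
      obtain ⟨v, rfl⟩ := e.surjective b
      simp [hin, hA]) (fun k => (J k).map e.toLinearMap)
    (by
      rintro k _ ⟨v, hv, rfl⟩
      exact ⟨A v, hJ k v hv, by simp⟩)
    (by
      rintro k _ ⟨v, hv, rfl⟩
      simp only [LinearEquiv.coe_coe, LinearMap.comp_apply, LinearEquiv.symm_apply_apply, hin]
      simpa only [sq] using hc k v hv) (u := e u)
    (by
      rw [← Submodule.map_iSup]
      exact ⟨u, hu, rfl⟩)
  simp only [LinearEquiv.coe_coe, LinearMap.comp_apply, LinearEquiv.symm_apply_apply, hin] at h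
  simpa only [sq] using h

/-- The functions of a permutation `x` that depend only on the values of `x` on `T`, described as
the functions invariant under `x ↦ x * σ` for all `σ` fixing `T` pointwise. -/
def juntaSpace (T : Finset Ω) : Submodule ℝ (Equiv.Perm Ω → ℝ) where
  carrier := {u | ∀ σ : Equiv.Perm Ω, (∀ t ∈ T, σ t = t) → ∀ x, u (x * σ) = u x}
  add_mem' hu hv σ hσ x := by simp [hu σ hσ x, hv σ hσ x]
  zero_mem' σ hσ x := rfl
  smul_mem' c u hu σ hσ x := by simp [hu σ hσ x]

variable (Ω) in
/-- The functions on permutations of degree less than `d`. -/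
def lowSpace (d : ℕ) : Submodule ℝ (Equiv.Perm Ω → ℝ) :=
  ⨆ T : {T : Finset Ω // T.card < d}, juntaSpace T.1

theorem juntaSpace_le_lowSpace {d : ℕ} {T : Finset Ω} (hT : T.card < d) :
    juntaSpace T ≤ lowSpace Ω d :=
  le_iSup (fun T : {T : Finset Ω // T.card < d} => juntaSpace T.1) ⟨T, hT⟩

theorem lowSpace_mono {d d' : ℕ} (h : d ≤ d') : lowSpace Ω d ≤ lowSpace Ω d' :=
  iSup_le fun T => juntaSpace_le_lowSpace (T.2.trans_le h)

theorem eq_of_mem_juntaSpace {T : Finset Ω} {u : Equiv.Perm Ω → ℝ} (hu : u ∈ juntaSpace T)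
    {x y : Equiv.Perm Ω} (h : ∀ t ∈ T, y t = x t) : u y = u x := by
  have := hu (x⁻¹ * y) (fun t ht => by simp [h t ht]) x
  rwa [mul_inv_cancel_left] at this

/-- The indicator function of the event `x (i s) = j s` for all `s ∈ S`. -/
theorem indicator_mem_juntaSpace (S : Finset κ) (i j : κ → Ω) :
    (fun x : Equiv.Perm Ω => if ∀ s ∈ S, x (i s) = j s then (1 : ℝ) else 0)
      ∈ juntaSpace (S.image i) := by
  intro σ hσ x
  refine if_congr (forall₂_congr fun s hs => ?_) rfl rfl
  rw [Equiv.Perm.mul_apply, hσ _ (Finset.mem_image_of_mem i hs)]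

/-- The conditional averages of order `#S` vanish for functions orthogonal to degree `#S`. -/
theorem condMean_eq_zero_of_orthogonal {S : Finset κ} {u : Equiv.Perm Ω → ℝ}
    (hu : ∀ g ∈ lowSpace Ω (S.card + 1), ∑ x, u x * g x = 0) (i j : κ → Ω) :
    condMean u S i j = 0 := by
  have h := hu _ (juntaSpace_le_lowSpace (Nat.lt_succ_of_le Finset.card_image_le)
    (indicator_mem_juntaSpace S i j))
  unfold condMean
  simp only [mul_ite, mul_one, mul_zero] at h
  rw [h, zero_div]

/-- The conditional averages of a function orthogonal to the functions of degree less than `#S` sum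
to zero over each of the positions. -/
theorem sum_condMean_update_eq_zero {S : Finset κ} {u : Equiv.Perm Ω → ℝ}
    (hu : ∀ g ∈ lowSpace Ω S.card, ∑ x, u x * g x = 0) (i j : κ → Ω) {s : κ} (hs : s ∈ S) :
    ∑ y, condMean u S (Function.update i s y) j = 0 := by
  have h := hu _ (juntaSpace_le_lowSpace (lt_of_le_of_lt Finset.card_image_le
    (Finset.card_erase_lt_of_mem hs)) (indicator_mem_juntaSpace (S.erase s) i j))
  unfold condMean
  rw [← Finset.sum_div, Finset.sum_comm]
  simp only [mul_ite, mul_one, mul_zero] at h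
  rw [div_eq_zero_iff]
  left
  refine Eq.trans ?_ h
  refine Finset.sum_congr rfl fun x _ => ?_
  rw [Finset.sum_eq_single (x.symm (j s))]
  · refine if_congr ⟨fun hx t ht => ?_, fun hx t ht => ?_⟩ rfl rfl
    · have := hx t (Finset.mem_of_mem_erase ht)
      rwa [Function.update_of_ne (Finset.ne_of_mem_erase ht)] at this
    · by_cases hts : t = s
      · subst hts; simp
      · rw [Function.update_of_ne hts]
        exact hx t (Finset.mem_erase.2 ⟨hts, ht⟩)
  · intro y _ hy
    rw [if_neg]
    intro hx
    have := hx s hs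
    rw [Function.update_self] at this
    exact hy (by rw [← this, Equiv.symm_apply_apply])
  · simp

theorem diffLeft_add (f g : Equiv.Perm Ω → ℝ) (S : Finset κ) (a : κ → Bool → Ω) (j : κ → Ω) :
    diffLeft (f + g) S a j = diffLeft f S a j + diffLeft g S a j := by
  unfold diffLeft
  simp_rw [condMean_add, mul_add, Finset.expect_add_distrib]

theorem diffLeft_smul (r : ℝ) (f : Equiv.Perm Ω → ℝ) (S : Finset κ) (a : κ → Bool → Ω)
    (j : κ → Ω) : diffLeft (r • f) S a j = r * diffLeft f S a j := by
  unfold diffLeft condMean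
  rw [Finset.mul_expect]
  refine Finset.expect_congr rfl fun c _ => ?_
  have : ∑ x : Equiv.Perm Ω, (if ∀ s ∈ S, x (sel a c s) = j s then (r • f) x else 0)
      = r * ∑ x : Equiv.Perm Ω, (if ∀ s ∈ S, x (sel a c s) = j s then f x else 0) := by
    rw [Finset.mul_sum]
    exact Finset.sum_congr rfl fun x _ => by split_ifs <;> simp
  rw [this]; ring

/-- Differences of order `#S` annihilate the functions of degree less than `#S`: a junta on fewer
than `#S` points does not see some of the pairs at all. -/
theorem diffLeft_eq_zero_of_mem_lowSpace {S : Finset κ} {a : κ → Bool → Ω} (ha : PairInj S a)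
    {u : Equiv.Perm Ω → ℝ} (hu : u ∈ lowSpace Ω S.card) (j : κ → Ω) : diffLeft u S a j = 0 := by
  have hle : lowSpace Ω S.card ≤ LinearMap.ker
      (IsLinearMap.mk' (fun f : Equiv.Perm Ω → ℝ => diffLeft f S a j)
        ⟨fun f g => diffLeft_add f g S a j, fun r f => diffLeft_smul r f S a j⟩) := by
    refine iSup_le ?_
    rintro ⟨T, hT⟩ v hv
    change diffLeft v S a j = 0
    obtain ⟨s, hs, hsT⟩ : ∃ s ∈ S, ∀ b, a s b ∉ T := by
      by_contra hcon
      push Not at hcon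
      choose! b hb using hcon
      refine absurd (Finset.card_le_card_of_injOn (fun s => a s (b s)) hb ?_) (not_le.2 hT)
      intro s hs t ht hst
      exact (ha s hs t ht _ _ hst).1
    refine expect_eq_zero_of_flipAt s _ fun c => ?_
    rw [sgn_flipAt_of_mem hs, neg_mul]
    congr 2
    unfold condMean
    congr 1
    refine Fintype.sum_equiv (Equiv.mulRight (Equiv.swap (a s false) (a s true))) _ _ fun x => ?_
    rw [Equiv.coe_mulRight, hv (Equiv.swap (a s false) (a s true)) (fun t ht =>
      Equiv.swap_apply_of_ne_of_ne (fun h => hsT _ (h ▸ ht)) fun h => hsT _ (h ▸ ht)) x]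
    refine if_congr (forall₂_congr fun t ht => ?_) rfl rfl
    have : Equiv.swap (a s false) (a s true) (sel a c t) = sel a (flipAt s c) t := by
      by_cases hts : t = s
      · subst hts
        cases h : c t <;> simp [sel, flipAt, h]
      · rw [Equiv.swap_apply_of_ne_of_ne]
        · simp [sel, flipAt, hts]
        · exact fun h => hts (ha t ht s hs _ _ h).1
        · exact fun h => hts (ha t ht s hs _ _ h).1
    rw [Equiv.Perm.mul_apply, this]
  exact hle hu

/-! ### Lower bound for the differences of a function of pure degree -/

/-- Replace the point `b` of the pair `s`. -/
def setPoint (a : κ → Bool → Ω) (s : κ) (b : Bool) (y : Ω) : κ → Bool → Ω :=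
  Function.update a s (Function.update (a s) b y)

theorem setPoint_apply (a : κ → Bool → Ω) (s : κ) (b : Bool) (y : Ω) (t : κ) (c : Bool) :
    setPoint a s b y t c = if t = s ∧ c = b then y else a t c := by
  unfold setPoint
  by_cases hts : t = s
  · subst hts
    by_cases hcb : c = b
    · subst hcb; simp
    · simp [hcb]
  · simp [hts]

theorem expect_setPoint (s : κ) (b : Bool) (φ : (κ → Bool → Ω) → ℝ) :
    𝔼 a : κ → Bool → Ω, 𝔼 y : Ω, φ (setPoint a s b y) = 𝔼 a, φ a := by
  rcases isEmpty_or_nonempty Ω with hΩ | hΩ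
  · have : IsEmpty (κ → Bool → Ω) := ⟨fun a => hΩ.false (a s b)⟩
    simp [Finset.univ_eq_empty]
  have h1 : 𝔼 a : κ → Bool → Ω, 𝔼 y : Ω, φ (setPoint a s b y)
      = 𝔼 q : (κ → Bool → Ω) × Ω, φ (setPoint q.1 s b q.2) := by
    rw [← Finset.univ_product_univ, Finset.expect_product]
  have h2 : 𝔼 q : (κ → Bool → Ω) × Ω, φ (setPoint q.1 s b q.2)
      = 𝔼 q : (κ → Bool → Ω) × Ω, φ q.1 := by
    refine Fintype.expect_bijective
      (fun q : (κ → Bool → Ω) × Ω => (setPoint q.1 s b q.2, q.1 s b))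
      (Function.Involutive.bijective ?_) _ _ fun q => rfl
    rintro ⟨a, y⟩
    simp only [Prod.mk.injEq]
    refine ⟨?_, by simp [setPoint_apply]⟩
    ext t c
    rw [setPoint_apply, setPoint_apply]
    by_cases h : t = s ∧ c = b
    · rw [if_pos h, h.1, h.2]
    · rw [if_neg h, if_neg h]
  rw [h1, h2, ← Finset.univ_product_univ, Finset.expect_product]
  simp

/-- For independent uniform pairs the cross terms in the square of `diffLeft` vanish: two selections
that differ at `s` can be separated by averaging over one point of the pair `s`. -/
theorem expect_diffLeft_sq [Nonempty Ω] {S : Finset κ} {u : Equiv.Perm Ω → ℝ}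
    (hu : ∀ g ∈ lowSpace Ω S.card, ∑ x, u x * g x = 0) (j : κ → Ω) :
    𝔼 a : κ → Bool → Ω, diffLeft u S a j ^ 2
      = ((2 : ℝ) ^ S.card)⁻¹ * 𝔼 i : κ → Ω, condMean u S i j ^ 2 := by
  change _ = _ * 𝔼 i : κ → Ω, (fun i => condMean u S i j) i ^ 2
  set F : (κ → Ω) → ℝ := fun i => condMean u S i j with hF
  have h1 : ∀ a : κ → Bool → Ω, diffLeft u S a j ^ 2
      = 𝔼 c : κ → Bool, 𝔼 c' : κ → Bool, sgn S c * sgn S c' * (F (sel a c) * F (sel a c')) := by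
    intro a
    rw [sq, diffLeft, Finset.expect_mul_expect]
    refine Finset.expect_congr rfl fun c _ => Finset.expect_congr rfl fun c' _ => ?_
    simp only [hF]; ring
  have h2 : ∀ c c' : κ → Bool,
      𝔼 a : κ → Bool → Ω, sgn S c * sgn S c' * (F (sel a c) * F (sel a c'))
        = (if ∀ s ∈ S, c' s = c s then 1 else 0) * 𝔼 i, F i ^ 2 := by
    intro c c'
    rw [← Finset.mul_expect]
    split_ifs with hcc
    · rw [sgn_congr hcc, sgn_mul_self, one_mul, one_mul, ← expect_sel c fun i => F i ^ 2]
      refine Finset.expect_congr rfl fun a _ => ?_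
      have : F (sel a c') = F (sel a c) :=
        condMean_congr u (fun s hs => by simp only [sel, hcc s hs]) fun _ _ => rfl
      rw [this, sq]
    · push Not at hcc
      obtain ⟨s, hs, hne⟩ := hcc
      rw [← expect_setPoint s (c s) fun a => F (sel a c) * F (sel a c'), zero_mul]
      refine mul_eq_zero_of_right _ (Finset.expect_eq_zero fun a _ => ?_)
      have e1 : ∀ y, sel (setPoint a s (c s) y) c = Function.update (sel a c) s y := by
        intro y; ext t
        by_cases hts : t = s
        · subst hts; simp [sel, setPoint_apply]
        · simp [sel, setPoint_apply, hts]
      have e2 : ∀ y, sel (setPoint a s (c s) y) c' = sel a c' := by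
        intro y; ext t
        simp only [sel, setPoint_apply]
        rw [if_neg]
        rintro ⟨rfl, h⟩; exact hne h
      simp_rw [e1, e2, ← Finset.expect_mul]
      have := sum_condMean_update_eq_zero hu (sel a c) j hs
      rw [Fintype.expect_eq_sum_div_card, this, zero_div, zero_mul]
  simp_rw [h1]
  rw [Finset.expect_comm]
  rw [Finset.expect_congr rfl fun c _ => Finset.expect_comm _ _ _]
  simp_rw [h2, ← Finset.expect_mul, expect_agree]
  rw [Fintype.expect_const, Fintype.card_bool]
  norm_num

open Classical in
/-- Pairs with a coincidence contribute little. As `condMean` vanishes when the selected points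
coincide, the coincidence involves a point that is not selected, hence uniform and independent of
the selected ones. -/
theorem expect_not_pairInj_le [Nonempty Ω] (u : Equiv.Perm Ω → ℝ) {S : Finset κ} {j : κ → Ω}
    (hj : Set.InjOn j S) (c : κ → Bool) :
    𝔼 a : κ → Bool → Ω, (if PairInj S a then 0 else condMean u S (sel a c) j ^ 2)
      ≤ 2 * S.card ^ 2 / Fintype.card Ω * 𝔼 i : κ → Ω, condMean u S i j ^ 2 := by
  set F : (κ → Ω) → ℝ := fun i => condMean u S i j with hF
  have h1 : ∀ a : κ → Bool → Ω, (if PairInj S a then 0 else F (sel a c) ^ 2)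
      ≤ ∑ s ∈ S, ∑ t ∈ S, ∑ b : Bool, if ¬ (t = s ∧ b = !c s) then
          (if a s (!c s) = a t b then 1 else 0) * F (sel a c) ^ 2 else 0 := by
    intro a
    have hnn : ∀ s t b, 0 ≤ if ¬ (t = s ∧ b = !c s) then
        (if a s (!c s) = a t b then 1 else 0) * F (sel a c) ^ 2 else 0 := by
      intro s t b; split_ifs <;> positivity
    have hnn' : 0 ≤ ∑ s ∈ S, ∑ t ∈ S, ∑ b : Bool, if ¬ (t = s ∧ b = !c s) then
        (if a s (!c s) = a t b then 1 else 0) * F (sel a c) ^ 2 else 0 :=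
      Finset.sum_nonneg fun s _ => Finset.sum_nonneg fun t _ => Finset.sum_nonneg fun b _ =>
        hnn s t b
    by_cases ha : PairInj S a
    · rw [if_pos ha]; exact hnn'
    rw [if_neg ha]
    by_cases hi : Set.InjOn (sel a c) S
    swap
    · have : F (sel a c) = 0 := condMean_eq_zero_of_not_injOn u (by tauto)
      simp [this]
    have key : ∀ s ∈ S, ∀ t ∈ S, ∀ b, ¬ (t = s ∧ b = !c s) → a s (!c s) = a t b →
        F (sel a c) ^ 2 ≤ ∑ s ∈ S, ∑ t ∈ S, ∑ b : Bool, if ¬ (t = s ∧ b = !c s) then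
          (if a s (!c s) = a t b then 1 else 0) * F (sel a c) ^ 2 else 0 := by
      intro s hs t ht b hne heq
      refine le_trans ?_ (Finset.single_le_sum (f := fun s => ∑ t ∈ S, ∑ b : Bool,
        if ¬ (t = s ∧ b = !c s) then
          (if a s (!c s) = a t b then 1 else 0) * F (sel a c) ^ 2 else 0) (fun s _ =>
        Finset.sum_nonneg fun t _ => Finset.sum_nonneg fun b _ => hnn s t b) hs)
      refine le_trans ?_ (Finset.single_le_sum (f := fun t => ∑ b : Bool,
        if ¬ (t = s ∧ b = !c s) then
          (if a s (!c s) = a t b then 1 else 0) * F (sel a c) ^ 2 else 0) (fun t _ =>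
        Finset.sum_nonneg fun b _ => hnn s t b) ht)
      refine le_trans ?_ (Finset.single_le_sum (f := fun b =>
        if ¬ (t = s ∧ b = !c s) then
          (if a s (!c s) = a t b then 1 else 0) * F (sel a c) ^ 2 else 0) (fun b _ =>
        hnn s t b) (Finset.mem_univ b))
      rw [if_pos hne, if_pos heq, one_mul]
    unfold PairInj at ha
    push Not at ha
    obtain ⟨s, hs, t, ht, b, b', heq, hne⟩ := ha
    by_cases hb : b = c s
    · by_cases hb' : b' = c t
      · subst hb hb'
        have hst := hi hs ht heq
        subst hst
        exact absurd rfl (hne rfl)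
      · obtain rfl : b' = !c t := Bool.eq_not.2 hb'
        exact key t ht s hs b (fun h => hne h.1 h.2 |> fun h => h) heq.symm
    · obtain rfl : b = !c s := Bool.eq_not.2 hb
      exact key s hs t ht b' (fun h => hne h.1.symm h.2.symm) heq
  have h2 : ∀ s t b, 𝔼 a : κ → Bool → Ω, (if ¬ (t = s ∧ b = !c s) then
      (if a s (!c s) = a t b then 1 else 0) * F (sel a c) ^ 2 else 0)
      ≤ 1 / Fintype.card Ω * 𝔼 i, F i ^ 2 := by
    intro s t b
    by_cases h : t = s ∧ b = !c s
    · simp only [h, and_self, not_true_eq_false, if_false, Finset.expect_const_zero]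
      exact mul_nonneg (by positivity) (expect_nonneg fun i => sq_nonneg _)
    · simp only [h, not_false_eq_true, if_true]
      rw [← expect_setPoint s (!c s) fun a : κ → Bool → Ω =>
        (if a s (!c s) = a t b then 1 else 0) * F (sel a c) ^ 2]
      have e1 : ∀ (a : κ → Bool → Ω) (y : Ω), sel (setPoint a s (!c s) y) c = sel a c := by
        intro a y; ext r
        simp only [sel, setPoint_apply]
        rw [if_neg]
        rintro ⟨rfl, h⟩; simp at h
      simp_rw [e1, setPoint_apply]
      simp only [and_self, if_true, if_neg h]
      refine le_of_eq ?_
      rw [← expect_sel c fun i => F i ^ 2, Finset.mul_expect]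
      refine Finset.expect_congr rfl fun a _ => ?_
      rw [← Finset.expect_mul, Fintype.expect_eq_sum_div_card]
      simp
  calc 𝔼 a : κ → Bool → Ω, (if PairInj S a then 0 else F (sel a c) ^ 2)
      ≤ 𝔼 a : κ → Bool → Ω, ∑ s ∈ S, ∑ t ∈ S, ∑ b : Bool, if ¬ (t = s ∧ b = !c s) then
          (if a s (!c s) = a t b then 1 else 0) * F (sel a c) ^ 2 else 0 := expect_mono h1
    _ = ∑ s ∈ S, ∑ t ∈ S, ∑ b : Bool, 𝔼 a : κ → Bool → Ω, if ¬ (t = s ∧ b = !c s) then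
          (if a s (!c s) = a t b then 1 else 0) * F (sel a c) ^ 2 else 0 := by
        simp_rw [Finset.expect_sum_comm]
    _ ≤ ∑ s ∈ S, ∑ t ∈ S, ∑ b : Bool, 1 / Fintype.card Ω * 𝔼 i, F i ^ 2 :=
        Finset.sum_le_sum fun s _ => Finset.sum_le_sum fun t _ => Finset.sum_le_sum fun b _ =>
          h2 s t b
    _ = _ := by
        simp only [Finset.sum_const, Finset.card_univ, Fintype.card_bool, nsmul_eq_mul]
        push_cast
        ring

open Classical in
/-- For a function orthogonal to the functions of lower degree, the mean square of the one-sided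
differences is comparable to that of the conditional averages. For pairs of independent points the
cross terms vanish exactly; coincidences among these points have small probability. -/
theorem le_expect_pairInj_diffLeft_sq [Nonempty Ω] {S : Finset κ} {u : Equiv.Perm Ω → ℝ}
    (hu : ∀ g ∈ lowSpace Ω S.card, ∑ x, u x * g x = 0)
    (hn : 4 * S.card ^ 2 * 2 ^ S.card ≤ Fintype.card Ω) {j : κ → Ω} (hj : Set.InjOn j S) :
    (2 * (2 : ℝ) ^ S.card)⁻¹ * 𝔼 i : κ → Ω, condMean u S i j ^ 2
      ≤ 𝔼 a : κ → Bool → Ω, if PairInj S a then diffLeft u S a j ^ 2 else 0 := by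
  set V := 𝔼 i : κ → Ω, condMean u S i j ^ 2 with hV
  have hV0 : 0 ≤ V := expect_nonneg fun i => sq_nonneg _
  have hnpos : (0 : ℝ) < Fintype.card Ω := by exact_mod_cast Fintype.card_pos
  have h1 := expect_diffLeft_sq hu j
  have h2 : 𝔼 a : κ → Bool → Ω, (if PairInj S a then 0 else diffLeft u S a j ^ 2)
      ≤ 2 * S.card ^ 2 / Fintype.card Ω * V := by
    have h3 : ∀ a : κ → Bool → Ω, (if PairInj S a then 0 else diffLeft u S a j ^ 2)
        ≤ 𝔼 c : κ → Bool, if PairInj S a then 0 else condMean u S (sel a c) j ^ 2 := by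
      intro a
      split_ifs
      · simp
      · refine (sq_expect_le _).trans (le_of_eq ?_)
        exact Finset.expect_congr rfl fun c _ => by rw [mul_pow, sgn_sq, one_mul]
    refine (expect_mono h3).trans ?_
    rw [Finset.expect_comm]
    exact Finset.expect_le Finset.univ_nonempty fun c _ => expect_not_pairInj_le u hj c
  have h4 : 𝔼 a : κ → Bool → Ω, diffLeft u S a j ^ 2
      = (𝔼 a : κ → Bool → Ω, if PairInj S a then diffLeft u S a j ^ 2 else 0)
        + 𝔼 a : κ → Bool → Ω, if PairInj S a then 0 else diffLeft u S a j ^ 2 := by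
    rw [← Finset.expect_add_distrib]
    exact Finset.expect_congr rfl fun a _ => by split_ifs <;> simp
  have h5 : 2 * (S.card : ℝ) ^ 2 / Fintype.card Ω ≤ (2 * (2 : ℝ) ^ S.card)⁻¹ := by
    rw [div_le_iff₀ hnpos, inv_mul_eq_div, le_div_iff₀ (by positivity)]
    have : (4 * S.card ^ 2 * 2 ^ S.card : ℝ) ≤ Fintype.card Ω := by exact_mod_cast hn
    linarith
  have h6 := mul_le_mul_of_nonneg_right h5 hV0
  have h7 : ((2 : ℝ) ^ S.card)⁻¹ = 2 * (2 * (2 : ℝ) ^ S.card)⁻¹ := by field_simp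
  rw [h1, h7] at h4
  linarith

/-! ### The sum of the conditional averages as an operator -/

open Classical in
/-- The average over injective `i` of the conditional expectations given the values at the points
`i s`, `s ∈ S`, up to normalization. -/
noncomputable def avgOp (S : Finset κ) : (Equiv.Perm Ω → ℝ) →ₗ[ℝ] (Equiv.Perm Ω → ℝ) where
  toFun u x := 𝔼 i : κ → Ω, if Set.InjOn i S then condMean u S i (x ∘ i) else 0
  map_add' u v := by
    ext x
    rw [Pi.add_apply, ← Finset.expect_add_distrib]
    exact Finset.expect_congr rfl fun i _ => by split_ifs <;> simp [condMean_add]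
  map_smul' r u := by
    ext x
    rw [Pi.smul_apply, RingHom.id_apply, smul_eq_mul, Finset.mul_expect]
    refine Finset.expect_congr rfl fun i _ => ?_
    split_ifs
    · unfold condMean
      rw [← mul_div_assoc, Finset.mul_sum]
      congr 1
      exact Finset.sum_congr rfl fun x _ => by split_ifs <;> simp
    · simp

open Classical in
theorem expect_mul_avgOp (S : Finset κ) (u v : Equiv.Perm Ω → ℝ) :
    𝔼 x, v x * avgOp S u x = 𝔼 i : κ → Ω, if Set.InjOn i S then
      injRatio Ω S.card * 𝔼 j : κ → Ω, condMean v S i j * condMean u S i j else 0 := by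
  have h1 : ∀ x, v x * avgOp S u x
      = 𝔼 i : κ → Ω, if Set.InjOn i S then v x * condMean u S i (x ∘ i) else 0 := by
    intro x
    change v x * (𝔼 i : κ → Ω, if Set.InjOn i S then condMean u S i (x ∘ i) else 0) = _
    rw [Finset.mul_expect]
    exact Finset.expect_congr rfl fun i _ => by split_ifs <;> simp
  simp_rw [h1]
  rw [Finset.expect_comm]
  refine Finset.expect_congr rfl fun i _ => ?_
  split_ifs
  · exact expect_mul_comp v S i fun j j' h => condMean_congr u (fun _ _ => rfl) h
  · simp

theorem avgOp_symm (S : Finset κ) (u v : Equiv.Perm Ω → ℝ) :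
    ∑ x, avgOp S u x * v x = ∑ x, u x * avgOp S v x := by
  have h1 := expect_mul_avgOp S u v
  have h2 := expect_mul_avgOp S v u
  have h3 : 𝔼 x, v x * avgOp S u x = 𝔼 x, u x * avgOp S v x := by
    rw [h1, h2]
    simp_rw [mul_comm (condMean v S _ _)]
  rw [Fintype.expect_eq_sum_div_card, Fintype.expect_eq_sum_div_card,
    div_left_inj' (by exact_mod_cast Fintype.card_ne_zero)] at h3
  simpa [mul_comm] using h3

/-- The operator `avgOp S` commutes with right translations, which characterize the juntas. -/
theorem avgOp_mem_juntaSpace (S : Finset κ) {T : Finset Ω} {u : Equiv.Perm Ω → ℝ}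
    (hu : u ∈ juntaSpace T) : avgOp S u ∈ juntaSpace T := by
  classical
  intro σ hσ x
  change (𝔼 i : κ → Ω, if Set.InjOn i S then condMean u S i ((x * σ) ∘ i) else 0)
    = 𝔼 i : κ → Ω, if Set.InjOn i S then condMean u S i (x ∘ i) else 0
  refine Fintype.expect_equiv (Equiv.arrowCongr (Equiv.refl κ) σ) _ _ fun i => ?_
  have h1 : Equiv.arrowCongr (Equiv.refl κ) σ i = σ ∘ i := rfl
  rw [h1]
  refine if_congr ⟨fun h => σ.injective.injOn.comp h (Set.mapsTo_univ _ _),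
    fun h => Set.InjOn.of_comp h⟩ ?_ rfl
  unfold condMean
  congr 1
  refine Fintype.sum_equiv (Equiv.mulRight σ⁻¹) _ _ fun y => ?_
  rw [Equiv.coe_mulRight]
  have h2 := hu σ hσ (y * σ⁻¹)
  rw [inv_mul_cancel_right] at h2
  rw [← h2]
  refine if_congr (forall₂_congr fun s _ => ?_) rfl rfl
  simp

/-- On a junta on at most `#S` points, one of the conditional expectations acts as the identity. -/
theorem le_expect_mul_avgOp [Nonempty Ω] {S : Finset κ} (hS : S.card ≤ Fintype.card Ω) {T : Finset Ω}
    (hT : T.card < S.card + 1) {u : Equiv.Perm Ω → ℝ} (hu : u ∈ juntaSpace T) :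
    ((Fintype.card Ω : ℝ) ^ S.card)⁻¹ * ∑ x, u x ^ 2 ≤ ∑ x, u x * avgOp S u x := by
  classical
  obtain ⟨R, hTR, hR⟩ : ∃ R : Finset Ω, T ⊆ R ∧ R.card = S.card := by
    obtain ⟨R, hTR, _, hR⟩ := Finset.exists_subsuperset_card_eq (Finset.subset_univ T)
      (Nat.lt_succ_iff.1 hT) (by simpa using hS)
    exact ⟨R, hTR, hR⟩
  let g := Finset.equivOfCardEq hR.symm
  let i₀ : κ → Ω := fun s => if hs : s ∈ S then g ⟨s, hs⟩ else Classical.arbitrary Ω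
  have hi₀ : ∀ (s : κ) (hs : s ∈ S), i₀ s = g ⟨s, hs⟩ := fun s hs => dif_pos hs
  have hinj : Set.InjOn i₀ S := by
    intro s hs t ht hst
    rw [hi₀ s hs, hi₀ t ht] at hst
    simpa using g.injective (Subtype.ext hst)
  have himg : ∀ t ∈ T, ∃ s ∈ S, i₀ s = t := by
    intro t ht
    refine ⟨g.symm ⟨t, hTR ht⟩, (g.symm ⟨t, hTR ht⟩).2, ?_⟩
    rw [hi₀ _ (g.symm ⟨t, hTR ht⟩).2]
    simp
  have hval : ∀ i : κ → Ω, (∀ s ∈ S, i s = i₀ s) → injRatio Ω S.card *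
      𝔼 j : κ → Ω, condMean u S i j * condMean u S i j = 𝔼 x, u x ^ 2 := by
    intro i hi
    rw [← expect_mul_comp u S i fun j j' h => condMean_congr u (fun _ _ => rfl) h]
    refine Finset.expect_congr rfl fun x _ => ?_
    have : condMean u S i (x ∘ i) = u x := by
      have hii : Set.InjOn i S := fun s hs t ht hst => hinj hs ht (by rw [← hi s hs, ← hi t ht, hst])
      have hxi : Set.InjOn (x ∘ i) S := x.injective.injOn.comp hii (Set.mapsTo_univ _ _)
      have h1 := condMean_one (Ω := Ω) hii hxi
      rw [← mul_one (u x), ← h1]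
      unfold condMean
      rw [← mul_div_assoc, Finset.mul_sum]
      congr 1
      refine Finset.sum_congr rfl fun y _ => ?_
      split_ifs with h
      · rw [mul_one]
        refine eq_of_mem_juntaSpace hu fun t ht => ?_
        obtain ⟨s, hs, rfl⟩ := himg t ht
        rw [← hi s hs]
        exact h s hs
      · rw [mul_zero]
    rw [this, sq]
  have hE : ((Fintype.card Ω : ℝ) ^ S.card)⁻¹ * 𝔼 x, u x ^ 2 ≤ 𝔼 x, u x * avgOp S u x := by
    rw [expect_mul_avgOp, ← expect_agree S i₀, Finset.expect_mul]
    refine expect_mono fun i => ?_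
    split_ifs with h1 h2 h2
    · rw [one_mul, hval i h1]
    · exact absurd (fun s hs t ht hst => hinj hs ht (by rw [← h1 s hs, ← h1 t ht, hst])) h2
    · rw [zero_mul]
      exact mul_nonneg (by unfold injRatio; positivity)
        (expect_nonneg fun j => mul_self_nonneg _)
    · rw [zero_mul]
  rw [Fintype.expect_eq_sum_div_card, Fintype.expect_eq_sum_div_card, ← mul_div_assoc] at hE
  exact (div_le_div_iff_of_pos_right (by exact_mod_cast Fintype.card_pos)).1 hE

theorem le_expect_mul_avgOp_of_mem_lowSpace [Nonempty Ω] {S : Finset κ}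
    (hS : S.card ≤ Fintype.card Ω) {u : Equiv.Perm Ω → ℝ} (hu : u ∈ lowSpace Ω (S.card + 1)) :
    ((Fintype.card Ω : ℝ) ^ S.card)⁻¹ * 𝔼 x, u x ^ 2 ≤ 𝔼 x, u x * avgOp S u x := by
  have h := le_sum_mul_of_mem_iSup (avgOp_symm S)
    (fun T : {T : Finset Ω // T.card < S.card + 1} => juntaSpace T.1)
    (fun T v hv => avgOp_mem_juntaSpace S hv) (fun T v hv => le_expect_mul_avgOp hS T.2 hv) hu
  rw [Fintype.expect_eq_sum_div_card, Fintype.expect_eq_sum_div_card, ← mul_div_assoc]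
  exact div_le_div_of_nonneg_right h (by positivity)

/-- The correlation of `f` with its two-sided differences of order `d` bounds the part of `f` of
pure degree `d`: the lower part is annihilated by the differences, and the higher part by the
conditional averages. -/
theorem choose_mul_expect_sq_le_corr [Nonempty Ω] {e : κ → Bool → Ω} (he : PairInj Finset.univ e)
    {d : ℕ} (h2d : 2 * d ≤ Fintype.card Ω) (hn : 4 * d ^ 2 * 2 ^ d ≤ Fintype.card Ω)
    {f f₀ u f₁ : Equiv.Perm Ω → ℝ} (hf : f = f₀ + u + f₁) (hf₀ : f₀ ∈ lowSpace Ω d)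
    (hu : u ∈ lowSpace Ω (d + 1)) (hu' : ∀ g ∈ lowSpace Ω d, ∑ x, u x * g x = 0)
    (hf₁ : ∀ g ∈ lowSpace Ω (d + 1), ∑ x, f₁ x * g x = 0) :
    ((Fintype.card κ).choose d : ℝ) * (((Fintype.card Ω : ℝ) ^ d)⁻¹ * 𝔼 x, u x ^ 2)
      ≤ 2 * corr f e d := by
  classical
  have key : ∀ S ∈ Finset.powersetCard d (Finset.univ : Finset κ),
      ((Fintype.card Ω : ℝ) ^ d)⁻¹ * 𝔼 x, u x ^ 2
        ≤ 2 * 𝔼 ρ : Equiv.Perm Ω, 𝔼 x : Equiv.Perm Ω,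
          f x * diffBoth f S (fun s b => ρ (e s b)) (fun s b => x (ρ (e s b))) := by
    intro S hS
    obtain rfl : S.card = d := (Finset.mem_powersetCard.1 hS).2
    have heS : PairInj S e := he.mono (Finset.subset_univ S)
    set r := injRatio Ω S.card with hr
    have hr0 : 0 ≤ r := by rw [hr, injRatio]; positivity
    have hdiff : ∀ a : κ → Bool → Ω, PairInj S a → ∀ j, diffLeft f S a j = diffLeft u S a j := by
      intro a ha j
      have h1 : diffLeft f₁ S a j = 0 := by
        unfold diffLeft
        exact Finset.expect_eq_zero fun c _ => by
          rw [condMean_eq_zero_of_orthogonal hf₁, mul_zero]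
      rw [hf, diffLeft_add, diffLeft_add, diffLeft_eq_zero_of_mem_lowSpace ha hf₀, h1, zero_add,
        add_zero]
    set ψ : (κ → Bool → Ω) → ℝ := fun a => r * 2 ^ S.card * 𝔼 j : κ → Ω, diffLeft u S a j ^ 2 with hψ
    have h1 : 𝔼 ρ : Equiv.Perm Ω, 𝔼 x : Equiv.Perm Ω,
        f x * diffBoth f S (fun s b => ρ (e s b)) (fun s b => x (ρ (e s b)))
          = 𝔼 ρ : Equiv.Perm Ω, ψ (fun s b => ρ (e s b)) := by
      refine Finset.expect_congr rfl fun ρ _ => ?_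
      rw [expect_mul_diffBoth f S fun s b => ρ (e s b)]
      simp_rw [hdiff _ (heS.comp_perm ρ)]
      rfl
    have hψ0 : ∀ a, 0 ≤ ψ a := fun a =>
      mul_nonneg (by positivity) (expect_nonneg fun j => sq_nonneg _)
    have h2 : 𝔼 a : κ → Bool → Ω, (if PairInj S a then ψ a else 0)
        ≤ 𝔼 ρ : Equiv.Perm Ω, ψ (fun s b => ρ (e s b)) := by
      rw [expect_comp_pairs heS (ψ := ψ) fun a a' h => by
        simp only [hψ]
        congr 1
        exact Finset.expect_congr rfl fun j _ => by
          rw [diffLeft_congr u (fun s hs => h s hs) fun _ _ => rfl]]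
      exact le_mul_of_one_le_left (expect_nonneg fun a => by split_ifs; exacts [hψ0 a, le_rfl])
        (one_le_injRatio h2d)
    have h3 : 𝔼 a : κ → Bool → Ω, (if PairInj S a then ψ a else 0) = r * 2 ^ S.card *
        𝔼 j : κ → Ω, 𝔼 a : κ → Bool → Ω, if PairInj S a then diffLeft u S a j ^ 2 else 0 := by
      rw [Finset.expect_comm, Finset.mul_expect]
      refine Finset.expect_congr rfl fun a _ => ?_
      split_ifs
      · rfl
      · simp
    have h4 : (2 * (2 : ℝ) ^ S.card)⁻¹ *
        (𝔼 i : κ → Ω, if Set.InjOn i S then 𝔼 j : κ → Ω, condMean u S i j ^ 2 else 0)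
        ≤ 𝔼 j : κ → Ω, 𝔼 a : κ → Bool → Ω, if PairInj S a then diffLeft u S a j ^ 2 else 0 := by
      have h5 : (𝔼 i : κ → Ω, if Set.InjOn i S then 𝔼 j : κ → Ω, condMean u S i j ^ 2 else 0)
          = 𝔼 j : κ → Ω, if Set.InjOn j S then 𝔼 i : κ → Ω, condMean u S i j ^ 2 else 0 := by
        have h6 : ∀ i : κ → Ω, (if Set.InjOn i S then 𝔼 j : κ → Ω, condMean u S i j ^ 2 else 0)
            = 𝔼 j : κ → Ω, if Set.InjOn j S then condMean u S i j ^ 2 else 0 := by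
          intro i
          split_ifs with hi
          · refine Finset.expect_congr rfl fun j _ => ?_
            split_ifs with hj
            · rfl
            · rw [condMean_eq_zero_of_not_injOn u (by tauto)]; simp
          · symm
            refine Finset.expect_eq_zero fun j _ => ?_
            split_ifs with hj
            · rw [condMean_eq_zero_of_not_injOn u (by tauto)]; simp
            · rfl
        simp_rw [h6]
        rw [Finset.expect_comm]
        refine Finset.expect_congr rfl fun j _ => ?_
        split_ifs
        · rfl
        · simp
      rw [h5, Finset.mul_expect]
      refine expect_mono fun j => ?_
      split_ifs with hj
      · exact le_expect_pairInj_diffLeft_sq hu' hn hj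
      · rw [mul_zero]
        exact expect_nonneg fun a => by split_ifs <;> positivity
    have h7 := le_expect_mul_avgOp_of_mem_lowSpace (S := S) (by omega) hu
    have h8 : 𝔼 x, u x * avgOp S u x
        = r * 𝔼 i : κ → Ω, if Set.InjOn i S then 𝔼 j : κ → Ω, condMean u S i j ^ 2 else 0 := by
      rw [expect_mul_avgOp, Finset.mul_expect]
      refine Finset.expect_congr rfl fun i _ => ?_
      simp only [← sq]
      split_ifs <;> simp [hr]
    rw [h1]
    refine h7.trans ?_
    rw [h8]
    have h9 := mul_le_mul_of_nonneg_left h4 (show 0 ≤ r * 2 ^ S.card by positivity)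
    rw [← h3] at h9
    have h10 : r * 2 ^ S.card * ((2 * (2 : ℝ) ^ S.card)⁻¹ *
        (𝔼 i : κ → Ω, if Set.InjOn i S then 𝔼 j : κ → Ω, condMean u S i j ^ 2 else 0))
        = r * (𝔼 i : κ → Ω, if Set.InjOn i S then 𝔼 j : κ → Ω, condMean u S i j ^ 2 else 0) / 2 := by
      field_simp
    rw [h10] at h9
    linarith
  have h := Finset.sum_le_sum key
  rw [Finset.sum_const, Finset.card_powersetCard, Finset.card_univ, nsmul_eq_mul,
    ← Finset.mul_sum] at h
  exact h

/-! ### The level inequality on the symmetric group -/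

theorem pow_le_mul_choose_div_four {n D d : ℕ} (hd : d ≤ D) (hn : 8 * D ≤ n) :
    (n : ℝ) ^ d ≤ (8 * D) ^ d * ((n / 4).choose d : ℝ) := by
  have h1 := Nat.pow_le_choose (α := ℝ) d (n / 4)
  rw [div_le_iff₀ (by positivity)] at h1
  have h2 : n ≤ 8 * (n / 4 + 1 - d) := by omega
  have h3 : (d.factorial : ℝ) ≤ D ^ d := by
    exact_mod_cast (Nat.factorial_le_pow d).trans (Nat.pow_le_pow_left hd d)
  calc (n : ℝ) ^ d ≤ ((8 * (n / 4 + 1 - d) : ℕ) : ℝ) ^ d := by gcongr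
    _ = 8 ^ d * ((n / 4 + 1 - d : ℕ) : ℝ) ^ d := by push_cast; rw [mul_pow]
    _ ≤ 8 ^ d * (((n / 4).choose d : ℝ) * d.factorial) := by
        refine mul_le_mul_of_nonneg_left ?_ (by positivity)
        exact_mod_cast h1
    _ ≤ 8 ^ d * (((n / 4).choose d : ℝ) * D ^ d) := by gcongr
    _ = _ := by rw [mul_pow]; ring

/-- The part of pure degree `d` of a global Boolean function has mean square of order `μ ^ 2`. -/
theorem expect_pure_sq_le {D p : ℕ} (hD : D ≠ 0) (hp : p ≠ 0) {μ : ℝ} (hμ : 0 < μ)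
    (hμp : μ⁻¹ ≤ 3 ^ p) {f : Equiv.Perm Ω → ℝ} (hf : ∀ x, f x = 0 ∨ f x = 1)
    (hg : PermGlobal D μ f) (hn₁ : 4 * (D * p) + 2 * D ≤ Fintype.card Ω)
    (hn₂ : 8 * D ^ 2 * 2 ^ D ≤ Fintype.card Ω) {d : ℕ} (hd : d ≤ D) {f₀ u f₁ : Equiv.Perm Ω → ℝ}
    (hsum : f = f₀ + u + f₁) (hf₀ : f₀ ∈ lowSpace Ω d)
    (hu : u ∈ lowSpace Ω (d + 1)) (hu' : ∀ g ∈ lowSpace Ω d, ∑ x, u x * g x = 0)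
    (hf₁ : ∀ g ∈ lowSpace Ω (d + 1), ∑ x, f₁ x * g x = 0) :
    𝔼 x, u x ^ 2 ≤ 6 * μ ^ 2 * (1024 * D * p * (D * p + 1)) ^ D := by
  set n := Fintype.card Ω with hn
  have hD1 : 1 ≤ D := Nat.one_le_iff_ne_zero.2 hD
  have hp1 : 1 ≤ p := Nat.one_le_iff_ne_zero.2 hp
  have h8 : 8 * D ≤ n := by
    refine le_trans ?_ hn₂
    calc 8 * D = 8 * D * 1 * 1 := by ring
      _ ≤ 8 * D * D * 2 ^ D := by gcongr; exact Nat.one_le_two_pow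
      _ = _ := by ring
  have hnpos : 0 < n := by omega
  have : Nonempty Ω := Fintype.card_pos_iff.1 hnpos
  have hquad : 4 * d ^ 2 * 2 ^ d ≤ n := by
    refine le_trans ?_ hn₂
    gcongr <;> norm_num
  set κ := Fin (n / 4)
  have hκ : Fintype.card κ = n / 4 := Fintype.card_fin _
  obtain ⟨e, he⟩ : ∃ e : κ → Bool → Ω, PairInj Finset.univ e :=
    exists_pairInj (by rw [hκ]; omega)
  have h1 := (weightSum_le (κ := κ) hp hμ hμp d hd hf (hg.mono hd) (by rw [hκ]; omega)
    (by omega)).2 e he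
  have h2 := choose_mul_expect_sq_le_corr he (by omega) hquad hsum hf₀ hu hu' hf₁
  rw [hκ] at h2
  have h3 := pow_le_mul_choose_div_four hd h8
  have hnd : (0 : ℝ) < (n : ℝ) ^ d := by positivity
  have hM : (1 : ℝ) ≤ 1024 * D * p * (D * p + 1) := by
    have hDr : (1 : ℝ) ≤ D := by exact_mod_cast hD1
    have hpr : (1 : ℝ) ≤ p := by exact_mod_cast hp1
    have : (1 : ℝ) ≤ D * p := one_le_mul_of_one_le_of_one_le hDr hpr
    nlinarith
  have hu0 : 0 ≤ 𝔼 x, u x ^ 2 := expect_nonneg fun x => sq_nonneg _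
  have h4 : (n : ℝ) ^ d * 𝔼 x, u x ^ 2
      ≤ (n : ℝ) ^ d * ((8 * D) ^ d * (6 * μ ^ 2 * (2 * (64 * p * (D * p + 1))) ^ d)) := by
    calc (n : ℝ) ^ d * 𝔼 x, u x ^ 2
        ≤ (8 * D) ^ d * ((n / 4).choose d : ℝ) * 𝔼 x, u x ^ 2 := by gcongr
      _ = (n : ℝ) ^ d * ((8 * D) ^ d *
          (((n / 4).choose d : ℝ) * (((n : ℝ) ^ d)⁻¹ * 𝔼 x, u x ^ 2))) := by
          field_simp
      _ ≤ _ := by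
          refine mul_le_mul_of_nonneg_left (mul_le_mul_of_nonneg_left ?_ (by positivity)) hnd.le
          linarith
  calc 𝔼 x, u x ^ 2 ≤ (8 * D) ^ d * (6 * μ ^ 2 * (2 * (64 * p * (D * p + 1))) ^ d) :=
        le_of_mul_le_mul_left h4 hnd
    _ = 6 * μ ^ 2 * (1024 * D * p * (D * p + 1)) ^ d := by
        rw [show (1024 * D * p * (D * p + 1) : ℝ) = 8 * D * (2 * (64 * p * (D * p + 1))) by ring,
          mul_pow (8 * D : ℝ)]
        ring
    _ ≤ _ := by gcongr

theorem lowSpace_zero : lowSpace Ω 0 = ⊥ := by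
  have : IsEmpty {T : Finset Ω // T.card < 0} := ⟨fun T => absurd T.2 (Nat.not_lt_zero _)⟩
  exact iSup_of_empty _

/-- The level inequality on the symmetric group, stated as a bound for the correlation with
functions of degree at most `D`. -/
theorem sq_expect_mul_le {D p : ℕ} (hD : D ≠ 0) (hp : p ≠ 0) {μ : ℝ} (hμ : 0 < μ)
    (hμp : μ⁻¹ ≤ 3 ^ p) {f : Equiv.Perm Ω → ℝ} (hf : ∀ x, f x = 0 ∨ f x = 1)
    (hg : PermGlobal D μ f) (hn₁ : 4 * (D * p) + 2 * D ≤ Fintype.card Ω)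
    (hn₂ : 8 * D ^ 2 * 2 ^ D ≤ Fintype.card Ω) {v : Equiv.Perm Ω → ℝ}
    (hv : v ∈ lowSpace Ω (D + 1)) :
    (𝔼 x, f x * v x) ^ 2
      ≤ (D + 1) ^ 2 * (6 * μ ^ 2 * (1024 * D * p * (D * p + 1)) ^ D) * 𝔼 x, v x ^ 2 := by
  choose w hw hfw using fun d => exists_orthogonal_projection (lowSpace Ω d) f
  have hw0 : w 0 = 0 := by simpa [lowSpace_zero] using hw 0
  set u : ℕ → Equiv.Perm Ω → ℝ := fun d => w (d + 1) - w d with hu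
  have hsum : ∀ x, w (D + 1) x = ∑ d ∈ Finset.range (D + 1), u d x := by
    intro x
    have : ∑ d ∈ Finset.range (D + 1), u d x = w (D + 1) x - w 0 x :=
      Finset.sum_range_sub (fun d => w d x) (D + 1)
    rw [this, hw0]; simp
  have hud : ∀ d ≤ D, 𝔼 x, u d x ^ 2 ≤ 6 * μ ^ 2 * (1024 * D * p * (D * p + 1)) ^ D := by
    intro d hd
    refine expect_pure_sq_le hD hp hμ hμp hf hg hn₁ hn₂ hd (f₀ := w d) (f₁ := f - w (d + 1))
      (by simp [hu]) (hw d) (sub_mem (hw (d + 1)) (lowSpace_mono (Nat.le_succ d) (hw d)))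
      (fun g hg => ?_) (fun g hg => hfw (d + 1) g hg)
    have h1 := hfw d g hg
    have h2 := hfw (d + 1) g (lowSpace_mono (Nat.le_succ d) hg)
    rw [← sub_eq_zero.2 (h1.trans h2.symm), ← Finset.sum_sub_distrib]
    exact Finset.sum_congr rfl fun x _ => by simp only [hu, Pi.sub_apply]; ring
  have hfv : 𝔼 x, f x * v x = 𝔼 x, w (D + 1) x * v x := by
    have h := hfw (D + 1) v hv
    rw [Fintype.expect_eq_sum_div_card, Fintype.expect_eq_sum_div_card]
    congr 1
    rw [← sub_eq_zero, ← Finset.sum_sub_distrib, ← h]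
    exact Finset.sum_congr rfl fun x _ => by ring
  have hw2 : 𝔼 x, w (D + 1) x ^ 2
      ≤ (D + 1) ^ 2 * (6 * μ ^ 2 * (1024 * D * p * (D * p + 1)) ^ D) := by
    calc 𝔼 x, w (D + 1) x ^ 2
        ≤ 𝔼 x, (D + 1 : ℝ) * ∑ d ∈ Finset.range (D + 1), u d x ^ 2 := by
          refine expect_mono fun x => ?_
          rw [hsum x]
          have := sq_sum_le_card_mul_sum_sq (s := Finset.range (D + 1)) (f := fun d => u d x)
          rw [Finset.card_range] at this
          exact_mod_cast this
      _ = (D + 1 : ℝ) * ∑ d ∈ Finset.range (D + 1), 𝔼 x, u d x ^ 2 := by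
          rw [← Finset.mul_expect, Finset.expect_sum_comm]
      _ ≤ (D + 1 : ℝ) * ∑ _d ∈ Finset.range (D + 1),
          6 * μ ^ 2 * (1024 * D * p * (D * p + 1)) ^ D := by
          refine mul_le_mul_of_nonneg_left (Finset.sum_le_sum fun d hd => ?_) (by positivity)
          exact hud d (Nat.lt_succ_iff.1 (Finset.mem_range.1 hd))
      _ = _ := by
          rw [Finset.sum_const, Finset.card_range, nsmul_eq_mul]
          push_cast; ring
  rw [hfv]
  have hcs := Finset.expect_mul_sq_le_sq_mul_sq Finset.univ (w (D + 1)) v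
  exact hcs.trans (mul_le_mul_of_nonneg_right hw2 (expect_nonneg fun x => sq_nonneg _))

/-- In degree `0` the level inequality is exact. -/
theorem sq_expect_mul_le_of_const {μ : ℝ} {f : Equiv.Perm Ω → ℝ}
    (hf : ∀ x, 0 ≤ f x) (hg : PermGlobal 0 μ f) {v : Equiv.Perm Ω → ℝ} (hv : v ∈ lowSpace Ω 1) :
    (𝔼 x, f x * v x) ^ 2 ≤ μ ^ 2 * 𝔼 x, v x ^ 2 := by
  have hle : lowSpace Ω 1 ≤ juntaSpace ∅ := iSup_le fun T => by
    rw [Finset.card_eq_zero.1 (Nat.lt_one_iff.1 T.2)]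
  have hc : ∀ x, v x = v 1 := fun x => eq_of_mem_juntaSpace (hle hv) (by simp)
  simp_rw [hc, ← Finset.expect_mul, Fintype.expect_const, mul_pow]
  have h1 : 0 ≤ 𝔼 x, f x := expect_nonneg hf
  have h2 := hg.expect_le
  gcongr

/-- Globalness under restrictions of a set of size exactly `d` entails it for smaller sets. -/
theorem permGlobal_of_card_eq {d d' : ℕ} (hdd : d ≤ d') (hd' : d' ≤ Fintype.card Ω) {μ : ℝ}
    {f : Equiv.Perm Ω → ℝ}
    (h : ∀ R : Finset Ω, R.card = d' → ∀ x₀ : Equiv.Perm Ω,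
      ∑ x : Equiv.Perm Ω, (if ∀ y ∈ R, x y = x₀ y then f x else 0)
        ≤ μ * ((Fintype.card Ω - d').factorial : ℝ)) : PermGlobal d μ f := by
  intro Q hQ x₀
  obtain ⟨R, hQR, _, hR⟩ := Finset.exists_subsuperset_card_eq (Finset.subset_univ Q)
    (hQ.trans hdd) (by simpa using hd')
  have hpos : (0 : ℝ) < (Fintype.card Ω - d').factorial := by positivity
  have hone : ∀ x : Equiv.Perm Ω, ∑ x₁ : Equiv.Perm Ω, (if ∀ y ∈ R, x y = x₁ y then (1 : ℝ) else 0)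
      = (Fintype.card Ω - d').factorial := by
    intro x
    rw [← hR, ← sum_agree_one R x]
    exact Finset.sum_congr rfl fun x₁ _ => if_congr (forall₂_congr fun y _ => eq_comm) rfl rfl
  refine le_of_mul_le_mul_right ?_ hpos
  calc (∑ x : Equiv.Perm Ω, (if ∀ y ∈ Q, x y = x₀ y then f x else 0))
        * (Fintype.card Ω - d').factorial
      = ∑ x : Equiv.Perm Ω, ∑ x₁ : Equiv.Perm Ω, (if ∀ y ∈ Q, x y = x₀ y then f x else 0) *
          (if ∀ y ∈ R, x y = x₁ y then (1 : ℝ) else 0) := by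
        rw [Finset.sum_mul]
        exact Finset.sum_congr rfl fun x _ => by rw [← Finset.mul_sum, hone]
    _ = ∑ x₁ : Equiv.Perm Ω, if ∀ y ∈ Q, x₁ y = x₀ y then
          ∑ x : Equiv.Perm Ω, (if ∀ y ∈ R, x y = x₁ y then f x else 0) else 0 := by
        rw [Finset.sum_comm]
        refine Finset.sum_congr rfl fun x₁ _ => ?_
        have hQ' : ∀ x : Equiv.Perm Ω, (∀ y ∈ R, x y = x₁ y) →
            ((∀ y ∈ Q, x y = x₀ y) ↔ ∀ y ∈ Q, x₁ y = x₀ y) := fun x hx =>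
          forall₂_congr fun y hy => by rw [hx y (hQR hy)]
        split_ifs with h1
        · refine Finset.sum_congr rfl fun x _ => ?_
          by_cases hx : ∀ y ∈ R, x y = x₁ y
          · rw [if_pos ((hQ' x hx).2 h1), if_pos hx, if_pos hx, mul_one]
          · rw [if_neg hx, if_neg hx, mul_zero]
        · refine Finset.sum_eq_zero fun x _ => ?_
          by_cases hx : ∀ y ∈ R, x y = x₁ y
          · rw [if_neg (fun h => h1 ((hQ' x hx).1 h)), zero_mul]
          · rw [if_neg hx, mul_zero]
    _ ≤ ∑ x₁ : Equiv.Perm Ω, if ∀ y ∈ Q, x₁ y = x₀ y then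
          μ * ((Fintype.card Ω - d').factorial : ℝ) else 0 := by
        refine Finset.sum_le_sum fun x₁ _ => ?_
        split_ifs
        · exact h R hR x₁
        · exact le_rfl
    _ = μ * (Fintype.card Ω - Q.card).factorial * (Fintype.card Ω - d').factorial := by
        rw [← sum_agree_one Q x₀, Finset.mul_sum, Finset.sum_mul]
        exact Finset.sum_congr rfl fun x₁ _ => by split_ifs <;> simp

end PermLevel

/-! ### The multi-slice as a quotient of the symmetric group -/

namespace MultiSlice

open ProductSpace PermLevel

variable {n m : ℕ} {k : Fin m → ℕ}

/-- The action of permutations on the points of the multi-slice, by permuting the coordinates. -/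
def act (x₀ : MultiSlice n k) (π : Equiv.Perm (Fin n)) : MultiSlice n k :=
  ⟨fun i => x₀.1 (π i), fun j => by
    rw [← x₀.2 j]
    exact Finset.card_bij (fun i _ => π i) (by simp) (fun i _ i' _ h => π.injective h)
      fun i hi => ⟨π.symm i, by simpa using hi, by simp⟩⟩

/-- The permutations that fix `R` pointwise act transitively on the points with prescribed
coordinates in `R`. -/
theorem exists_act_eq {z z' : MultiSlice n k} {R : Finset (Fin n)} (h : ∀ i ∈ R, z.1 i = z'.1 i) :
    ∃ σ : Equiv.Perm (Fin n), (∀ i ∈ R, σ i = i) ∧ act z σ = z' := by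
  have hcard : ∀ j, Fintype.card {i : {i // i ∉ R} // z'.1 i = j}
      = Fintype.card {i : {i // i ∉ R} // z.1 i = j} := by
    have key : ∀ (y : MultiSlice n k) (j : Fin m), Fintype.card {i : {i // i ∉ R} // y.1 i = j}
        + (R.filter fun i => y.1 i = j).card = k j := by
      intro y j
      rw [← y.2 j, ← Finset.card_filter_add_card_filter_not (s := Finset.univ.filter fun i => y.1 i = j)
        (fun i => i ∉ R)]
      congr 1
      · rw [Fintype.card_congr (Equiv.subtypeSubtypeEquivSubtypeInter (fun i => i ∉ R)
          fun i => y.1 i = j), Fintype.card_subtype, Finset.filter_filter]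
        congr 1
        ext i; simp [and_comm]
      · congr 1
        ext i; simp [and_comm]
    intro j
    have h1 := key z j
    have h2 := key z' j
    rw [Finset.filter_congr fun i hi => by rw [h i hi]] at h1
    omega
  let τ : Equiv.Perm {i // i ∉ R} := Equiv.ofFiberEquiv (f := fun i => z'.1 i.1)
    (g := fun i => z.1 i.1) fun j => Fintype.equivOfCardEq (hcard j)
  have hτ : ∀ i : {i // i ∉ R}, z.1 (τ i) = z'.1 i :=
    fun i => Equiv.ofFiberEquiv_map (g := fun i : {i // i ∉ R} => z.1 i.1) _ i
  refine ⟨Equiv.Perm.ofSubtype τ, fun i hi => ?_, Subtype.ext (funext fun i => ?_)⟩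
  · exact Equiv.Perm.ofSubtype_apply_of_not_mem τ (by simpa using hi)
  · change z.1 (Equiv.Perm.ofSubtype τ i) = z'.1 i
    by_cases hi : i ∈ R
    · rw [Equiv.Perm.ofSubtype_apply_of_not_mem τ (by simpa using hi), h i hi]
    · rw [Equiv.Perm.ofSubtype_apply_of_mem τ hi, hτ]

/-- Averages over the permutations with prescribed values on `R` are averages over the points of
the multi-slice with prescribed coordinates in `R`. -/
theorem card_mul_sum_act (x₀ : MultiSlice n k) (R : Finset (Fin n)) (π₀ : Equiv.Perm (Fin n))
    (f : MultiSlice n k → ℝ) :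
    ((Finset.univ.filter fun z : MultiSlice n k => ∀ i ∈ R, z.1 i = x₀.1 (π₀ i)).card : ℝ) *
      ∑ π : Equiv.Perm (Fin n), (if ∀ i ∈ R, π i = π₀ i then f (act x₀ π) else 0)
      = ((n - R.card).factorial : ℝ) *
        ∑ z ∈ Finset.univ.filter fun z : MultiSlice n k => ∀ i ∈ R, z.1 i = x₀.1 (π₀ i), f z := by
  classical
  set B := Finset.univ.filter fun z : MultiSlice n k => ∀ i ∈ R, z.1 i = x₀.1 (π₀ i) with hB
  set W := Finset.univ.filter fun π : Equiv.Perm (Fin n) => ∀ i ∈ R, π i = π₀ i with hW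
  have hmaps : ∀ π ∈ W, act x₀ π ∈ B := by
    intro π hπ
    simp only [hB, hW, Finset.mem_filter, Finset.mem_univ, true_and] at hπ ⊢
    exact fun i hi => congrArg x₀.1 (hπ i hi)
  have hconst : ∀ z ∈ B, (W.filter fun π => act x₀ π = z).card
      = (W.filter fun π => act x₀ π = act x₀ π₀).card := by
    intro z hz
    simp only [hB, Finset.mem_filter, Finset.mem_univ, true_and] at hz
    obtain ⟨σ, hσ, hσz⟩ := exists_act_eq (z := act x₀ π₀) (z' := z) (R := R)
      fun i hi => (hz i hi).symm
    symm
    refine Finset.card_bij (fun π _ => π * σ) (fun π hπ => ?_) (fun π _ π' _ h => mul_right_cancel h)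
      fun π hπ => ⟨π * σ⁻¹, ?_, by simp⟩
    · simp only [hW, Finset.mem_filter, Finset.mem_univ, true_and] at hπ ⊢
      refine ⟨fun i hi => by rw [Equiv.Perm.mul_apply, hσ i hi, hπ.1 i hi], ?_⟩
      rw [← hσz, ← hπ.2]; rfl
    · simp only [hW, Finset.mem_filter, Finset.mem_univ, true_and] at hπ ⊢
      have hσ' : ∀ i ∈ R, σ⁻¹ i = i := fun i hi => by
        rw [Equiv.Perm.inv_eq_iff_eq, hσ i hi]
      refine ⟨fun i hi => by rw [Equiv.Perm.mul_apply, hσ' i hi, hπ.1 i hi], ?_⟩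
      have h1 : act (act x₀ (π * σ⁻¹)) σ = act (act x₀ π₀) σ := by
        rw [hσz, ← hπ.2]
        refine Subtype.ext (funext fun i => ?_)
        simp [act]
      refine Subtype.ext (funext fun i => ?_)
      have := congrFun (congrArg Subtype.val h1) (σ⁻¹ i)
      simpa [act] using this
  set c := (W.filter fun π => act x₀ π = act x₀ π₀).card with hc
  have hsum : ∀ g : MultiSlice n k → ℝ, ∑ π ∈ W, g (act x₀ π) = c * ∑ z ∈ B, g z := by
    intro g
    rw [← Finset.sum_fiberwise_of_maps_to hmaps, Finset.mul_sum]
    refine Finset.sum_congr rfl fun z hz => ?_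
    rw [← hconst z hz, ← nsmul_eq_mul, ← Finset.sum_const]
    exact Finset.sum_congr rfl fun π hπ => by rw [(Finset.mem_filter.1 hπ).2]
  have hWcard : ((n - R.card).factorial : ℝ) = c * B.card := by
    have h1 : ∑ π ∈ W, (1 : ℝ) = ((n - R.card).factorial : ℝ) := by
      rw [hW, Finset.sum_filter]
      refine (Finset.sum_congr rfl fun π _ => by congr).trans
        ((sum_agree_one R π₀).trans ?_)
      rw [Fintype.card_fin]
    rw [← h1, hsum fun _ => 1]
    simp
  rw [← Finset.sum_filter, hsum f, hWcard]
  ring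

theorem expect_act (x₀ : MultiSlice n k) (f : MultiSlice n k → ℝ) :
    𝔼 π : Equiv.Perm (Fin n), f (act x₀ π) = 𝔼 z, f z := by
  have h := card_mul_sum_act x₀ ∅ 1 f
  simp only [Finset.notMem_empty, false_imp_iff, implies_true, if_true, Finset.filter_true,
    Finset.card_univ, Finset.card_empty, Nat.sub_zero] at h
  have : Nonempty (MultiSlice n k) := ⟨x₀⟩
  have hpos : (0 : ℝ) < Fintype.card (MultiSlice n k) := by exact_mod_cast Fintype.card_pos
  rw [Fintype.expect_eq_sum_div_card, Fintype.expect_eq_sum_div_card, Fintype.card_perm,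
    Fintype.card_fin, div_eq_div_iff (by positivity) hpos.ne']
  linarith

theorem permGlobal_comp_act {d d' : ℕ} (hdd : d ≤ d') (hn : d' ≤ n) {ε : ℝ} (hε : 0 < ε)
    {f : MultiSlice n k → ℝ} (hf : ∀ x, f x = 0 ∨ f x = 1) (hg : IsGlobal d' ε f)
    (x₀ : MultiSlice n k) : PermGlobal d (ε ^ 2) fun π => f (act x₀ π) := by
  classical
  refine permGlobal_of_card_eq hdd (by simpa using hn) fun R hR π₀ => ?_
  rw [Fintype.card_fin]
  have h := card_mul_sum_act x₀ R π₀ f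
  set B := Finset.univ.filter fun z : MultiSlice n k => ∀ i ∈ R, z.1 i = x₀.1 (π₀ i) with hB
  have hBne : B.Nonempty := ⟨act x₀ π₀, Finset.mem_filter.2 ⟨Finset.mem_univ _, fun _ _ => rfl⟩⟩
  have hBpos : (0 : ℝ) < B.card := by exact_mod_cast hBne.card_pos
  have h1 : ∑ z ∈ B, f z ≤ B.card * ε ^ 2 := by
    have h2 := hg R (fun i => x₀.1 (π₀ i)) hR
    rw [l2Norm, Real.sqrt_le_left hε.le, Fintype.expect_eq_sum_div_card] at h2
    have hmem : ∀ z : MultiSlice n k, z ∈ B ↔ ∀ i : R, z.1 i = x₀.1 (π₀ i) := by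
      intro z; simp [hB]
    have hcard : Fintype.card (Sub k R fun i => x₀.1 (π₀ i)) = B.card :=
      Fintype.card_of_subtype B hmem
    rw [hcard, div_le_iff₀ hBpos] at h2
    have hs : ∑ z ∈ B, f z = ∑ z : Sub k R fun i => x₀.1 (π₀ i),
        restrict f R (fun i => x₀.1 (π₀ i)) z ^ 2 := by
      rw [Finset.sum_subtype B hmem]
      refine Finset.sum_congr rfl fun z _ => ?_
      rcases hf z.1 with hz | hz <;> simp [restrict, hz]
    rw [hs]
    linarith
  refine le_of_mul_le_mul_left (le_of_eq_of_le
    ((congrArg _ (Finset.sum_congr rfl fun π _ => by congr)).trans h) ?_) hBpos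
  rw [hR]
  calc ((n - d').factorial : ℝ) * ∑ z ∈ B, f z ≤ ((n - d').factorial : ℝ) * (B.card * ε ^ 2) := by
        gcongr
    _ = _ := by ring

theorem comp_act_mem_lowSpace {d : ℕ} (x₀ : MultiSlice n k) {g : MultiSlice n k → ℝ}
    (hg : g ∈ degreeSpace n k d) :
    (fun π => g (act x₀ π)) ∈ lowSpace (Fin n) (d + 1) := by
  have hle : degreeSpace n k d
      ≤ (lowSpace (Fin n) (d + 1)).comap (LinearMap.funLeft ℝ ℝ (act x₀)) := by
    refine Submodule.span_le.2 ?_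
    rintro g ⟨A, hA, g', hg'⟩
    refine juntaSpace_le_lowSpace (Nat.lt_succ_of_le hA) fun σ hσ π => ?_
    simp only [LinearMap.funLeft_apply, hg']
    congr 1
    funext i
    simp [act, hσ i i.2]
  exact hle hg

/-- A bound for the correlations of `f` with functions of degree at most `d`, in the symmetric group,
is a bound for the low degree part of `f`. -/
theorem l2Norm_lowDegreePart_sq_le {d : ℕ} {f : MultiSlice n k → ℝ} (x₀ : MultiSlice n k) {K : ℝ}
    (hK : 0 ≤ K) (h : ∀ v ∈ lowSpace (Fin n) (d + 1),
      (𝔼 π, f (act x₀ π) * v π) ^ 2 ≤ K * 𝔼 π, v π ^ 2) :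
    l2Norm (lowDegreePart d f) ^ 2 ≤ K := by
  have hE0 : 0 ≤ 𝔼 z, lowDegreePart d f z ^ 2 := expect_nonneg fun z => sq_nonneg _
  rw [l2Norm, Real.sq_sqrt hE0]
  have h1 := h _ (comp_act_mem_lowSpace x₀ (lowDegreePart_mem d f))
  rw [expect_act x₀ fun z => f z * lowDegreePart d f z,
    expect_act x₀ fun z => lowDegreePart d f z ^ 2] at h1
  have h2 := expect_sub_lowDegreePart_mul d f _ (lowDegreePart_mem d f)
  have h3 : 𝔼 z, f z * lowDegreePart d f z = 𝔼 z, lowDegreePart d f z ^ 2 := by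
    rw [← sub_eq_zero, ← Finset.expect_sub_distrib, ← h2]
    exact Finset.expect_congr rfl fun z _ => by ring
  rw [h3, sq] at h1
  rcases hE0.eq_or_lt with h0 | h0
  · rwa [← h0]
  · exact le_of_mul_le_mul_right h1 h0

end MultiSlice

/-! ### The choice of the constant -/

namespace LevelConstants

/-- The logarithm `L = log (1 / ε)` may be less than `1`, so that high powers of it may be small; this
lower bound for `L` limits the loss. -/
theorem two_rpow_le_log_two : (2 : ℝ) ^ (-(3 / 4) : ℝ) ≤ Real.log 2 := by
  have h1 : ((2 : ℝ) ^ (-(3 / 4) : ℝ)) ^ 4 = 1 / 8 := by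
    rw [← Real.rpow_natCast, ← Real.rpow_mul (by norm_num)]
    rw [show (-(3 / 4) * ((4 : ℕ) : ℝ)) = ((-3 : ℤ) : ℝ) by norm_num, Real.rpow_intCast]
    norm_num
  have h2 : (2 : ℝ) ^ (-(3 / 4) : ℝ) ≤ 0.6 := by
    refine le_of_pow_le_pow_left₀ (n := 4) (by norm_num) (by norm_num) ?_
    rw [h1]; norm_num
  linarith [Real.log_two_gt_d9]

/-- A part of a power of `L` can be traded for a power of `2`. -/
theorem mul_rpow_le_rpow {L : ℝ} (hL : (2 : ℝ) ^ (-(3 / 4) : ℝ) ≤ L) {s t : ℝ} (hst : s ≤ t) :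
    L ^ s * 2 ^ (-(3 / 4) * (t - s)) ≤ L ^ t := by
  have h0 : (0 : ℝ) < L := lt_of_lt_of_le (by positivity) hL
  rw [Real.rpow_mul (by norm_num), show t = s + (t - s) by ring, Real.rpow_add h0,
    show s + (t - s) - s = t - s by ring]
  refine mul_le_mul_of_nonneg_left ?_ (by positivity)
  exact Real.rpow_le_rpow (by positivity) hL (by linarith)

theorem le_of_rpow_mul_log_rpow_le {D n : ℕ} (hD : D ≠ 0) {L : ℝ}
    (hL : (2 : ℝ) ^ (-(3 / 4) : ℝ) ≤ L)
    (hn : (2 : ℝ) ^ (100 * (D : ℝ) ^ 3) * L ^ (100 * (D : ℝ)) ≤ n) :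
    8 * D ^ 2 * 2 ^ D ≤ n ∧ 20 * D * L ≤ n := by
  have hD1 : (1 : ℝ) ≤ D := by exact_mod_cast Nat.one_le_iff_ne_zero.2 hD
  have hD3 : (D : ℝ) ≤ D ^ 3 := le_self_pow₀ hD1 (by norm_num)
  have h0 : (0 : ℝ) < L := lt_of_lt_of_le (by positivity) hL
  have h2D : (D : ℝ) ≤ 2 ^ D := by exact_mod_cast Nat.lt_two_pow_self.le
  constructor
  · have h1 : (8 * D ^ 2 * 2 ^ D : ℝ) ≤ n := by
      calc (8 * D ^ 2 * 2 ^ D : ℝ) ≤ 2 ^ 3 * (2 ^ D) ^ 2 * 2 ^ D := by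
            gcongr; norm_num
        _ = 2 ^ (((3 + 3 * D : ℕ) : ℝ)) := by rw [Real.rpow_natCast]; ring
        _ ≤ 2 ^ (100 * (D : ℝ) ^ 3 + -(3 / 4) * (100 * D - 0)) := by
            refine Real.rpow_le_rpow_of_exponent_le (by norm_num) ?_
            push_cast; linarith
        _ = 2 ^ (100 * (D : ℝ) ^ 3) * (L ^ (0 : ℝ) * 2 ^ (-(3 / 4) * (100 * (D : ℝ) - 0))) := by
            rw [Real.rpow_add (by norm_num), Real.rpow_zero, one_mul]
        _ ≤ 2 ^ (100 * (D : ℝ) ^ 3) * L ^ (100 * (D : ℝ)) :=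
            mul_le_mul_of_nonneg_left (mul_rpow_le_rpow hL (by linarith)) (by positivity)
        _ ≤ n := hn
    exact_mod_cast h1
  · calc 20 * D * L ≤ 2 ^ 5 * 2 ^ D * L := by gcongr; norm_num
      _ = 2 ^ (((5 + D : ℕ) : ℝ)) * L := by rw [Real.rpow_natCast]; ring
      _ ≤ 2 ^ (100 * (D : ℝ) ^ 3 + -(3 / 4) * (100 * D - 1)) * L := by
          refine mul_le_mul_of_nonneg_right
            (Real.rpow_le_rpow_of_exponent_le (by norm_num) ?_) h0.le
          push_cast; linarith
      _ = 2 ^ (100 * (D : ℝ) ^ 3) * (L ^ (1 : ℝ) * 2 ^ (-(3 / 4) * (100 * (D : ℝ) - 1))) := by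
          rw [Real.rpow_add (by norm_num), Real.rpow_one]; ring
      _ ≤ 2 ^ (100 * (D : ℝ) ^ 3) * L ^ (100 * (D : ℝ)) :=
          mul_le_mul_of_nonneg_left (mul_rpow_le_rpow hL (by linarith)) (by positivity)
      _ ≤ n := hn

theorem level_constant_le {D p : ℕ} (hD : D ≠ 0) (hp : p ≠ 0) {L : ℝ}
    (hL : (2 : ℝ) ^ (-(3 / 4) : ℝ) ≤ L) (hpL : p ≤ 4 * L) :
    (D + 1 : ℝ) ^ 2 * (6 * (1024 * D * p * (D * p + 1)) ^ D)
      ≤ 2 ^ (100 * (D : ℝ) ^ 4) * L ^ (100 * (D : ℝ)) := by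
  have hD1 : (1 : ℝ) ≤ D := by exact_mod_cast Nat.one_le_iff_ne_zero.2 hD
  have hp1 : (1 : ℝ) ≤ p := by exact_mod_cast Nat.one_le_iff_ne_zero.2 hp
  have hDp : (1 : ℝ) ≤ D * p := one_le_mul_of_one_le_of_one_le hD1 hp1
  have h0 : (0 : ℝ) < L := lt_of_lt_of_le (by positivity) hL
  have h2D : (D : ℝ) ≤ 2 ^ D := by exact_mod_cast Nat.lt_two_pow_self.le
  have h2D' : (D + 1 : ℝ) ≤ 2 ^ D := by exact_mod_cast Nat.lt_two_pow_self
  have hD4 : (D : ℝ) ≤ D ^ 4 := le_self_pow₀ hD1 (by norm_num)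
  have hD24 : (D : ℝ) ^ 2 ≤ D ^ 4 := pow_le_pow_right₀ hD1 (by norm_num)
  have hbase : (1024 * D * p * (D * p + 1) : ℝ) ≤ 2 ^ (15 + 2 * D) * L ^ 2 := by
    calc (1024 * D * p * (D * p + 1) : ℝ) = 1024 * (D * p) * (D * p + 1) := by ring
      _ ≤ 1024 * (D * p) * (D * p + D * p) := by gcongr
      _ ≤ 1024 * (2 ^ D * (4 * L)) * (2 ^ D * (4 * L) + 2 ^ D * (4 * L)) := by gcongr
      _ = _ := by ring
  calc (D + 1 : ℝ) ^ 2 * (6 * (1024 * D * p * (D * p + 1)) ^ D)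
      ≤ (2 ^ D) ^ 2 * (2 ^ 3 * (2 ^ (15 + 2 * D) * L ^ 2) ^ D) := by
        gcongr; norm_num
    _ = 2 ^ (((3 + 17 * D + 2 * D ^ 2 : ℕ) : ℝ)) * L ^ (((2 * D : ℕ) : ℝ)) := by
        rw [Real.rpow_natCast, Real.rpow_natCast, mul_pow, ← pow_mul, ← pow_mul, ← pow_mul]
        rw [show 3 + 17 * D + 2 * D ^ 2 = D * 2 + (3 + (15 + 2 * D) * D) by ring, pow_add, pow_add]
        ring
    _ ≤ 2 ^ (100 * (D : ℝ) ^ 4 + -(3 / 4) * (100 * D - (2 * D : ℕ))) * L ^ (((2 * D : ℕ) : ℝ)) := by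
        refine mul_le_mul_of_nonneg_right
          (Real.rpow_le_rpow_of_exponent_le (by norm_num) ?_) (by positivity)
        push_cast; linarith
    _ = 2 ^ (100 * (D : ℝ) ^ 4) *
          (L ^ (((2 * D : ℕ) : ℝ)) * 2 ^ (-(3 / 4) * (100 * (D : ℝ) - (2 * D : ℕ)))) := by
        rw [Real.rpow_add (by norm_num)]; ring
    _ ≤ _ := by
        refine mul_le_mul_of_nonneg_left (mul_rpow_le_rpow hL ?_) (by positivity)
        push_cast; linarith

end LevelConstants

theorem mainTheorem10 :
    ∃ C : ℝ, 0 < C ∧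
      ∀ (d n : ℕ) (ε : ℝ), 0 < ε → ε ≤ 1 / 2 →
        (2 : ℝ) ^ (C * (d : ℝ) ^ 3) * Real.log (1 / ε) ^ (C * (d : ℝ)) ≤ (n : ℝ) →
        ∀ (m : ℕ) (k : Fin m → ℕ), ∑ j, k j = n →
          ∀ f : MultiSlice n k → ℝ, (∀ x, f x = 0 ∨ f x = 1) →
            MultiSlice.IsGlobal (2 * d) ε f →
            MultiSlice.l2Norm (MultiSlice.lowDegreePart d f) ^ 2 ≤
              (2 : ℝ) ^ (C * (d : ℝ) ^ 4) * ε ^ 4 * Real.log (1 / ε) ^ (C * (d : ℝ)) := by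
  refine ⟨100, by norm_num, fun d n ε hε hε2 hn m k _ f hf hg => ?_⟩
  set L := Real.log (1 / ε) with hLdef
  have hL2 : Real.log 2 ≤ L := by
    refine Real.log_le_log (by norm_num) ?_
    rw [le_div_iff₀ hε]; linarith
  have hL : (2 : ℝ) ^ (-(3 / 4) : ℝ) ≤ L := LevelConstants.two_rpow_le_log_two.trans hL2
  have hLhalf : 1 / 2 ≤ L := by linarith [Real.log_two_gt_d9]
  rcases isEmpty_or_nonempty (MultiSlice n k) with hU | ⟨⟨x₀⟩⟩
  · have : MultiSlice.l2Norm (MultiSlice.lowDegreePart d f) = 0 := by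
      simp [MultiSlice.l2Norm, Finset.univ_eq_empty]
    rw [this, zero_pow two_ne_zero]
    positivity
  refine MultiSlice.l2Norm_lowDegreePart_sq_le x₀ (by positivity) fun v hv => ?_
  have hμ : (0 : ℝ) < ε ^ 2 := by positivity
  rcases eq_or_ne d 0 with rfl | hd
  · have h := PermLevel.sq_expect_mul_le_of_const (f := fun π => f (x₀.act π))
      (fun π => by rcases hf (x₀.act π) with h | h <;> simp [h])
      (MultiSlice.permGlobal_comp_act le_rfl (Nat.zero_le n) hε hf hg x₀) hv
    refine h.trans (le_of_eq ?_)
    simp only [Nat.cast_zero]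
    norm_num
    left; ring
  obtain ⟨hn₁, hn₂⟩ := LevelConstants.le_of_rpow_mul_log_rpow_le hd hL hn
  -- With this `p` the bound `(ε ^ 2)⁻¹ ≤ 3 ^ p` holds, as `ε = exp (-L)`.
  set p := ⌈2 * L⌉₊ with hpdef
  have hp : p ≠ 0 := (Nat.ceil_pos.2 (by linarith)).ne'
  have hpL : (p : ℝ) ≤ 4 * L := by
    have := Nat.ceil_lt_add_one (show 0 ≤ 2 * L by linarith)
    linarith
  have hμp : (ε ^ 2)⁻¹ ≤ 3 ^ p := by
    have h1 : (ε ^ 2)⁻¹ = Real.exp (2 * L) := by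
      rw [hLdef, one_div, Real.log_inv, show 2 * -Real.log ε = -(Real.log ε + Real.log ε) by ring,
        Real.exp_neg, Real.exp_add, Real.exp_log hε, sq]
    rw [h1]
    calc Real.exp (2 * L) ≤ Real.exp p := Real.exp_le_exp.2 (Nat.le_ceil _)
      _ = Real.exp 1 ^ p := by rw [← Real.exp_nat_mul, mul_one]
      _ ≤ 3 ^ p := by gcongr; linarith [Real.exp_one_lt_d9]
  have hd1 : (1 : ℝ) ≤ d := by exact_mod_cast Nat.one_le_iff_ne_zero.2 hd
  have hn₃ : 4 * (d * p) + 2 * d ≤ n := by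
    have : (4 * (d * p) + 2 * d : ℝ) ≤ n := by
      calc (4 * (d * p) + 2 * d : ℝ) ≤ 4 * (d * (4 * L)) + 2 * d * (2 * L) := by
            refine add_le_add (by gcongr) (le_mul_of_one_le_right (by positivity) (by linarith))
        _ = 20 * d * L := by ring
        _ ≤ n := hn₂
    exact_mod_cast this
  have h := PermLevel.sq_expect_mul_le hd hp hμ hμp (f := fun π => f (x₀.act π)) (fun π => hf _)
    (MultiSlice.permGlobal_comp_act (by omega) (by omega) hε hf hg x₀)
    (by rwa [Fintype.card_fin]) (by rwa [Fintype.card_fin]) hv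
  refine h.trans (mul_le_mul_of_nonneg_right ?_ (Finset.expect_nonneg fun π _ => sq_nonneg _))
  calc (d + 1 : ℝ) ^ 2 * (6 * (ε ^ 2) ^ 2 * (1024 * d * p * (d * p + 1)) ^ d)
      = ε ^ 4 * ((d + 1 : ℝ) ^ 2 * (6 * (1024 * d * p * (d * p + 1)) ^ d)) := by ring
    _ ≤ ε ^ 4 * (2 ^ (100 * (d : ℝ) ^ 4) * L ^ (100 * (d : ℝ))) := by
        exact mul_le_mul_of_nonneg_left (LevelConstants.level_constant_le hd hp hL hpL)
          (by positivity)
    _ = _ := by ring
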